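/- A triple $(\Sigma,g,r)$, consisting of a smooth $n$-dimensional manifold $\Sigma$ with $n\ge 2$, a $C^1$ Riemannian metric $g$ on $\Sigma$, and a proper unbounded $C^2$ function $r:\Sigma\to(R_\Sigma,\infty)$ with $R_\Sigma\ge 1$, is called a *weakly conical end* if there is a constant $\Lambda\ge 0$ such that on $\Sigma$ $$\big||\nabla_g r|-1\big|\le \frac{\Lambda}{r^4}\le\frac12\qquad\text{and}\qquad |\nabla_g^2 r^2-2g|\le\frac{\Lambda}{r^2}\le\frac12 ,$$ where the norm of the 2-tensor is $|T|^2=g^{ik}g^{jl}T_{ij}T_{kl}$. For such an end put $\bar E_R=\{p: r(p)\ge R\}$ and $S_\rho=\{p: r(p)=\rho\}$. For $m\in\mathbb R$ let $\Phi_m(t)=t^me^{-t^2/4}$ and $\Psi_m(t)=t^me^{t^2/4}$, also regarded as functions on $\Sigma$ by composition with $r$. Let $\partial_r=\nabla_g r$ and $$\mathcal L_0^+=\Delta_g+\frac r2\,\partial_r .$$ For $R>R_\Sigma$ and $m\in\mathbb R$ let $C^2_{m,1}(\bar E_R)$ be the set of all $f\in C^2(\bar E_R)$ (twice continuously differentiable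 up to the boundary) with $$\int_{\bar E_R} f^2\,\Phi_m+\int_{\bar E_R}|\nabla_g f|^2\,\Phi_m<\infty .$$ **Theorem.** Let $(\Sigma,g,r)$ be a weakly conical end, $R>R_\Sigma$, $\lambda,M\in\mathbb R$, and let $u\in C^2(\bar E_R)$ satisfy $$\left|(\mathcal L_0^++\lambda)u\right|\le M\,r^{-1}\left(|u|+|\nabla_g u|\right)\quad\text{on }\bar E_R$$ and $$B(\rho):=\int_{S_\rho}u^2\,|\nabla_g r| = o\!\left(\rho^{-4\lambda+n-1}\right)\quad\text{as }\rho\to\infty ,$$ the integral being taken with respect to the $(n-1)$-dimensional Riemannian area of $S_\rho$. Then, for every $m'\in\mathbb R$, the function $\Psi_0u=e^{r^2/4}u$ belongs to $C^2_{m',1}(\bar E_R)$. -/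

import Mathlib

open Set Filter MeasureTheory Manifold Asymptotics
open scoped Topology ContDiff ENNReal

noncomputable section

namespace ConicalEnd

/-! ### Riemannian geometry in a coordinate domain

`G` is the matrix of a metric in coordinates, `F`, `H` are functions of the coordinates.
Derivatives are taken along a set `s` (one-sided derivatives at boundary points of `s`);
for `s = univ`, or at interior points of `s`, they are the usual derivatives. -/

/-- The `i`-th standard basis vector of `ℝᵏ`. -/
def stdVec {k : ℕ} (i : Fin k) : EuclideanSpace ℝ (Fin k) := EuclideanSpace.single i 1

/-- `∂ᵢ F (y)`. -/
def pd {n : ℕ} (s : Set (EuclideanSpace ℝ (Fin n))) (F : EuclideanSpace ℝ (Fin n) → ℝ)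
    (i : Fin n) (y : EuclideanSpace ℝ (Fin n)) : ℝ :=
  fderivWithin ℝ F s y (stdVec i)

/-- `g(∇F, ∇H) = gⁱʲ ∂ᵢF ∂ⱼH`. -/
def coordGradInner {n : ℕ} (G : EuclideanSpace ℝ (Fin n) → Matrix (Fin n) (Fin n) ℝ)
    (s : Set (EuclideanSpace ℝ (Fin n))) (F H : EuclideanSpace ℝ (Fin n) → ℝ)
    (y : EuclideanSpace ℝ (Fin n)) : ℝ :=
  ∑ i, ∑ j, (G y)⁻¹ i j * pd s F i y * pd s H j y

/-- `Γᵏᵢⱼ = ½ gᵏˡ (∂ᵢ gⱼₗ + ∂ⱼ gᵢₗ - ∂ₗ gᵢⱼ)`. -/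
def christoffel {n : ℕ} (G : EuclideanSpace ℝ (Fin n) → Matrix (Fin n) (Fin n) ℝ)
    (k i j : Fin n) (y : EuclideanSpace ℝ (Fin n)) : ℝ :=
  (1 / 2) * ∑ l, (G y)⁻¹ k l *
    (pd univ (fun z => G z j l) i y + pd univ (fun z => G z i l) j y
      - pd univ (fun z => G z i j) l y)

/-- `(∇²F)ᵢⱼ = ∂ᵢ∂ⱼF - Γᵏᵢⱼ ∂ₖF`. -/
def coordHess {n : ℕ} (G : EuclideanSpace ℝ (Fin n) → Matrix (Fin n) (Fin n) ℝ)
    (s : Set (EuclideanSpace ℝ (Fin n))) (F : EuclideanSpace ℝ (Fin n) → ℝ)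
    (y : EuclideanSpace ℝ (Fin n)) : Matrix (Fin n) (Fin n) ℝ :=
  Matrix.of fun i j => pd s (pd s F j) i y - ∑ k, christoffel G k i j y * pd s F k y

/-- `ΔF = gⁱʲ (∇²F)ᵢⱼ`. -/
def coordLaplacian {n : ℕ} (G : EuclideanSpace ℝ (Fin n) → Matrix (Fin n) (Fin n) ℝ)
    (s : Set (EuclideanSpace ℝ (Fin n))) (F : EuclideanSpace ℝ (Fin n) → ℝ)
    (y : EuclideanSpace ℝ (Fin n)) : ℝ :=
  ∑ i, ∑ j, (G y)⁻¹ i j * coordHess G s F y i j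

/-- The norm `|T| = (gⁱᵏ gʲˡ Tᵢⱼ Tₖₗ)^{1/2}` of a covariant 2-tensor `T` with respect to the inner
product with matrix `A`. -/
def tensorNorm {n : ℕ} (A T : Matrix (Fin n) (Fin n) ℝ) : ℝ :=
  √(∑ i, ∑ j, ∑ k, ∑ l, A⁻¹ i k * A⁻¹ j l * T i j * T k l)

/-! ### `C¹` Riemannian metrics on a manifold -/

/-- A `C¹` Riemannian metric on the `n`-manifold `X`. -/
abbrev C1Metric (n : ℕ) (X : Type*) [TopologicalSpace X]
    [ChartedSpace (EuclideanSpace ℝ (Fin n)) X] [IsManifold (𝓡 n) ∞ X] :=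
  Bundle.ContMDiffRiemannianMetric (𝓡 n) 1 (EuclideanSpace ℝ (Fin n))
    (fun x : X => TangentSpace (𝓡 n) x)

section Manifold

variable {n : ℕ} {X : Type*} [TopologicalSpace X] [ChartedSpace (EuclideanSpace ℝ (Fin n)) X]
  [IsManifold (𝓡 n) ∞ X]

/-- The matrix of `ψ^* g` at `y`, for a map `ψ` from (a domain in) `ℝᵏ` to `X`. -/
def gram (g : C1Metric n X) {k : ℕ} (ψ : EuclideanSpace ℝ (Fin k) → X)
    (y : EuclideanSpace ℝ (Fin k)) : Matrix (Fin k) (Fin k) ℝ :=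
  Matrix.of fun i j =>
    g.inner (ψ y) (mfderiv (𝓡 k) (𝓡 n) ψ y (stdVec i)) (mfderiv (𝓡 k) (𝓡 n) ψ y (stdVec j))

/-- The matrix `gᵢⱼ` of the metric in the preferred chart at `p`, as a function of the
coordinates. -/
def chartGram (g : C1Metric n X) (p : X) :
    EuclideanSpace ℝ (Fin n) → Matrix (Fin n) (Fin n) ℝ :=
  gram g (extChartAt (𝓡 n) p).symm

/-- `g(∇f, ∇h)` at `p` (one-sided derivatives along `s`). -/
def gradInner (g : C1Metric n X) (s : Set X) (f h : X → ℝ) (p : X) : ℝ :=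
  coordGradInner (chartGram g p) ((extChartAt (𝓡 n) p).symm ⁻¹' s)
    (f ∘ (extChartAt (𝓡 n) p).symm) (h ∘ (extChartAt (𝓡 n) p).symm) (extChartAt (𝓡 n) p p)

/-- `|∇f|` at `p`. -/
def gradNorm (g : C1Metric n X) (s : Set X) (f : X → ℝ) (p : X) : ℝ :=
  √(gradInner g s f f p)

/-- The matrix of the Hessian `∇²f` at `p` in the preferred chart at `p`. -/
def hess (g : C1Metric n X) (s : Set X) (f : X → ℝ) (p : X) : Matrix (Fin n) (Fin n) ℝ :=
  coordHess (chartGram g p) ((extChartAt (𝓡 n) p).symm ⁻¹' s)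
    (f ∘ (extChartAt (𝓡 n) p).symm) (extChartAt (𝓡 n) p p)

/-- The Laplace-Beltrami operator `Δf` at `p`. -/
def laplacian (g : C1Metric n X) (s : Set X) (f : X → ℝ) (p : X) : ℝ :=
  coordLaplacian (chartGram g p) ((extChartAt (𝓡 n) p).symm ⁻¹' s)
    (f ∘ (extChartAt (𝓡 n) p).symm) (extChartAt (𝓡 n) p p)

/-! ### Riemannian volume and area -/

/-- `ψ : W → S` is an injective `C¹` immersion of an open set `W ⊆ ℝᵏ`. -/
structure IsPatch {k : ℕ} (S : Set X) (W : Set (EuclideanSpace ℝ (Fin k)))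
    (ψ : EuclideanSpace ℝ (Fin k) → X) : Prop where
  isOpen : IsOpen W
  contMDiffOn : ContMDiffOn (𝓡 k) (𝓡 n) 1 ψ W
  injOn : InjOn ψ W
  immersion : ∀ y ∈ W, Function.Injective (mfderiv (𝓡 k) (𝓡 n) ψ y)
  mapsTo : MapsTo ψ W S

variable [MeasurableSpace X]

/-- The `k`-dimensional area of a patch: the push-forward under `ψ` of `√det(ψ^* g) dy` on `W`. -/
def patchMeasure (g : C1Metric n X) {k : ℕ} (W : Set (EuclideanSpace ℝ (Fin k)))
    (ψ : EuclideanSpace ℝ (Fin k) → X) : Measure X :=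
  ((volume.restrict W).withDensity fun y => ENNReal.ofReal √(gram g ψ y).det).map ψ

/-- The `k`-dimensional Riemannian area measure of a `k`-dimensional `C¹` submanifold `S` of `X`:
the smallest measure that dominates the area of every patch in `S`. -/
def areaMeasure (g : C1Metric n X) (k : ℕ) (S : Set X) : Measure X :=
  ⨆ (W : Set (EuclideanSpace ℝ (Fin k))) (ψ : EuclideanSpace ℝ (Fin k) → X)
    (_ : IsPatch (n := n) S W ψ), patchMeasure g W ψ

/-- The Riemannian volume measure. -/
def volMeasure (g : C1Metric n X) : Measure X := areaMeasure g n univ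

end Manifold

/-! ### Weakly conical ends -/

/-- `(X, g, r)` is a weakly conical end, with `r` taking values in `(R₀, ∞)`. -/
structure IsWeaklyConicalEnd {n : ℕ} {X : Type*} [TopologicalSpace X]
    [ChartedSpace (EuclideanSpace ℝ (Fin n)) X] [IsManifold (𝓡 n) ∞ X]
    (g : C1Metric n X) (r : X → ℝ) (R₀ : ℝ) : Prop where
  two_le_dim : 2 ≤ n
  one_le : 1 ≤ R₀
  contMDiff : ContMDiff (𝓡 n) 𝓘(ℝ, ℝ) 2 r
  lt : ∀ p, R₀ < r p
  proper : IsProperMap fun p => (⟨r p, lt p⟩ : Ioi R₀)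
  unbounded : ¬ BddAbove (range r)
  conical : ∃ Λ : ℝ, 0 ≤ Λ ∧ ∀ p,
    |gradNorm g univ r p - 1| ≤ Λ / r p ^ 4 ∧ Λ / r p ^ 4 ≤ 1 / 2 ∧
    tensorNorm (chartGram g p (extChartAt (𝓡 n) p p))
      (hess g univ (fun q => r q ^ 2) p - (2 : ℝ) • chartGram g p (extChartAt (𝓡 n) p p))
        ≤ Λ / r p ^ 2 ∧ Λ / r p ^ 2 ≤ 1 / 2

/-- The closed end `{r ≥ R}`. -/
def closedEnd {X : Type*} (r : X → ℝ) (R : ℝ) : Set X := {p | R ≤ r p}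

/-- `Φ_m(t) = t^m e^{-t²/4}`. -/
def Phi (m t : ℝ) : ℝ := t ^ m * Real.exp (-t ^ 2 / 4)

/-- `Ψ_m(t) = t^m e^{t²/4}`. -/
def Psi (m t : ℝ) : ℝ := t ^ m * Real.exp (t ^ 2 / 4)

section Weighted

variable {n : ℕ} {X : Type*} [TopologicalSpace X] [ChartedSpace (EuclideanSpace ℝ (Fin n)) X]
  [IsManifold (𝓡 n) ∞ X]

/-- `L_m^+ u = Δu + (r/2) ∂_r u + (m/r) ∂_r u`, where `∂_r = ∇r`. -/
def driftPlus (g : C1Metric n X) (r : X → ℝ) (m : ℝ) (s : Set X) (u : X → ℝ) (p : X) : ℝ :=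
  laplacian g s u p + r p / 2 * gradInner g s r u p + m / r p * gradInner g s r u p

variable [MeasurableSpace X]

/-- The boundary norm `B(ρ) = ∫_{r = ρ} u² |∇r|`. -/
def boundaryB (g : C1Metric n X) (r u : X → ℝ) (ρ : ℝ) : ℝ :=
  ∫ p, u p ^ 2 * gradNorm g univ r p ∂(areaMeasure g (n - 1) {p | r p = ρ})

/-- `‖f‖²_{m,1} = ∫_{r ≥ R} f² Φ_m + ∫_{r ≥ R} |∇f|² Φ_m`, as an element of `[0, ∞]`. -/
def weightedNormSq (g : C1Metric n X) (r : X → ℝ) (R m : ℝ) (f : X → ℝ) : ℝ≥0∞ :=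
  (∫⁻ p in closedEnd r R, ENNReal.ofReal (f p ^ 2 * Phi m (r p)) ∂(volMeasure g)) +
  ∫⁻ p in closedEnd r R,
    ENNReal.ofReal (gradNorm g (closedEnd r R) f p ^ 2 * Phi m (r p)) ∂(volMeasure g)

/-- Membership in `C²_{m,1}` of the closed end `{r ≥ R}`. -/
def MemC2Weighted (g : C1Metric n X) (r : X → ℝ) (R m : ℝ) (f : X → ℝ) : Prop :=
  ContMDiffOn (𝓡 n) 𝓘(ℝ, ℝ) 2 f (closedEnd r R) ∧ weightedNormSq g r R m f < (⊤ : ℝ≥0∞)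

end Weighted

end ConicalEnd

end

/-!
Put `x = r²`, `S = |∇x|²`, `Q = g(∇u, ∇x)` and `P = |∇u|²`. On a weakly conical end
`S = 4x + O(1/x)` and `Δx = 2n + O(1/x)`, and the equation reads
`Δu = -Q / 4 - λu + O(x^{-1/2} (|u| + √P))`. Fix a smooth bump `η` and consider the smoothed shell
averages `b(s) = ∫ η(x - s) S u²` and `d(s) = ∫ η(x - s) u Q`. Green's identity turns the
`s`-derivative of such an average into a divergence, and gives

* `b' = 2d + (n / 2s) b + O(b / s²)`;
* `d' - 2zd ≥ -d / 4 - (z² + λ / 4s + O(|z| / s + s^{-3/2})) b` for every real `z`, by completing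
  squares and `Q² ≤ SP`.

These are a Riccati inequality for the frequency `d / b`, with limiting values `-1/4` and `0`
(`exp_decay_of_riccati`). Either `d / b ≤ -3/16` for all large `s`, so that `b ≤ K e^{-s/3}`; or at
some point `d / b` exceeds `-3/16`, and from there on it stays above a barrier asymptotic to
`-λ / s`, which forces `b ≥ c s^{n/2 - 2λ}`. The hypothesis on `B` excludes the second case, for by
the coarea formula (`lintegral_coarea`) `b` is an average of `4ρ² B(ρ)` over an interval of length
`O(s^{-1/2})` around `√s`, whence `b = o(s^{n/2 - 2λ})` (`integral_bump_isLittleO`).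

Caccioppoli's inequality (`ShellSystem.integral_gradient_le`) transfers the decay of `b` to the
averages of `P`, and summation over unit shells yields `∫ (S u² + P) e^{3x/10} < ∞`
(`ShellSystem.lintegral_exp_lt_top`). The weighted energy density of `Ψ₀ u` is at most
`(S u² + P) e^{x/4}` times a power of `r` (`IsWeaklyConicalEnd.weighted_energy_le`), and
`1/4 < 3/10`. On the bounded part of the end the gradient is bounded up to the boundary
(`exists_nhds_gradInner_le`), and the boundary itself is a null set by the coarea formula.

The estimates use the geometry only through Green's identity and the coarea formula. As the metric
is merely `C¹`, the chart independence of the Laplacian is not checked by differentiating transition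
maps twice: the divergence form of the coordinate Laplacian (`sum_pd_flux`) gives the weak
formulation in every chart, and two continuous functions with the same weak formulation agree
(`chartLaplacian_eq`). A partition of unity then gives Green's identity (`integral_mul_laplacian`).
Area and volume are suprema over patches; inside an open set covered by a single parametrization
they reduce to the density of that parametrization (`areaMeasure_restrict_eq`), and flattening the
level sets of `r` (`exists_flattening`) reduces the coarea formula to Tonelli's theorem.
-/

noncomputable section

namespace ConicalEnd

/-! ### Calculus in a coordinate domain -/

theorem pd_univ {n : ℕ} (F : EuclideanSpace ℝ (Fin n) → ℝ) (i : Fin n)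
    (y : EuclideanSpace ℝ (Fin n)) : pd univ F i y = fderiv ℝ F y (stdVec i) := by
  rw [pd, fderivWithin_univ]

section Matrix

variable {E : Type*} [NormedAddCommGroup E] [NormedSpace ℝ E] {n : ℕ}

theorem contDiffAt_det {k : WithTop ℕ∞} {G : E → Matrix (Fin n) (Fin n) ℝ} {y : E}
    (hG : ∀ i j, ContDiffAt ℝ k (fun z => G z i j) y) : ContDiffAt ℝ k (fun z => (G z).det) y := by
  simp only [Matrix.det_apply]
  refine ContDiffAt.sum fun σ _ => ?_
  exact (contDiffAt_prod fun i _ => hG _ _).const_smul _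

theorem contDiffAt_inv_entry {k : WithTop ℕ∞} {G : E → Matrix (Fin n) (Fin n) ℝ} {y : E}
    (hG : ∀ i j, ContDiffAt ℝ k (fun z => G z i j) y) (h0 : (G y).det ≠ 0) (i j : Fin n) :
    ContDiffAt ℝ k (fun z => (G z)⁻¹ i j) y := by
  simp only [Matrix.inv_def, Ring.inverse_eq_inv, Matrix.smul_apply, smul_eq_mul]
  refine ((contDiffAt_det hG).inv h0).mul ?_
  simp only [Matrix.adjugate_apply]
  refine contDiffAt_det fun a b => ?_
  simp only [Matrix.updateRow_apply]
  split_ifs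
  · exact contDiffAt_const
  · exact hG a b

/-- Jacobi's formula for the derivative of a determinant. -/
theorem fderiv_det_apply {G : E → Matrix (Fin n) (Fin n) ℝ} {y : E}
    (hG : ∀ i j, DifferentiableAt ℝ (fun z => G z i j) y) (h0 : (G y).det ≠ 0) (v : E) :
    fderiv ℝ (fun z => (G z).det) y v =
      (G y).det * ∑ i, ∑ j, (G y)⁻¹ i j * fderiv ℝ (fun z => G z j i) y v := by
  set D : (Fin n → Fin n → ℝ) → ℝ := fun A => (Matrix.of A).det with hD
  have hDd : Differentiable ℝ D := by
    have : ContDiff ℝ 1 D := contDiff_iff_contDiffAt.2 fun A => by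
      refine contDiffAt_det fun i j => ?_
      exact (contDiff_apply_apply ℝ ℝ i j).contDiffAt
    exact this.differentiable (by norm_num)
  set B : Matrix (Fin n) (Fin n) ℝ := Matrix.of fun i j => fderiv ℝ (fun z => G z i j) y v
    with hB
  set c : E → Fin n → Fin n → ℝ := fun z i j => G z i j with hc
  have hcd : DifferentiableAt ℝ c y :=
    differentiableAt_pi.2 fun i => differentiableAt_pi.2 fun j => hG i j
  have hcv : fderiv ℝ c y v = fun i j => B i j := by
    ext i j
    have h1 := (hasFDerivAt_pi'.1 (hasFDerivAt_pi'.1 hcd.hasFDerivAt i) j).fderiv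
    have := congrArg (fun L : E →L[ℝ] ℝ => L v) h1
    simpa [hB] using this.symm
  have h1 : fderiv ℝ (fun z => (G z).det) y v = fderiv ℝ D (c y) (fderiv ℝ c y v) := by
    have : (fun z => (G z).det) = D ∘ c := by ext z; rfl
    rw [this, fderiv_comp y (hDd _) hcd]; rfl
  -- along the line through `G y` the determinant is `det (G y) * det (1 + t (G y)⁻¹ B)`
  have hline : HasDerivAt (fun t : ℝ => D (c y + t • fun i j => B i j))
      ((G y).det * ((G y)⁻¹ * B).trace) 0 := by
    have e : (fun t : ℝ => D (c y + t • fun i j => B i j)) =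
        fun t => (G y).det * (1 + ((G y)⁻¹ * B).trace * t +
          (Polynomial.eval t (Matrix.det (1 + (Polynomial.X : Polynomial ℝ) •
            ((G y)⁻¹ * B).map Polynomial.C)).divX.divX) * t ^ 2) := by
      ext t
      rw [← Matrix.det_one_add_smul, ← Matrix.det_mul]
      have : Matrix.of (c y + t • fun i j => B i j) = G y + t • B := by ext i j; rfl
      simp only [hD, this]
      rw [mul_add, mul_one, Matrix.mul_smul, ← mul_assoc,
        Matrix.mul_nonsing_inv _ (isUnit_iff_ne_zero.2 h0), one_mul]
    rw [e]
    refine HasDerivAt.const_mul _ ?_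
    set p := (Matrix.det (1 + (Polynomial.X : Polynomial ℝ) •
            ((G y)⁻¹ * B).map Polynomial.C)).divX.divX
    have h2 := (((hasDerivAt_const (0:ℝ) (1:ℝ)).add
      ((hasDerivAt_id (0:ℝ)).const_mul ((G y)⁻¹ * B).trace)).add
      ((p.hasDerivAt 0).mul ((hasDerivAt_id (0:ℝ)).pow 2)))
    refine h2.congr_deriv ?_
    simp
  have h2 : HasDerivAt (fun t : ℝ => D (c y + t • fun i j => B i j))
      (fderiv ℝ D (c y) (fun i j => B i j)) 0 := by
    have hl : HasDerivAt (fun t : ℝ => c y + t • fun i j => B i j) (fun i j => B i j) 0 := by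
      have := ((hasDerivAt_id (0:ℝ)).smul_const (fun i j => B i j)).const_add (c y)
      simpa using this
    have h3 : HasFDerivAt D (fderiv ℝ D (c y)) (c y + (0:ℝ) • fun i j => B i j) := by
      simpa using (hDd (c y)).hasFDerivAt
    exact h3.comp_hasDerivAt (0:ℝ) hl
  rw [h1, hcv, h2.unique hline, Matrix.trace]
  simp only [Matrix.diag_apply, Matrix.mul_apply, hB, Matrix.of_apply]

/-- The formula `(G⁻¹)′ = -G⁻¹ G′ G⁻¹`, entry by entry. -/
theorem fderiv_inv_apply {G : E → Matrix (Fin n) (Fin n) ℝ} {y : E}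
    (hG : ∀ i j, ContDiffAt ℝ 1 (fun z => G z i j) y) (h0 : (G y).det ≠ 0) (v : E)
    (i j : Fin n) :
    fderiv ℝ (fun z => (G z)⁻¹ i j) y v =
      - ∑ a, ∑ b, (G y)⁻¹ i a * fderiv ℝ (fun z => G z a b) y v * (G y)⁻¹ b j := by
  have hI : ∀ i j, DifferentiableAt ℝ (fun z => (G z)⁻¹ i j) y := fun i j =>
    (contDiffAt_inv_entry hG h0 i j).differentiableAt (by norm_num)
  have hGd : ∀ i j, DifferentiableAt ℝ (fun z => G z i j) y := fun i j =>
    (hG i j).differentiableAt (by norm_num)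
  set G' : Matrix (Fin n) (Fin n) ℝ := Matrix.of fun i j => fderiv ℝ (fun z => G z i j) y v
    with hG'
  set H' : Matrix (Fin n) (Fin n) ℝ := Matrix.of fun i j => fderiv ℝ (fun z => (G z)⁻¹ i j) y v
    with hH'
  have hu : IsUnit (G y).det := isUnit_iff_ne_zero.2 h0
  -- differentiate `G * G⁻¹ = 1`
  have key : G' * (G y)⁻¹ + G y * H' = 0 := by
    ext a b
    have h1 : (fun z => ∑ k, G z a k * (G z)⁻¹ k b) =ᶠ[𝓝 y]
        fun _ => (1 : Matrix (Fin n) (Fin n) ℝ) a b := by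
      have : ∀ᶠ z in 𝓝 y, (G z).det ≠ 0 :=
        (contDiffAt_det hG).continuousAt.eventually_ne h0
      filter_upwards [this] with z hz
      rw [← Matrix.mul_apply, Matrix.mul_nonsing_inv _ (isUnit_iff_ne_zero.2 hz)]
    have h2 := congrArg (fun L : E →L[ℝ] ℝ => L v) h1.fderiv_eq
    have h3 : fderiv ℝ (fun z => ∑ k, G z a k * (G z)⁻¹ k b) y =
        ∑ k, (G y a k • fderiv ℝ (fun z => (G z)⁻¹ k b) y +
          (G y)⁻¹ k b • fderiv ℝ (fun z => G z a k) y) := by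
      exact (HasFDerivAt.fun_sum fun k _ =>
        (hGd a k).hasFDerivAt.mul (hI k b).hasFDerivAt).fderiv
    rw [h3] at h2
    simp only [sum_apply, add_apply, smul_apply, smul_eq_mul, fderiv_const_apply,
      zero_apply] at h2
    rw [Matrix.add_apply, Matrix.mul_apply, Matrix.mul_apply, ← Finset.sum_add_distrib,
      Matrix.zero_apply, ← h2]
    refine Finset.sum_congr rfl fun k _ => ?_
    simp only [hG', hH', Matrix.of_apply]; ring
  have h4 : H' = -((G y)⁻¹ * G' * (G y)⁻¹) := by
    have h5 : (G y)⁻¹ * (G y * H') = H' := by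
      rw [← mul_assoc, Matrix.nonsing_inv_mul _ hu, one_mul]
    rw [← h5, eq_neg_of_add_eq_zero_right key, Matrix.mul_neg, Matrix.mul_assoc]
  have h6 := congrFun (congrFun h4 i) j
  simp only [hH', Matrix.of_apply] at h6
  rw [h6, Matrix.neg_apply, Matrix.mul_apply]
  simp only [Matrix.mul_apply, Finset.sum_mul, hG', Matrix.of_apply]
  rw [Finset.sum_comm]

end Matrix

/-- The contraction identity behind the divergence form of the Laplacian: `H` is the inverse metric,
`D k` the `k`-th derivative of the metric, `V` the differential of the function. -/
theorem christoffel_contraction {n : ℕ} (H : Fin n → Fin n → ℝ) (D : Fin n → Fin n → Fin n → ℝ)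
    (V : Fin n → ℝ) (hH : ∀ i j, H i j = H j i) (hD : ∀ k i j, D k i j = D k j i) :
    ∑ j, ((1 / 2) * (∑ a, ∑ b, H a b * D j b a) * (∑ i, H i j * V i) -
        ∑ i, (∑ a, ∑ b, H i a * D j a b * H b j) * V i) =
      - ∑ i, ∑ j, H i j * ∑ k, ((1 / 2) * ∑ l, H k l * (D i j l + D j i l - D l i j)) * V k := by
  have e1 : ∑ i, ∑ j, H i j * ∑ k, ((1 / 2) * ∑ l, H k l * (D i j l + D j i l - D l i j)) * V k =
      ∑ i, ∑ j, ∑ k, ∑ l, (1 / 2) * (H i j * H k l * D i j l * V k) +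
      ∑ i, ∑ j, ∑ k, ∑ l, (1 / 2) * (H i j * H k l * D j i l * V k) -
      ∑ i, ∑ j, ∑ k, ∑ l, (1 / 2) * (H i j * H k l * D l i j * V k) := by
    simp only [← Finset.sum_add_distrib, ← Finset.sum_sub_distrib, Finset.mul_sum, Finset.sum_mul]
    refine Finset.sum_congr rfl fun i _ => Finset.sum_congr rfl fun j _ =>
      Finset.sum_congr rfl fun k _ => Finset.sum_congr rfl fun l _ => ?_
    ring
  have e2 : ∑ i, ∑ j, ∑ k, ∑ l, (1 / 2) * (H i j * H k l * D j i l * V k) =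
      ∑ i, ∑ j, ∑ k, ∑ l, (1 / 2) * (H i j * H k l * D i j l * V k) := by
    rw [Finset.sum_comm]
    refine Finset.sum_congr rfl fun i _ => Finset.sum_congr rfl fun j _ =>
      Finset.sum_congr rfl fun k _ => Finset.sum_congr rfl fun l _ => ?_
    rw [hH j i]
  have e3 : ∑ j, (1 / 2) * (∑ a, ∑ b, H a b * D j b a) * (∑ i, H i j * V i) =
      ∑ i, ∑ j, ∑ k, ∑ l, (1 / 2) * (H i j * H k l * D l i j * V k) := by
    calc _ = ∑ l, ∑ i, ∑ j, ∑ k, (1 / 2) * (H i j * H k l * D l i j * V k) := by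
          simp only [Finset.mul_sum, Finset.sum_mul]
          refine Finset.sum_congr rfl fun l _ => ?_
          rw [Finset.sum_comm]
          refine Finset.sum_congr rfl fun i _ => ?_
          rw [Finset.sum_comm]
          refine Finset.sum_congr rfl fun j _ => ?_
          refine Finset.sum_congr rfl fun k _ => ?_
          rw [hD l j i]; ring
      _ = _ := by
          rw [Finset.sum_comm]
          refine Finset.sum_congr rfl fun i _ => ?_
          rw [Finset.sum_comm]
          refine Finset.sum_congr rfl fun j _ => ?_
          rw [Finset.sum_comm]
  have e4 : ∑ j, ∑ i, (∑ a, ∑ b, H i a * D j a b * H b j) * V i =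
      ∑ i, ∑ j, ∑ k, ∑ l, (H i j * H k l * D i j l * V k) := by
    calc _ = ∑ i, ∑ k, ∑ l, ∑ j, (H i j * H k l * D i j l * V k) := by
          simp only [Finset.sum_mul]
          refine Finset.sum_congr rfl fun i _ => Finset.sum_congr rfl fun k _ =>
            Finset.sum_congr rfl fun l _ => Finset.sum_congr rfl fun j _ => ?_
          rw [hD i l j, hH j i]; ring
      _ = _ := by
          refine Finset.sum_congr rfl fun i _ => ?_
          rw [Finset.sum_comm' (t' := Finset.univ) (s' := fun _ => Finset.univ) (by simp)]
          have : ∀ l, ∑ k, ∑ j, (H i j * H k l * D i j l * V k) =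
              ∑ j, ∑ k, (H i j * H k l * D i j l * V k) := fun l => Finset.sum_comm
          simp only [this]
          rw [Finset.sum_comm]
          refine Finset.sum_congr rfl fun j _ => ?_
          rw [Finset.sum_comm]
  rw [Finset.sum_sub_distrib, e1, e2, e3, e4]
  simp only [← Finset.mul_sum]
  ring

/-- The coordinate Laplacian in divergence form. -/
theorem sum_pd_flux {n : ℕ} {G : EuclideanSpace ℝ (Fin n) → Matrix (Fin n) (Fin n) ℝ}
    {F : EuclideanSpace ℝ (Fin n) → ℝ} {y : EuclideanSpace ℝ (Fin n)}
    (hG : ∀ i j, ContDiffAt ℝ 1 (fun z => G z i j) y) (hsymm : ∀ z, (G z).IsSymm)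
    (h0 : 0 < (G y).det) (hF : ContDiffAt ℝ 2 F y) :
    ∑ j, fderiv ℝ (fun z => √(G z).det * ∑ i, (G z)⁻¹ i j * pd univ F i z) y (stdVec j) =
      √(G y).det * coordLaplacian G univ F y := by
  have hV : ∀ i, DifferentiableAt ℝ (pd univ F i) y := fun i => by
    have : pd univ F i = fun z => fderiv ℝ F z (stdVec i) := by ext z; exact pd_univ F i z
    rw [this]
    exact ((hF.fderiv_right (m := 1) (by norm_num)).differentiableAt (by norm_num)).clm_apply
      (differentiableAt_const _)
  have hI : ∀ i j, DifferentiableAt ℝ (fun z => (G z)⁻¹ i j) y := fun i j =>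
    (contDiffAt_inv_entry hG h0.ne' i j).differentiableAt (by norm_num)
  have hGd : ∀ i j, DifferentiableAt ℝ (fun z => G z i j) y := fun i j =>
    (hG i j).differentiableAt (by norm_num)
  have hdet : DifferentiableAt ℝ (fun z => (G z).det) y :=
    (contDiffAt_det hG).differentiableAt (by norm_num)
  have hs : 0 < √(G y).det := Real.sqrt_pos.2 h0
  have hsq : √(G y).det ^ 2 = (G y).det := Real.sq_sqrt h0.le
  have hHs : ∀ i j, (G y)⁻¹ i j = (G y)⁻¹ j i := fun i j => by
    have : ((G y)⁻¹).IsSymm := by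
      rw [Matrix.IsSymm, Matrix.transpose_nonsing_inv, (hsymm y).eq]
    exact (this.apply i j).symm
  have hterm : ∀ j, fderiv ℝ (fun z => √(G z).det * ∑ i, (G z)⁻¹ i j * pd univ F i z) y
      (stdVec j) = √(G y).det * (((1 / 2) * (∑ a, ∑ b, (G y)⁻¹ a b *
          pd univ (fun z => G z b a) j y) * (∑ i, (G y)⁻¹ i j * pd univ F i y) -
        ∑ i, (∑ a, ∑ b, (G y)⁻¹ i a * pd univ (fun z => G z a b) j y * (G y)⁻¹ b j)
          * pd univ F i y) + ∑ i, (G y)⁻¹ i j * pd univ (pd univ F i) j y) := by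
    intro j
    have hd := (hdet.hasFDerivAt.sqrt h0.ne').mul (HasFDerivAt.fun_sum (u := Finset.univ)
      fun i _ => (hI i j).hasFDerivAt.mul (hV i).hasFDerivAt)
    rw [show (fun z => √(G z).det * ∑ i, (G z)⁻¹ i j * pd univ F i z) =
      ((fun z => √(G z).det) * fun z => ∑ i, ((fun z => (G z)⁻¹ i j) * pd univ F i) z)
      from by ext z; rfl]
    rw [hd.fderiv]
    simp only [add_apply, smul_apply, sum_apply, smul_eq_mul, fderiv_det_apply hGd h0.ne',
      fderiv_inv_apply hG h0.ne', ← pd_univ, Pi.mul_apply, Finset.sum_add_distrib]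
    have e5 : ∑ x, pd univ F x y * -∑ a, ∑ b, (G y)⁻¹ x a * pd univ (fun z => G z a b) j y *
        (G y)⁻¹ b j = - ∑ i, (∑ a, ∑ b, (G y)⁻¹ i a * pd univ (fun z => G z a b) j y *
        (G y)⁻¹ b j) * pd univ F i y := by
      rw [← Finset.sum_neg_distrib]
      exact Finset.sum_congr rfl fun i _ => by ring
    rw [e5]
    set T := ∑ a, ∑ b, (G y)⁻¹ a b * pd univ (fun z => G z b a) j y
    have e6 : 1 / (2 * √(G y).det) * ((G y).det * T) = √(G y).det * (1 / 2 * T) := by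
      rw [← hsq]; field_simp; simp [hs.le]
    rw [e6]; ring
  simp only [hterm]
  rw [← Finset.mul_sum, Finset.sum_add_distrib,
    christoffel_contraction (fun i j => (G y)⁻¹ i j) (fun k i j => pd univ (fun z => G z i j) k y)
      (fun i => pd univ F i y) hHs (fun k i j => by
        have : (fun z => G z i j) = fun z => G z j i := by ext z; exact (hsymm z).apply j i
        simp only [this])]
  congr 1
  simp only [coordLaplacian, coordHess, christoffel, Matrix.of_apply, mul_sub,
    Finset.sum_sub_distrib]
  have e7 : ∑ j, ∑ i, (G y)⁻¹ i j * pd univ (pd univ F i) j y =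
      ∑ i, ∑ j, (G y)⁻¹ i j * pd univ (pd univ F j) i y :=
    Finset.sum_congr rfl fun i _ => Finset.sum_congr rfl fun j _ => by rw [hHs]
  rw [e7]; ring

theorem continuous_mul_of_tsupport_subset {Y : Type*} [TopologicalSpace Y] {φ f : Y → ℝ} {O : Set Y}
    (hO : IsOpen O) (hφ : Continuous φ) (hs : tsupport φ ⊆ O) (hf : ContinuousOn f O) :
    Continuous fun y => φ y * f y :=
  (hφ.continuousOn.mul hf).continuous_of_tsupport_subset hO
    ((tsupport_mul_subset_left (f := φ) (g := f)).trans hs)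

theorem contDiffAt_pd {n : ℕ} {F : EuclideanSpace ℝ (Fin n) → ℝ} {y : EuclideanSpace ℝ (Fin n)}
    {k m : WithTop ℕ∞} (hF : ContDiffAt ℝ k F y) (h : m + 1 ≤ k) (i : Fin n) :
    ContDiffAt ℝ m (pd univ F i) y := by
  have : pd univ F i = fun z => fderiv ℝ F z (stdVec i) := by ext z; exact pd_univ F i z
  rw [this]
  exact (hF.fderiv_right h).clm_apply contDiffAt_const

theorem coordLaplacian_continuousOn {n : ℕ}
    {G : EuclideanSpace ℝ (Fin n) → Matrix (Fin n) (Fin n) ℝ}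
    {F : EuclideanSpace ℝ (Fin n) → ℝ} {O : Set (EuclideanSpace ℝ (Fin n))}
    (hG : ∀ y ∈ O, ∀ i j, ContDiffAt ℝ 1 (fun z => G z i j) y)
    (h0 : ∀ y ∈ O, 0 < (G y).det) (hF : ∀ y ∈ O, ContDiffAt ℝ 2 F y) :
    ContinuousOn (coordLaplacian G univ F) O := by
  intro y hy
  have hI : ∀ i j, ContinuousAt (fun z => (G z)⁻¹ i j) y := fun i j =>
    (contDiffAt_inv_entry (hG y hy) (h0 y hy).ne' i j).continuousAt
  have hV : ∀ i, ContDiffAt ℝ 1 (pd univ F i) y := contDiffAt_pd (hF y hy) (by norm_num)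
  have hW : ∀ i j, ContinuousAt (pd univ (pd univ F j) i) y := fun i j =>
    (contDiffAt_pd (m := 0) (hV j) (by norm_num) i).continuousAt
  have hD : ∀ i j k, ContinuousAt (pd univ (fun z => G z i j) k) y := fun i j k =>
    (contDiffAt_pd (m := 0) (hG y hy i j) (by norm_num) k).continuousAt
  refine ContinuousAt.continuousWithinAt ?_
  unfold coordLaplacian coordHess christoffel
  simp only [Matrix.of_apply]
  refine tendsto_finsetSum _ fun i _ => tendsto_finsetSum _ fun j _ =>
    (hI i j).mul ((hW i j).sub (tendsto_finsetSum _ fun k _ =>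
      (Tendsto.const_mul _ (tendsto_finsetSum _ fun l _ => (hI k l).mul
        (((hD _ _ _).add (hD _ _ _)).sub (hD _ _ _)))).mul (hV k).continuousAt))

theorem coordGradInner_continuousAt {n : ℕ}
    {G : EuclideanSpace ℝ (Fin n) → Matrix (Fin n) (Fin n) ℝ}
    {F H : EuclideanSpace ℝ (Fin n) → ℝ} {y : EuclideanSpace ℝ (Fin n)}
    (hG : ∀ i j, ContDiffAt ℝ 1 (fun z => G z i j) y)
    (h0 : 0 < (G y).det) (hF : ContDiffAt ℝ 1 F y) (hH : ContDiffAt ℝ 1 H y) :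
    ContinuousAt (coordGradInner G univ F H) y := by
  refine tendsto_finsetSum _ fun i _ => tendsto_finsetSum _ fun j _ =>
    ((contDiffAt_inv_entry hG h0.ne' i j).continuousAt.mul
      (contDiffAt_pd (m := 0) hF (by norm_num) i).continuousAt).mul
      (contDiffAt_pd (m := 0) hH (by norm_num) j).continuousAt

/-- Green's formula in coordinates. -/
theorem integral_mul_coordLaplacian {n : ℕ}
    {G : EuclideanSpace ℝ (Fin n) → Matrix (Fin n) (Fin n) ℝ}
    {F φ : EuclideanSpace ℝ (Fin n) → ℝ} {O : Set (EuclideanSpace ℝ (Fin n))} (hO : IsOpen O)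
    (hG : ∀ y ∈ O, ∀ i j, ContDiffAt ℝ 1 (fun z => G z i j) y) (hsymm : ∀ z, (G z).IsSymm)
    (h0 : ∀ y ∈ O, 0 < (G y).det) (hF : ∀ y ∈ O, ContDiffAt ℝ 2 F y)
    (hφ : ContDiff ℝ 1 φ) (hc : HasCompactSupport φ) (hs : tsupport φ ⊆ O) :
    ∫ y, φ y * (√(G y).det * coordLaplacian G univ F y) =
      - ∫ y, √(G y).det * coordGradInner G univ F φ y := by
  set J : Fin n → EuclideanSpace ℝ (Fin n) → ℝ :=
    fun j z => √(G z).det * ∑ i, (G z)⁻¹ i j * pd univ F i z with hJ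
  have hJd : ∀ j, ∀ y ∈ O, ContDiffAt ℝ 1 (J j) y := fun j y hy =>
    ((contDiffAt_det (hG y hy)).sqrt (h0 y hy).ne').mul (ContDiffAt.sum fun i _ =>
      (contDiffAt_inv_entry (hG y hy) (h0 y hy).ne' i j).mul
        (contDiffAt_pd (hF y hy) (by norm_num) i))
  have hJc : ∀ j, ContinuousOn (J j) O := fun j y hy =>
    (hJd j y hy).continuousAt.continuousWithinAt
  have hJ'c : ∀ j, ContinuousOn (fun y => fderiv ℝ (J j) y (stdVec j)) O := fun j y hy =>
    (((hJd j y hy).fderiv_right (m := 0) (by norm_num)).continuousAt.clm_apply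
      continuousAt_const).continuousWithinAt
  have hφ'c : ∀ j, Continuous fun y => fderiv ℝ φ y (stdVec j) := fun j =>
    (hφ.continuous_fderiv (by norm_num)).clm_apply continuous_const
  have hφ's : ∀ j, tsupport (fun y => fderiv ℝ φ y (stdVec j)) ⊆ tsupport φ :=
    fun j => tsupport_fderiv_apply_subset ℝ _
  have hi1 : ∀ j, Integrable fun y => φ y * fderiv ℝ (J j) y (stdVec j) := fun j =>
    (continuous_mul_of_tsupport_subset hO hφ.continuous hs (hJ'c j)).integrable_of_hasCompactSupport
      hc.mul_right
  have hi2 : ∀ j, Integrable fun y => fderiv ℝ φ y (stdVec j) * J j y := fun j =>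
    (continuous_mul_of_tsupport_subset hO (hφ'c j) ((hφ's j).trans hs)
      (hJc j)).integrable_of_hasCompactSupport
      (HasCompactSupport.mul_right (hc.mono' (subset_closure.trans (hφ's j))))
  have hi3 : ∀ j, Integrable fun y => φ y * J j y := fun j =>
    (continuous_mul_of_tsupport_subset hO hφ.continuous hs (hJc j)).integrable_of_hasCompactSupport
      hc.mul_right
  have hcut : ∀ y, φ y * (√(G y).det * coordLaplacian G univ F y) =
      ∑ j, φ y * fderiv ℝ (J j) y (stdVec j) := by
    intro y
    by_cases hy : y ∈ O
    · rw [← sum_pd_flux (hG y hy) hsymm (h0 y hy) (hF y hy), Finset.mul_sum]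
    · have : φ y = 0 := image_eq_zero_of_notMem_tsupport fun h => hy (hs h)
      simp [this]
  have hgrad : ∀ y, √(G y).det * coordGradInner G univ F φ y =
      ∑ j, fderiv ℝ φ y (stdVec j) * J j y := by
    intro y
    rw [coordGradInner, Finset.sum_comm, Finset.mul_sum]
    refine Finset.sum_congr rfl fun j _ => ?_
    rw [← Finset.sum_mul, pd_univ φ]
    simp only [hJ]; ring
  simp only [hcut, hgrad]
  rw [integral_finsetSum _ fun j _ => hi1 j, integral_finsetSum _ fun j _ => hi2 j,
    ← Finset.sum_neg_distrib]
  refine Finset.sum_congr rfl fun j _ => ?_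
  exact integral_bilinear_hasFDerivAt_right_eq_neg_left_of_integrable
    (B := ContinuousLinearMap.mul ℝ ℝ) (f' := fderiv ℝ φ) (g' := fderiv ℝ (J j))
    (hi2 j) (hi1 j) (hi3 j)
    (fun y _ => (hφ.differentiable (by norm_num) y).hasFDerivAt)
    (fun y hy => ((hJd j y (hs hy)).differentiableAt (by norm_num)).hasFDerivAt)

/-! ### The metric in coordinates -/

theorem mfderiv_injective_of_leftInverse {n k : ℕ} {X : Type*} [TopologicalSpace X]
    [ChartedSpace (EuclideanSpace ℝ (Fin n)) X] {ψ : EuclideanSpace ℝ (Fin k) → X}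
    {π : X → EuclideanSpace ℝ (Fin k)} {y : EuclideanSpace ℝ (Fin k)}
    (hψ : MDifferentiableAt (𝓡 k) (𝓡 n) ψ y) (hπ : MDifferentiableAt (𝓡 n) (𝓡 k) π (ψ y))
    (h : π ∘ ψ =ᶠ[𝓝 y] id) : Function.Injective (mfderiv (𝓡 k) (𝓡 n) ψ y) := by
  have h1 := mfderiv_comp (I := 𝓡 k) (I' := 𝓡 n) (I'' := 𝓡 k) y hπ hψ
  rw [h.mfderiv_eq, mfderiv_id] at h1
  intro v w hvw
  have h3 : ∀ z, z = mfderiv (𝓡 n) (𝓡 k) π (ψ y) (mfderiv (𝓡 k) (𝓡 n) ψ y z) := fun z =>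
    congrArg (fun L : EuclideanSpace ℝ (Fin k) →L[ℝ] EuclideanSpace ℝ (Fin k) => L z) h1
  rw [h3 v, h3 w, hvw]

section Manifold

variable {n : ℕ} {X : Type*} [TopologicalSpace X] [ChartedSpace (EuclideanSpace ℝ (Fin n)) X]
  [IsManifold (𝓡 n) ∞ X]

theorem sum_smul_stdVec {k : ℕ} (v : EuclideanSpace ℝ (Fin k)) : ∑ a, v a • stdVec a = v := by
  ext i
  simp [stdVec, Pi.single_apply]

theorem bilin_expand {k : ℕ} {V : Type*} [NormedAddCommGroup V] [NormedSpace ℝ V]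
    (B : V →L[ℝ] V →L[ℝ] ℝ) (L : EuclideanSpace ℝ (Fin k) →L[ℝ] V)
    (v w : EuclideanSpace ℝ (Fin k)) :
    B (L v) (L w) = ∑ a, ∑ b, v a * w b * B (L (stdVec a)) (L (stdVec b)) := by
  conv_lhs => rw [← sum_smul_stdVec v, ← sum_smul_stdVec w]
  simp only [map_sum, map_smul, sum_apply, smul_apply, smul_eq_mul, Finset.mul_sum]
  rw [Finset.sum_comm]
  refine Finset.sum_congr rfl fun a _ => Finset.sum_congr rfl fun b _ => ?_
  ring

theorem gram_isSymm (g : C1Metric n X) {k : ℕ} (ψ : EuclideanSpace ℝ (Fin k) → X)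
    (y : EuclideanSpace ℝ (Fin k)) : (gram g ψ y).IsSymm := by
  ext i j
  simp only [gram, Matrix.transpose_apply, Matrix.of_apply]
  exact g.symm _ _ _

/-- The Jacobian matrix of a map between coordinate domains. -/
def jacobian {k m : ℕ} (τ : EuclideanSpace ℝ (Fin m) → EuclideanSpace ℝ (Fin k))
    (y : EuclideanSpace ℝ (Fin m)) : Matrix (Fin k) (Fin m) ℝ :=
  Matrix.of fun a i => (fderiv ℝ τ y (stdVec i)) a

/-- The matrix of a pulled back metric transforms by the Jacobian of the change of parameters. -/
theorem gram_comp (g : C1Metric n X) {k m : ℕ} {ψ : EuclideanSpace ℝ (Fin k) → X}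
    {τ : EuclideanSpace ℝ (Fin m) → EuclideanSpace ℝ (Fin k)} {y : EuclideanSpace ℝ (Fin m)}
    (hψ : MDifferentiableAt (𝓡 k) (𝓡 n) ψ (τ y)) (hτ : DifferentiableAt ℝ τ y) :
    gram g (ψ ∘ τ) y = (jacobian τ y).transpose * gram g ψ (τ y) * jacobian τ y := by
  have h2 : ∀ i, mfderiv (𝓡 m) (𝓡 n) (ψ ∘ τ) y (stdVec i) =
      mfderiv (𝓡 k) (𝓡 n) ψ (τ y) (fderiv ℝ τ y (stdVec i)) := fun i => by
    rw [mfderiv_comp y hψ hτ.mdifferentiableAt, mfderiv_eq_fderiv]; rfl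
  ext i j
  have h3 : gram g (ψ ∘ τ) y i j = g.inner (ψ (τ y))
      (mfderiv (𝓡 k) (𝓡 n) ψ (τ y) (fderiv ℝ τ y (stdVec i)))
      (mfderiv (𝓡 k) (𝓡 n) ψ (τ y) (fderiv ℝ τ y (stdVec j))) := by
    rw [← h2 i, ← h2 j]; rfl
  have h4 := bilin_expand (V := EuclideanSpace ℝ (Fin n)) (g.inner (ψ (τ y)))
    (mfderiv (𝓡 k) (𝓡 n) ψ (τ y)) (fderiv ℝ τ y (stdVec i)) (fderiv ℝ τ y (stdVec j))
  rw [h3]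
  refine h4.trans ?_
  rw [Matrix.mul_apply]
  simp only [Matrix.mul_apply, Matrix.transpose_apply, gram, Matrix.of_apply, Finset.sum_mul,
    jacobian]
  rw [Finset.sum_comm]
  refine Finset.sum_congr rfl fun a _ => Finset.sum_congr rfl fun b _ => ?_
  exact mul_right_comm _ _ _

theorem gram_posDef (g : C1Metric n X) {k : ℕ} {ψ : EuclideanSpace ℝ (Fin k) → X}
    {y : EuclideanSpace ℝ (Fin k)} (h : Function.Injective (mfderiv (𝓡 k) (𝓡 n) ψ y)) :
    (gram g ψ y).PosDef := by
  refine Matrix.PosDef.of_dotProduct_mulVec_pos ?_ ?_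
  · rw [Matrix.IsHermitian, Matrix.conjTranspose_eq_transpose_of_trivial]
    exact gram_isSymm g ψ y
  · intro v hv
    set w : EuclideanSpace ℝ (Fin k) := WithLp.toLp 2 v with hw
    have hw0 : w ≠ 0 := fun h0 => hv (by
      ext i; have := congrArg (fun z : EuclideanSpace ℝ (Fin k) => z i) h0; simpa [hw] using this)
    have hv0 : mfderiv (𝓡 k) (𝓡 n) ψ y w ≠ 0 := fun h0 =>
      hw0 (h (h0.trans (map_zero (mfderiv (𝓡 k) (𝓡 n) ψ y)).symm))
    have h3 := g.pos (ψ y) _ hv0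
    have h4 := bilin_expand (V := EuclideanSpace ℝ (Fin n)) (g.inner (ψ y))
      (mfderiv (𝓡 k) (𝓡 n) ψ y) w w
    refine lt_of_lt_of_eq (h3.trans_eq h4) ?_
    simp only [dotProduct, Matrix.mulVec, gram, Matrix.of_apply, star_trivial, Finset.mul_sum]
    refine Finset.sum_congr rfl fun a _ => Finset.sum_congr rfl fun b _ => ?_
    simp only [hw]
    exact (mul_assoc _ _ _).trans (by rw [mul_comm (v b)]; rfl)

/-! ### Charts -/

theorem mdifferentiableAt_chart_symm {p : X} {y : EuclideanSpace ℝ (Fin n)}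
    (hy : y ∈ (extChartAt (𝓡 n) p).target) :
    MDifferentiableAt (𝓡 n) (𝓡 n) (extChartAt (𝓡 n) p).symm y :=
  ((contMDiffOn_extChartAt_symm (n := ∞) p).contMDiffAt
    ((isOpen_extChartAt_target p).mem_nhds hy)).mdifferentiableAt (by norm_num)

theorem mdifferentiableAt_chart {p q : X} (hq : q ∈ (extChartAt (𝓡 n) p).source) :
    MDifferentiableAt (𝓡 n) (𝓡 n) (extChartAt (𝓡 n) p) q :=
  mdifferentiableAt_extChartAt (by simpa using hq)

theorem mfderiv_chart_symm_injective {p : X} {y : EuclideanSpace ℝ (Fin n)}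
    (hy : y ∈ (extChartAt (𝓡 n) p).target) :
    Function.Injective (mfderiv (𝓡 n) (𝓡 n) (extChartAt (𝓡 n) p).symm y) := by
  refine mfderiv_injective_of_leftInverse (mdifferentiableAt_chart_symm hy)
    (mdifferentiableAt_chart ((extChartAt (𝓡 n) p).map_target hy)) ?_
  filter_upwards [(isOpen_extChartAt_target p).mem_nhds hy] with z hz
  exact (extChartAt (𝓡 n) p).right_inv hz

theorem chartGram_det_pos (g : C1Metric n X) {p : X} {y : EuclideanSpace ℝ (Fin n)}
    (hy : y ∈ (extChartAt (𝓡 n) p).target) : 0 < (chartGram g p y).det :=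
  (gram_posDef g (mfderiv_chart_symm_injective hy)).det_pos

/-- The components of a `C¹` metric in a chart are `C¹` functions: the coordinate vector fields are the
constant sections of the trivialization of the tangent bundle given by the chart. -/
theorem chartGram_contDiffAt (g : C1Metric n X) {p : X} {y : EuclideanSpace ℝ (Fin n)}
    (hy : y ∈ (extChartAt (𝓡 n) p).target) (i j : Fin n) :
    ContDiffAt ℝ 1 (fun z => chartGram g p z i j) y := by
  set e := trivializationAt (EuclideanSpace ℝ (Fin n)) (TangentSpace (𝓡 n) : X → Type _) p with he
  set ψ := (extChartAt (𝓡 n) p).symm with hψ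
  have hψs : ContMDiffAt (𝓡 n) (𝓡 n) 1 ψ y :=
    (contMDiffOn_extChartAt_symm (n := 1) p).contMDiffAt
    ((isOpen_extChartAt_target p).mem_nhds hy)
  have hbase : ∀ z ∈ (extChartAt (𝓡 n) p).target, ψ z ∈ e.baseSet := fun z hz => by
    have := (extChartAt (𝓡 n) p).map_target hz
    simpa [he, hψ] using this
  have hsec : ∀ v : EuclideanSpace ℝ (Fin n), ContMDiffAt (𝓡 n)
      ((𝓡 n).prod 𝓘(ℝ, EuclideanSpace ℝ (Fin n))) 1
      (fun z => Bundle.TotalSpace.mk' (EuclideanSpace ℝ (Fin n)) (E := (TangentSpace (𝓡 n) : X → Type _)) (ψ z) (e.symmL ℝ (ψ z) v)) y := by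
    intro v
    have : ContMDiffAt (𝓡 n) ((𝓡 n).prod 𝓘(ℝ, EuclideanSpace ℝ (Fin n))) 1
      (fun x => Bundle.TotalSpace.mk' (EuclideanSpace ℝ (Fin n)) (E := (TangentSpace (𝓡 n) : X → Type _)) x (e.symmL ℝ x v)) (ψ y) := by
      refine (e.contMDiffAt_section_iff (hbase y hy)).2 ?_
      refine (contMDiffAt_const (c := v)).congr_of_eventuallyEq ?_
      filter_upwards [e.open_baseSet.mem_nhds (hbase y hy)] with x hx
      have := e.apply_mk_symm hx v
      rw [e.symmL_apply hx]
      exact congrArg Prod.snd this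
    exact this.comp y hψs
  have hg : ContMDiffAt (𝓡 n) ((𝓡 n).prod 𝓘(ℝ, EuclideanSpace ℝ (Fin n) →L[ℝ] EuclideanSpace ℝ (Fin n) →L[ℝ] ℝ)) 1
      (fun z => Bundle.TotalSpace.mk' (EuclideanSpace ℝ (Fin n) →L[ℝ] EuclideanSpace ℝ (Fin n) →L[ℝ] ℝ)
        (E := fun x : X => TangentSpace (𝓡 n) x →L[ℝ] TangentSpace (𝓡 n) x →L[ℝ] ℝ)
        (ψ z) (g.inner (ψ z))) y := g.contMDiff.contMDiffAt.comp y hψs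
  have h1 : ContMDiffAt (𝓡 n) ((𝓡 n).prod 𝓘(ℝ, ℝ)) 1
      (fun z => Bundle.TotalSpace.mk' ℝ (E := Bundle.Trivial X ℝ) (ψ z)
        (g.inner (ψ z) (e.symmL ℝ (ψ z) (stdVec i)) (e.symmL ℝ (ψ z) (stdVec j)))) y :=
    ContMDiffAt.clm_bundle_apply₂ (E₃ := Bundle.Trivial X ℝ) hg (hsec (stdVec i)) (hsec (stdVec j))
  rw [Bundle.contMDiffAt_totalSpace] at h1
  have h2 := contMDiffAt_iff_contDiffAt.1 h1.2
  refine h2.congr_of_eventuallyEq ?_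
  filter_upwards [(isOpen_extChartAt_target p).mem_nhds hy] with z hz
  have h3 := TangentBundle.symmL_trivializationAt (I := 𝓡 n) (x₀ := p) (x := ψ z) (by
    have := (extChartAt (𝓡 n) p).map_target hz
    simpa [hψ] using this)
  have h4 : extChartAt (𝓡 n) p (ψ z) = z := (extChartAt (𝓡 n) p).right_inv hz
  have h5 : ∀ v : EuclideanSpace ℝ (Fin n), e.symmL ℝ (ψ z) v = mfderiv (𝓡 n) (𝓡 n) ψ z v := by
    intro v
    have h6 := congrArg (fun L : EuclideanSpace ℝ (Fin n) →L[ℝ] EuclideanSpace ℝ (Fin n) => L v) h3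
    refine h6.trans ?_
    simp only [ModelWithCorners.range_eq_univ, mfderivWithin_univ]
    rw [h4]; rfl
  show gram g ψ z i j = g.inner (ψ z) (e.symmL ℝ (ψ z) (stdVec i)) (e.symmL ℝ (ψ z) (stdVec j))
  rw [h5, h5]; rfl

end Manifold

/-! ### Differentials and gradients in charts -/

section Manifold

variable {n : ℕ} {X : Type*} [TopologicalSpace X] [ChartedSpace (EuclideanSpace ℝ (Fin n)) X]
  [IsManifold (𝓡 n) ∞ X]

theorem gram_congr (g : C1Metric n X) {k : ℕ} {ψ ψ' : EuclideanSpace ℝ (Fin k) → X}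
    {y : EuclideanSpace ℝ (Fin k)} (h : ψ =ᶠ[𝓝 y] ψ') : gram g ψ y = gram g ψ' y := by
  have h1 := h.mfderiv_eq (I := 𝓡 k) (I' := 𝓡 n)
  have h2 := h.eq_of_nhds
  ext i j
  have key : ∀ (x x' : X) (L L' : EuclideanSpace ℝ (Fin k) →L[ℝ] EuclideanSpace ℝ (Fin n)),
      x = x' → L = L' → (g.inner x : EuclideanSpace ℝ (Fin n) →L[ℝ] EuclideanSpace ℝ (Fin n) →L[ℝ] ℝ)
        (L (stdVec i)) (L (stdVec j)) = (g.inner x' : EuclideanSpace ℝ (Fin n) →L[ℝ]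
          EuclideanSpace ℝ (Fin n) →L[ℝ] ℝ) (L' (stdVec i)) (L' (stdVec j)) := by
    rintro x _ L _ rfl rfl; rfl
  exact key _ _ _ _ h2 h1

/-- The inner product of two covectors, given by their coordinates, for the metric with
matrix `A`. -/
def coInner (A : Matrix (Fin n) (Fin n) ℝ) (v w : Fin n → ℝ) : ℝ :=
  ∑ i, ∑ j, A⁻¹ i j * v i * w j

theorem coInner_eq (A : Matrix (Fin n) (Fin n) ℝ) (v w : Fin n → ℝ) :
    coInner A v w = v ⬝ᵥ (A⁻¹.mulVec w) := by
  simp only [coInner, dotProduct, Matrix.mulVec, Finset.mul_sum]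
  exact Finset.sum_congr rfl fun i _ => Finset.sum_congr rfl fun j _ => by ring

theorem coInner_add_right (A : Matrix (Fin n) (Fin n) ℝ) (v w w' : Fin n → ℝ) :
    coInner A v (w + w') = coInner A v w + coInner A v w' := by
  simp only [coInner_eq, Matrix.mulVec_add, dotProduct_add]

theorem coInner_smul_right (A : Matrix (Fin n) (Fin n) ℝ) (v w : Fin n → ℝ) (c : ℝ) :
    coInner A v (c • w) = c * coInner A v w := by
  simp only [coInner_eq, Matrix.mulVec_smul, dotProduct_smul, smul_eq_mul]

theorem coInner_comm {A : Matrix (Fin n) (Fin n) ℝ} (hA : A.IsSymm) (v w : Fin n → ℝ) :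
    coInner A v w = coInner A w v := by
  have : (A⁻¹).IsSymm := by rw [Matrix.IsSymm, Matrix.transpose_nonsing_inv, hA.eq]
  rw [coInner, Finset.sum_comm]
  refine Finset.sum_congr rfl fun i _ => Finset.sum_congr rfl fun j _ => ?_
  rw [this.apply]; ring

theorem coInner_self_nonneg {A : Matrix (Fin n) (Fin n) ℝ} (hA : A.PosDef) (v : Fin n → ℝ) :
    0 ≤ coInner A v v := by
  rw [coInner_eq]
  simpa using hA.inv.posSemidef.dotProduct_mulVec_nonneg v

/-- The Cauchy-Schwarz inequality. -/
theorem coInner_sq_le {A : Matrix (Fin n) (Fin n) ℝ} (hA : A.PosDef) (v w : Fin n → ℝ) :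
    coInner A v w ^ 2 ≤ coInner A v v * coInner A w w := by
  have hs : A.IsSymm := by
    have := hA.isHermitian
    rwa [Matrix.IsHermitian, Matrix.conjTranspose_eq_transpose_of_trivial] at this
  have h : ∀ t : ℝ, 0 ≤ coInner A w w * (t * t) + (2 * coInner A v w) * t + coInner A v v := by
    intro t
    have := coInner_self_nonneg hA (v + t • w)
    rw [coInner_add_right, coInner_smul_right, coInner_comm hs _ v, coInner_comm hs _ w,
      coInner_add_right, coInner_add_right, coInner_smul_right, coInner_smul_right,
      coInner_comm hs w v] at this
    linarith
  have := discrim_le_zero h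
  rw [discrim] at this
  nlinarith

/-- The differential of a function in the preferred chart at a point. -/
def chartDiff (f : X → ℝ) (p : X) : Fin n → ℝ := fun i =>
  pd univ (f ∘ (extChartAt (𝓡 n) p).symm) i (extChartAt (𝓡 n) p p)

/-- The matrix of the metric at `p` in the preferred chart at `p`. -/
def metricAt (g : C1Metric n X) (p : X) : Matrix (Fin n) (Fin n) ℝ :=
  chartGram g p (extChartAt (𝓡 n) p p)

theorem metricAt_posDef (g : C1Metric n X) (p : X) : (metricAt g p).PosDef :=
  gram_posDef g (mfderiv_chart_symm_injective (mem_extChartAt_target p))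

theorem metricAt_isSymm (g : C1Metric n X) (p : X) : (metricAt g p).IsSymm :=
  gram_isSymm g _ _

theorem gradInner_univ (g : C1Metric n X) (f h : X → ℝ) (p : X) :
    gradInner g univ f h p = coInner (metricAt g p) (chartDiff f p) (chartDiff h p) := rfl

theorem contDiffAt_comp_chart_symm {f : X → ℝ} {p : X} {y : EuclideanSpace ℝ (Fin n)}
    {k : WithTop ℕ∞} (hk : k ≤ (∞ : WithTop ℕ∞)) (hy : y ∈ (extChartAt (𝓡 n) p).target)
    (hf : ContMDiffAt (𝓡 n) 𝓘(ℝ, ℝ) k f ((extChartAt (𝓡 n) p).symm y)) :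
    ContDiffAt ℝ k (f ∘ (extChartAt (𝓡 n) p).symm) y := by
  have h := ((contMDiffOn_extChartAt_symm (I := 𝓡 n) (n := ∞) p).contMDiffAt
    ((isOpen_extChartAt_target p).mem_nhds hy)).of_le hk
  exact contMDiffAt_iff_contDiffAt.1 (hf.comp y h)

theorem contDiffAt_comp_chart_symm' {f : X → ℝ} {p q : X}
    {k : WithTop ℕ∞} (hk : k ≤ (∞ : WithTop ℕ∞)) (hq : q ∈ (extChartAt (𝓡 n) p).source)
    (hf : ContMDiffAt (𝓡 n) 𝓘(ℝ, ℝ) k f q) :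
    ContDiffAt ℝ k (f ∘ (extChartAt (𝓡 n) p).symm) (extChartAt (𝓡 n) p q) :=
  contDiffAt_comp_chart_symm hk ((extChartAt (𝓡 n) p).map_source hq)
    (by rwa [(extChartAt (𝓡 n) p).left_inv hq])

theorem differentiableAt_comp_chart_symm {f : X → ℝ} {p q : X}
    (hq : q ∈ (extChartAt (𝓡 n) p).source) (hf : MDifferentiableAt (𝓡 n) 𝓘(ℝ, ℝ) f q) :
    DifferentiableAt ℝ (f ∘ (extChartAt (𝓡 n) p).symm) (extChartAt (𝓡 n) p q) := by
  refine mdifferentiableAt_iff_differentiableAt.1 (MDifferentiableAt.comp _ ?_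
    (mdifferentiableAt_chart_symm ((extChartAt (𝓡 n) p).map_source hq)))
  rwa [(extChartAt (𝓡 n) p).left_inv hq]

theorem chartDiff_mul {f h : X → ℝ} {p : X} (hf : MDifferentiableAt (𝓡 n) 𝓘(ℝ, ℝ) f p)
    (hh : MDifferentiableAt (𝓡 n) 𝓘(ℝ, ℝ) h p) :
    chartDiff (n := n) (fun q => f q * h q) p = f p • chartDiff h p + h p • chartDiff f p := by
  ext i
  have hp := mem_extChartAt_source (I := 𝓡 n) p
  have hF := differentiableAt_comp_chart_symm hp hf
  have hH := differentiableAt_comp_chart_symm hp hh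
  have := fderiv_mul hF hH
  have h2 := congrArg (fun L : EuclideanSpace ℝ (Fin n) →L[ℝ] ℝ => L (stdVec i)) this
  simp only [add_apply, smul_apply, smul_eq_mul, Function.comp_apply,
    (extChartAt (𝓡 n) p).left_inv hp] at h2
  simp only [chartDiff, Pi.add_apply, Pi.smul_apply, smul_eq_mul, pd_univ]
  exact h2

theorem chartDiff_comp {f : X → ℝ} {p : X} {θ : ℝ → ℝ} (hθ : DifferentiableAt ℝ θ (f p))
    (hf : MDifferentiableAt (𝓡 n) 𝓘(ℝ, ℝ) f p) :
    chartDiff (n := n) (fun q => θ (f q)) p = deriv θ (f p) • chartDiff f p := by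
  ext i
  have hp := mem_extChartAt_source (I := 𝓡 n) p
  have hF := differentiableAt_comp_chart_symm hp hf
  have e : (f ∘ (extChartAt (𝓡 n) p).symm) (extChartAt (𝓡 n) p p) = f p := by
    simp only [Function.comp_apply, (extChartAt (𝓡 n) p).left_inv hp]
  have hθ' : HasDerivAt θ (deriv θ (f p)) ((f ∘ (extChartAt (𝓡 n) p).symm)
      (extChartAt (𝓡 n) p p)) := by rw [e]; exact hθ.hasDerivAt
  have h2 := (hθ'.comp_hasFDerivAt _ hF.hasFDerivAt).fderiv
  have h3 := congrArg (fun L : EuclideanSpace ℝ (Fin n) →L[ℝ] ℝ => L (stdVec i)) h2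
  simp only [smul_apply, smul_eq_mul] at h3
  simp only [chartDiff, Pi.smul_apply, smul_eq_mul, pd_univ]
  exact h3

theorem chartDiff_congr {f h : X → ℝ} {p : X} (hfh : f =ᶠ[𝓝 p] h) :
    chartDiff (n := n) f p = chartDiff h p := by
  ext i
  have hc : ContinuousAt (extChartAt (𝓡 n) p).symm (extChartAt (𝓡 n) p p) :=
    continuousAt_extChartAt_symm p
  have e : f ∘ (extChartAt (𝓡 n) p).symm =ᶠ[𝓝 (extChartAt (𝓡 n) p p)]
      h ∘ (extChartAt (𝓡 n) p).symm := by
    refine hc.eventually (p := fun z => f z = h z) ?_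
    rwa [(extChartAt (𝓡 n) p).left_inv (mem_extChartAt_source p)]
  simp only [chartDiff, pd_univ, e.fderiv_eq]

/-! ### Change of coordinates -/

theorem pd_comp {k m : ℕ} {F : EuclideanSpace ℝ (Fin k) → ℝ}
    {τ : EuclideanSpace ℝ (Fin m) → EuclideanSpace ℝ (Fin k)} {y : EuclideanSpace ℝ (Fin m)}
    (hF : DifferentiableAt ℝ F (τ y)) (hτ : DifferentiableAt ℝ τ y) :
    (fun i => pd univ (F ∘ τ) i y) = (jacobian τ y).transpose.mulVec (fun a => pd univ F a (τ y)) := by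
  ext i
  have h1 : fderiv ℝ F (τ y) (fderiv ℝ τ y (stdVec i)) =
      ∑ a, jacobian τ y a i * fderiv ℝ F (τ y) (stdVec a) := by
    conv_lhs => rw [← sum_smul_stdVec (fderiv ℝ τ y (stdVec i))]
    simp only [map_sum, map_smul, smul_eq_mul, jacobian, Matrix.of_apply]
  simp only [pd_univ, Matrix.mulVec, dotProduct, Matrix.transpose_apply]
  rw [fderiv_comp y hF hτ, ← h1]; rfl

/-- The inner product of covectors does not depend on the coordinates. -/
theorem coInner_change {A J : Matrix (Fin n) (Fin n) ℝ} (v w : Fin n → ℝ) (hJ : J.det ≠ 0) :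
    coInner (J.transpose * A * J) (J.transpose.mulVec v) (J.transpose.mulVec w) =
      coInner A v w := by
  have hu : IsUnit J.det := isUnit_iff_ne_zero.2 hJ
  have hu' : IsUnit J.transpose.det := by rwa [Matrix.det_transpose]
  rw [coInner_eq, coInner_eq, Matrix.mul_inv_rev, Matrix.mul_inv_rev, Matrix.mulVec_mulVec,
    Matrix.mul_assoc, Matrix.mul_assoc, Matrix.nonsing_inv_mul _ hu', Matrix.mul_one,
    Matrix.dotProduct_mulVec, ← Matrix.mulVec_transpose, Matrix.mulVec_mulVec,
    Matrix.transpose_mul, Matrix.mul_assoc, ← Matrix.transpose_mul, Matrix.mul_nonsing_inv _ hu,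
    Matrix.transpose_one, Matrix.mul_one, Matrix.mulVec_transpose, Matrix.dotProduct_mulVec]

/-- The inner product of differentials is invariant under a change of parameters. -/
theorem coordGradInner_gram_comp (g : C1Metric n X)
    {ψ : EuclideanSpace ℝ (Fin n) → X} {τ : EuclideanSpace ℝ (Fin n) → EuclideanSpace ℝ (Fin n)}
    {y : EuclideanSpace ℝ (Fin n)} {F H : EuclideanSpace ℝ (Fin n) → ℝ}
    (hψ : MDifferentiableAt (𝓡 n) (𝓡 n) ψ (τ y)) (hτ : DifferentiableAt ℝ τ y)
    (hdet : (gram g (ψ ∘ τ) y).det ≠ 0) (hF : DifferentiableAt ℝ F (τ y))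
    (hH : DifferentiableAt ℝ H (τ y)) :
    coInner (gram g (ψ ∘ τ) y) (fun i => pd univ (F ∘ τ) i y) (fun i => pd univ (H ∘ τ) i y) =
      coInner (gram g ψ (τ y)) (fun i => pd univ F i (τ y)) (fun i => pd univ H i (τ y)) := by
  rw [gram_comp g hψ hτ] at hdet ⊢
  rw [pd_comp hF hτ, pd_comp hH hτ, coInner_change]
  intro h0
  simp [Matrix.det_mul, h0] at hdet

/-- The inner product of two gradients can be computed in any chart around the point. -/
theorem gradInner_eq_coInner (g : C1Metric n X) {f h : X → ℝ} {p q : X}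
    (hq : q ∈ (extChartAt (𝓡 n) p).source)
    (hf : MDifferentiableAt (𝓡 n) 𝓘(ℝ, ℝ) f q) (hh : MDifferentiableAt (𝓡 n) 𝓘(ℝ, ℝ) h q) :
    gradInner g univ f h q = coordGradInner (chartGram g p) univ
      (f ∘ (extChartAt (𝓡 n) p).symm) (h ∘ (extChartAt (𝓡 n) p).symm) (extChartAt (𝓡 n) p q) := by
  set ψ := (extChartAt (𝓡 n) p).symm with hψ
  set ψ' := (extChartAt (𝓡 n) q).symm with hψ'
  set y := extChartAt (𝓡 n) q q with hy
  have hyt : y ∈ (extChartAt (𝓡 n) q).target := mem_extChartAt_target q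
  have hy' : ψ' y = q := (extChartAt (𝓡 n) q).left_inv (mem_extChartAt_source q)
  set τ : EuclideanSpace ℝ (Fin n) → EuclideanSpace ℝ (Fin n) := extChartAt (𝓡 n) p ∘ ψ' with hτ
  have hτy : τ y = extChartAt (𝓡 n) p q := by simp only [hτ, Function.comp_apply, hy']
  have hτd : DifferentiableAt ℝ τ y := by
    refine mdifferentiableAt_iff_differentiableAt.1 (MDifferentiableAt.comp _
      (I' := 𝓡 n) ?_ (mdifferentiableAt_chart_symm hyt))
    exact mdifferentiableAt_chart (by rwa [hy'])
  have hev : ψ' =ᶠ[𝓝 y] ψ ∘ τ := by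
    have hc : ContinuousAt ψ' y := (mdifferentiableAt_chart_symm hyt).continuousAt
    have : ∀ᶠ z in 𝓝 y, ψ' z ∈ (extChartAt (𝓡 n) p).source :=
      hc.eventually ((isOpen_extChartAt_source p).mem_nhds (by rwa [hy']))
    filter_upwards [this] with z hz
    exact ((extChartAt (𝓡 n) p).left_inv hz).symm
  have hfe : ∀ f : X → ℝ, (fun i => pd univ (f ∘ ψ') i y) =
      fun i => pd univ ((f ∘ ψ) ∘ τ) i y := fun f => by
    have : f ∘ ψ' =ᶠ[𝓝 y] (f ∘ ψ) ∘ τ := hev.fun_comp f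
    ext i; simp only [pd_univ, this.fderiv_eq]
  have hψd : MDifferentiableAt (𝓡 n) (𝓡 n) ψ (τ y) := by
    rw [hτy]; exact mdifferentiableAt_chart_symm ((extChartAt (𝓡 n) p).map_source hq)
  show coInner (gram g ψ' y) (fun i => pd univ (f ∘ ψ') i y) (fun i => pd univ (h ∘ ψ') i y) = _
  have hdet : (gram g (ψ ∘ τ) y).det ≠ 0 := by
    rw [← gram_congr g hev]; exact (chartGram_det_pos g hyt).ne'
  rw [hfe f, hfe h, gram_congr g hev, coordGradInner_gram_comp g hψd hτd hdet
    (by rw [hτy]; exact differentiableAt_comp_chart_symm hq hf)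
    (by rw [hτy]; exact differentiableAt_comp_chart_symm hq hh), hτy]
  rfl

theorem gradInner_continuousAt (g : C1Metric n X) {f h : X → ℝ} {q : X}
    (hf : ContMDiffAt (𝓡 n) 𝓘(ℝ, ℝ) 1 f q) (hh : ContMDiffAt (𝓡 n) 𝓘(ℝ, ℝ) 1 h q) :
    ContinuousAt (gradInner g univ f h) q := by
  have hs := mem_extChartAt_source (I := 𝓡 n) q
  have hev : gradInner g univ f h =ᶠ[𝓝 q] fun q' => coordGradInner (chartGram g q) univ
      (f ∘ (extChartAt (𝓡 n) q).symm) (h ∘ (extChartAt (𝓡 n) q).symm) (extChartAt (𝓡 n) q q') := by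
    filter_upwards [(isOpen_extChartAt_source (I := 𝓡 n) q).mem_nhds hs,
      (contMDiffAt_iff_contMDiffAt_nhds (by norm_num)).1 hf,
      (contMDiffAt_iff_contMDiffAt_nhds (by norm_num)).1 hh] with q' h1 h2 h3
    exact gradInner_eq_coInner g h1 (h2.mdifferentiableAt (by norm_num))
      (h3.mdifferentiableAt (by norm_num))
  refine ContinuousAt.congr ?_ hev.symm
  have h1 : ContinuousAt (coordGradInner (chartGram g q) univ
      (f ∘ (extChartAt (𝓡 n) q).symm) (h ∘ (extChartAt (𝓡 n) q).symm)) (extChartAt (𝓡 n) q q) :=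
    coordGradInner_continuousAt (fun i j => chartGram_contDiffAt g (mem_extChartAt_target q) i j)
      (chartGram_det_pos g (mem_extChartAt_target q))
      (contDiffAt_comp_chart_symm' (by norm_num) hs hf)
      (contDiffAt_comp_chart_symm' (by norm_num) hs hh)
  exact ContinuousAt.comp (f := extChartAt (𝓡 n) q) h1 (continuousAt_extChartAt q)

/-! ### Pointwise algebra -/

open scoped MatrixOrder Matrix.Norms.L2Operator in
theorem exists_eq_transpose_mul_self {A : Matrix (Fin n) (Fin n) ℝ} (hA : A.PosSemidef) :
    ∃ C : Matrix (Fin n) (Fin n) ℝ, A = C.transpose * C := by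
  obtain ⟨C, rfl⟩ := CStarAlgebra.nonneg_iff_eq_star_mul_self.mp hA.nonneg
  exact ⟨C, rfl⟩

/-- The trace of a 2-tensor is controlled by its norm. -/
theorem abs_trace_le_tensorNorm {A : Matrix (Fin n) (Fin n) ℝ} (hA : A.PosDef)
    (T : Matrix (Fin n) (Fin n) ℝ) :
    |∑ i, ∑ j, A⁻¹ i j * T i j| ≤ √n * tensorNorm A T := by
  obtain ⟨C, hC⟩ := exists_eq_transpose_mul_self hA.inv.posSemidef
  have hCe : ∀ i j, A⁻¹ i j = ∑ a, C a i * C a j := fun i j => by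
    rw [hC, Matrix.mul_apply]; simp
  -- the components of `T` in an orthonormal frame, the rows of `C`
  set N : Fin n → Fin n → ℝ := fun a b => ∑ i, ∑ j, C a i * C b j * T i j with hN
  have h1 : ∑ i, ∑ j, A⁻¹ i j * T i j = ∑ a, N a a := by
    simp only [hCe, hN, Finset.sum_mul]
    calc _ = ∑ i, ∑ a, ∑ j, C a i * C a j * T i j :=
          Finset.sum_congr rfl fun i _ => Finset.sum_comm
      _ = _ := Finset.sum_comm
  have h2 : ∑ i, ∑ j, ∑ k, ∑ l, A⁻¹ i k * A⁻¹ j l * T i j * T k l = ∑ a, ∑ b, N a b ^ 2 := by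
    have e1 : ∀ a b, N a b ^ 2 = ∑ i, ∑ j, ∑ k, ∑ l, (C a i * C a k) * (C b j * C b l) * T i j * T k l := by
      intro a b
      simp only [sq, hN, Finset.sum_mul, Finset.mul_sum]
      refine Finset.sum_congr rfl fun i _ => Finset.sum_congr rfl fun j _ =>
        Finset.sum_congr rfl fun k _ => Finset.sum_congr rfl fun l _ => by ring
    have e2 : ∀ i j k l, A⁻¹ i k * A⁻¹ j l * T i j * T k l =
        ∑ a, ∑ b, (C a i * C a k) * (C b j * C b l) * T i j * T k l := by
      intro i j k l
      rw [hCe, hCe, Finset.sum_mul_sum]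
      simp only [Finset.sum_mul]
    simp only [e1, e2]
    have c : ∀ (f : Fin n → Fin n → Fin n → Fin n → Fin n → Fin n → ℝ),
        ∑ i, ∑ j, ∑ k, ∑ l, ∑ a, ∑ b, f i j k l a b = ∑ a, ∑ b, ∑ i, ∑ j, ∑ k, ∑ l, f i j k l a b := by
      intro f
      simp only [← Fintype.sum_prod_type']
      refine Finset.sum_bij' (fun x _ => (x.2.2.2.2.1, x.2.2.2.2.2, x.1, x.2.1, x.2.2.1, x.2.2.2.1))
        (fun x _ => (x.2.2.1, x.2.2.2.1, x.2.2.2.2.1, x.2.2.2.2.2, x.1, x.2.1)) ?_ ?_ ?_ ?_ ?_ <;> simp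
    exact c _
  rw [h1, tensorNorm, h2, ← Real.sqrt_mul (by positivity)]
  refine Real.abs_le_sqrt ?_
  calc (∑ a, N a a) ^ 2 ≤ n * ∑ a, N a a ^ 2 := by
        have := sq_sum_le_card_mul_sum_sq (s := Finset.univ) (f := fun a => N a a)
        simpa using this
    _ ≤ n * ∑ a, ∑ b, N a b ^ 2 := by
        refine mul_le_mul_of_nonneg_left (Finset.sum_le_sum fun a _ => ?_) (by positivity)
        exact Finset.single_le_sum (f := fun b => N a b ^ 2) (fun b _ => by positivity)
          (Finset.mem_univ a)

end Manifold

/-! ### Patches and the volume measure -/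

section Manifold

variable {n : ℕ} {X : Type*} [TopologicalSpace X] [ChartedSpace (EuclideanSpace ℝ (Fin n)) X]
  [IsManifold (𝓡 n) ∞ X]

theorem det_fderiv_eq_jacobian {k : ℕ} (τ : EuclideanSpace ℝ (Fin k) → EuclideanSpace ℝ (Fin k))
    (y : EuclideanSpace ℝ (Fin k)) : (fderiv ℝ τ y).det = (jacobian τ y).det := by
  rw [ContinuousLinearMap.det, ← LinearMap.det_toMatrix (EuclideanSpace.basisFun (Fin k) ℝ).toBasis]
  congr 1

theorem measurableSet_inter_preimage {Y Z : Type*} [TopologicalSpace Y] [MeasurableSpace Y]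
    [BorelSpace Y] [TopologicalSpace Z] [MeasurableSpace Z] [BorelSpace Z] {f : Y → Z} {W : Set Y}
    (hW : MeasurableSet W) (hf : ContinuousOn f W) {A : Set Z} (hA : MeasurableSet A) :
    MeasurableSet (W ∩ f ⁻¹' A) := by
  have h1 : Measurable (W.domRestrict f) := (continuousOn_iff_continuous_domRestrict.1 hf).measurable
  have h2 := hW.subtype_image (h1 hA)
  convert h2 using 1
  ext y; simp [Set.domRestrict, and_comm]

variable [MeasurableSpace X] [BorelSpace X]

theorem IsPatch.aemeasurable {k : ℕ} {S : Set X} {W : Set (EuclideanSpace ℝ (Fin k))}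
    {ψ : EuclideanSpace ℝ (Fin k) → X} (h : IsPatch (n := n) S W ψ)
    (ρ : EuclideanSpace ℝ (Fin k) → ℝ≥0∞) :
    AEMeasurable ψ ((volume.restrict W).withDensity ρ) :=
  (h.contMDiffOn.continuousOn.aemeasurable h.isOpen.measurableSet).mono_ac
    (withDensity_absolutelyContinuous _ _)

theorem IsPatch.patchMeasure_apply (g : C1Metric n X) {k : ℕ} {S : Set X}
    {W : Set (EuclideanSpace ℝ (Fin k))}
    {ψ : EuclideanSpace ℝ (Fin k) → X} (h : IsPatch (n := n) S W ψ) {A : Set X}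
    (hA : MeasurableSet A) :
    patchMeasure g W ψ A = ∫⁻ y in W ∩ ψ ⁻¹' A, ENNReal.ofReal √(gram g ψ y).det := by
  rw [patchMeasure, Measure.map_apply_of_aemeasurable (h.aemeasurable _) hA, withDensity_apply',
    Measure.restrict_restrict' h.isOpen.measurableSet, inter_comm]

/-- A parametrization `ψ₀` of the part of `S` inside the open set `U`, with a `C¹` left inverse,
dominates inside `U` the area of every patch of `S`. -/
theorem patchMeasure_restrict_le (g : C1Metric n X) {k : ℕ} {S U : Set X}
    {W₀ W : Set (EuclideanSpace ℝ (Fin k))} {ψ₀ ψ : EuclideanSpace ℝ (Fin k) → X}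
    {π : X → EuclideanSpace ℝ (Fin k)} (h₀ : IsPatch (n := n) S W₀ ψ₀) (hU : IsOpen U)
    (hπ : ContMDiffOn (𝓡 n) (𝓡 k) 1 π U)
    (hinv : ∀ x ∈ S ∩ U, π x ∈ W₀ ∧ ψ₀ (π x) = x) (h : IsPatch (n := n) S W ψ) :
    (patchMeasure g W ψ).restrict U ≤ patchMeasure g W₀ ψ₀ := by
  refine Measure.le_iff.2 fun A hA => ?_
  rw [Measure.restrict_apply hA, h.patchMeasure_apply g (hA.inter hU.measurableSet),
    h₀.patchMeasure_apply g hA]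
  set V := W ∩ ψ ⁻¹' (A ∩ U) with hV
  have hVm : MeasurableSet V := measurableSet_inter_preimage h.isOpen.measurableSet
    h.contMDiffOn.continuousOn (hA.inter hU.measurableSet)
  -- `ψ = ψ₀ ∘ τ` near every point mapped into `U`, so the claim is a change of variables
  set τ : EuclideanSpace ℝ (Fin k) → EuclideanSpace ℝ (Fin k) := π ∘ ψ with hτ
  have hopen : IsOpen (W ∩ ψ ⁻¹' U) := h.contMDiffOn.continuousOn.isOpen_inter_preimage h.isOpen hU
  have hfact : ∀ z ∈ W ∩ ψ ⁻¹' U, τ z ∈ W₀ ∧ ψ₀ (τ z) = ψ z := fun z hz =>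
    hinv _ ⟨h.mapsTo hz.1, hz.2⟩
  have hVsub : V ⊆ W ∩ ψ ⁻¹' U := fun z hz => ⟨hz.1, hz.2.2⟩
  have hτd : ∀ y ∈ V, DifferentiableAt ℝ τ y := fun y hy => by
    have h1 : MDifferentiableAt (𝓡 k) (𝓡 n) ψ y :=
      (h.contMDiffOn.contMDiffAt (h.isOpen.mem_nhds hy.1)).mdifferentiableAt (by norm_num)
    have h2 : MDifferentiableAt (𝓡 n) (𝓡 k) π (ψ y) :=
      (hπ.contMDiffAt (hU.mem_nhds hy.2.2)).mdifferentiableAt (by norm_num)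
    exact mdifferentiableAt_iff_differentiableAt.1 (h2.comp y h1)
  have hτinj : InjOn τ V := by
    intro y hy z hz hyz
    refine h.injOn hy.1 hz.1 ?_
    rw [← (hfact y (hVsub hy)).2, ← (hfact z (hVsub hz)).2, hyz]
  have hgram : ∀ y ∈ V, ENNReal.ofReal √(gram g ψ y).det =
      ENNReal.ofReal |(fderiv ℝ τ y).det| * ENNReal.ofReal √(gram g ψ₀ (τ y)).det := by
    intro y hy
    have hev : ψ =ᶠ[𝓝 y] ψ₀ ∘ τ := by
      filter_upwards [hopen.mem_nhds (hVsub hy)] with z hz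
      exact (hfact z hz).2.symm
    have hd : MDifferentiableAt (𝓡 k) (𝓡 n) ψ₀ (τ y) :=
      (h₀.contMDiffOn.contMDiffAt (h₀.isOpen.mem_nhds (hfact y (hVsub hy)).1)).mdifferentiableAt
        (by norm_num)
    rw [gram_congr g hev, gram_comp g hd (hτd y hy), Matrix.det_mul, Matrix.det_mul,
      Matrix.det_transpose, det_fderiv_eq_jacobian, ← ENNReal.ofReal_mul (abs_nonneg _),
      mul_comm (jacobian τ y).det, mul_assoc, ← sq, mul_comm, Real.sqrt_mul (sq_nonneg _),
      Real.sqrt_sq_eq_abs]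
  rw [setLIntegral_congr_fun hVm hgram, ← lintegral_image_eq_lintegral_abs_det_fderiv_mul volume hVm
    (fun y hy => (hτd y hy).hasFDerivAt.hasFDerivWithinAt) hτinj
    (fun z => ENNReal.ofReal √(gram g ψ₀ z).det)]
  refine lintegral_mono_set ?_
  rintro _ ⟨y, hy, rfl⟩
  refine ⟨(hfact y (hVsub hy)).1, ?_⟩
  rw [mem_preimage, (hfact y (hVsub hy)).2]
  exact hy.2.1

theorem IsPatch.patchMeasure_le_areaMeasure (g : C1Metric n X) {k : ℕ} {S : Set X}
    {W : Set (EuclideanSpace ℝ (Fin k))}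
    {ψ : EuclideanSpace ℝ (Fin k) → X} (h : IsPatch (n := n) S W ψ) :
    patchMeasure g W ψ ≤ areaMeasure g k S :=
  le_iSup_of_le W (le_iSup_of_le ψ (le_iSup (fun _ : IsPatch (n := n) S W ψ => patchMeasure g W ψ) h))

theorem IsPatch.patchMeasure_restrict (g : C1Metric n X) {k : ℕ} {S A : Set X}
    {W : Set (EuclideanSpace ℝ (Fin k))} {ψ : EuclideanSpace ℝ (Fin k) → X}
    (h : IsPatch (n := n) S W ψ) (hA : MeasurableSet A) (hm : MapsTo ψ W A) :
    (patchMeasure g W ψ).restrict A = patchMeasure g W ψ := by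
  refine Measure.restrict_eq_self_of_ae_mem ?_
  rw [ae_iff]
  have : {x | x ∉ A} = Aᶜ := rfl
  rw [this, h.patchMeasure_apply g hA.compl]
  have : W ∩ ψ ⁻¹' Aᶜ = ∅ := by
    ext y; simp only [mem_inter_iff, mem_preimage, mem_compl_iff, mem_empty_iff_false, iff_false,
      not_and, not_not]
    exact fun hy => hm hy
  rw [this]; simp

/-- Inside an open set `U`, the area of `S` is that of any one parametrization of `S ∩ U` with a `C¹`
left inverse. -/
theorem areaMeasure_restrict_eq (g : C1Metric n X) {k : ℕ} {S U : Set X}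
    {W₀ : Set (EuclideanSpace ℝ (Fin k))} {ψ₀ : EuclideanSpace ℝ (Fin k) → X}
    {π : X → EuclideanSpace ℝ (Fin k)} (h₀ : IsPatch (n := n) S W₀ ψ₀) (hU : IsOpen U)
    (hm : MapsTo ψ₀ W₀ U) (hπ : ContMDiffOn (𝓡 n) (𝓡 k) 1 π U)
    (hinv : ∀ x ∈ S ∩ U, π x ∈ W₀ ∧ ψ₀ (π x) = x) :
    (areaMeasure g k S).restrict U = patchMeasure g W₀ ψ₀ := by
  refine le_antisymm ?_ ?_
  -- A supremum of measures cannot be restricted to `U` term by term; outside `U` each patch is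
  -- bounded by the area measure itself.
  · have hle : areaMeasure g k S ≤ patchMeasure g W₀ ψ₀ + (areaMeasure g k S).restrict Uᶜ := by
      refine iSup_le fun W => iSup_le fun ψ => iSup_le fun h => ?_
      rw [← Measure.restrict_add_restrict_compl (μ := patchMeasure g W ψ) hU.measurableSet]
      exact add_le_add (patchMeasure_restrict_le g h₀ hU hπ hinv h)
        (Measure.restrict_mono subset_rfl (h.patchMeasure_le_areaMeasure g))
    refine Measure.le_iff.2 fun A hA => ?_
    rw [Measure.restrict_apply hA]
    refine (hle (A ∩ U)).trans ?_
    rw [Measure.add_apply, Measure.restrict_apply (hA.inter hU.measurableSet)]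
    have : A ∩ U ∩ Uᶜ = ∅ := by rw [inter_assoc, inter_compl_self, inter_empty]
    rw [this, measure_empty, add_zero]
    exact measure_mono inter_subset_left
  · rw [← h₀.patchMeasure_restrict g hU.measurableSet hm]
    exact Measure.restrict_mono subset_rfl (h₀.patchMeasure_le_areaMeasure g)

/-- The area measure of `S` is concentrated on `S`. -/
theorem areaMeasure_compl (g : C1Metric n X) (k : ℕ) {S : Set X} (hS : MeasurableSet S) :
    areaMeasure g k S Sᶜ = 0 := by
  have hle : areaMeasure g k S ≤ (areaMeasure g k S).restrict S := by
    refine iSup_le fun W => iSup_le fun ψ => iSup_le fun h => ?_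
    rw [← h.patchMeasure_restrict g hS h.mapsTo]
    exact Measure.restrict_mono subset_rfl (h.patchMeasure_le_areaMeasure g)
  have := hle Sᶜ
  rw [Measure.restrict_apply hS.compl, compl_inter_self, measure_empty] at this
  exact le_antisymm this bot_le

theorem IsPatch.lintegral_patchMeasure (g : C1Metric n X) {k : ℕ} {S : Set X}
    {W : Set (EuclideanSpace ℝ (Fin k))} {ψ : EuclideanSpace ℝ (Fin k) → X}
    (h : IsPatch (n := n) S W ψ) (hc : ContinuousOn (fun y => √(gram g ψ y).det) W)
    {f : X → ℝ≥0∞} (hf : Measurable f) :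
    ∫⁻ x, f x ∂(patchMeasure g W ψ) =
      ∫⁻ y in W, ENNReal.ofReal √(gram g ψ y).det * f (ψ y) := by
  rw [patchMeasure, lintegral_map' hf.aemeasurable (h.aemeasurable _),
    lintegral_withDensity_eq_lintegral_mul₀
      (hc.aemeasurable h.isOpen.measurableSet).ennreal_ofReal
      (g := fun y => f (ψ y)) (hf.comp_aemeasurable (h.contMDiffOn.continuousOn.aemeasurable h.isOpen.measurableSet))]
  rfl

theorem IsPatch.integral_patchMeasure (g : C1Metric n X) {k : ℕ} {S : Set X}
    {W : Set (EuclideanSpace ℝ (Fin k))} {ψ : EuclideanSpace ℝ (Fin k) → X}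
    (h : IsPatch (n := n) S W ψ) (hc : ContinuousOn (fun y => √(gram g ψ y).det) W)
    {f : X → ℝ} (hf : AEStronglyMeasurable f (patchMeasure g W ψ)) :
    ∫ x, f x ∂(patchMeasure g W ψ) = ∫ y in W, √(gram g ψ y).det * f (ψ y) := by
  rw [patchMeasure] at hf ⊢
  rw [integral_map (h.aemeasurable _) hf,
    integral_withDensity_eq_integral_toReal_smul₀
      (hc.aemeasurable h.isOpen.measurableSet).ennreal_ofReal
      (Eventually.of_forall fun _ => ENNReal.ofReal_lt_top)]
  refine integral_congr_ae (Eventually.of_forall fun y => ?_)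
  simp only [ENNReal.toReal_ofReal (Real.sqrt_nonneg _), smul_eq_mul]

/-! ### The volume measure in charts -/

theorem isPatch_chart (p : X) :
    IsPatch (n := n) (univ : Set X) (extChartAt (𝓡 n) p).target (extChartAt (𝓡 n) p).symm where
  isOpen := isOpen_extChartAt_target p
  contMDiffOn := contMDiffOn_extChartAt_symm p
  injOn := (extChartAt (𝓡 n) p).symm.injOn
  immersion _ hy := mfderiv_chart_symm_injective hy
  mapsTo _ _ := mem_univ _

theorem continuousOn_sqrt_det_chartGram (g : C1Metric n X) (p : X) :
    ContinuousOn (fun y => √(chartGram g p y).det) (extChartAt (𝓡 n) p).target := fun _ hy =>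
  (contDiffAt_det (chartGram_contDiffAt g hy)).continuousAt.continuousWithinAt.sqrt

/-- On a chart domain, the volume measure has the density `√det g` in the coordinates. -/
theorem volMeasure_restrict_source (g : C1Metric n X) (p : X) :
    (volMeasure g).restrict (extChartAt (𝓡 n) p).source =
      patchMeasure g (extChartAt (𝓡 n) p).target (extChartAt (𝓡 n) p).symm :=
  areaMeasure_restrict_eq g (isPatch_chart p) (isOpen_extChartAt_source p)
    (extChartAt (𝓡 n) p).symm.mapsTo (by
      have := contMDiffOn_extChartAt (I := 𝓡 n) (x := p) (n := 1)
      rwa [← extChartAt_source (𝓡 n)] at this) fun x hx =>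
      ⟨(extChartAt (𝓡 n) p).map_source hx.2, (extChartAt (𝓡 n) p).left_inv hx.2⟩

theorem volMeasure_apply_of_subset_source (g : C1Metric n X) (p : X) {A : Set X}
    (hA : MeasurableSet A) (hs : A ⊆ (extChartAt (𝓡 n) p).source) :
    volMeasure g A = ∫⁻ y in (extChartAt (𝓡 n) p).target ∩ (extChartAt (𝓡 n) p).symm ⁻¹' A,
      ENNReal.ofReal √(chartGram g p y).det := by
  have h1 := congrArg (fun μ : Measure X => μ A) (volMeasure_restrict_source g p)
  simp only [Measure.restrict_apply hA, inter_eq_self_of_subset_left hs] at h1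
  rw [h1, (isPatch_chart p).patchMeasure_apply g hA]; rfl

theorem isLocallyFiniteMeasure_volMeasure [T2Space X] (g : C1Metric n X) :
    IsLocallyFiniteMeasure (volMeasure g) := by
  have : LocallyCompactSpace X := ChartedSpace.locallyCompactSpace (EuclideanSpace ℝ (Fin n)) X
  refine ⟨fun p => ?_⟩
  obtain ⟨K, hK, hKs, hKc⟩ := local_compact_nhds
    ((isOpen_extChartAt_source (I := 𝓡 n) p).mem_nhds (mem_extChartAt_source p))
  refine ⟨K, hK, ?_⟩
  rw [volMeasure_apply_of_subset_source g p hKc.measurableSet hKs]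
  have himg : IsCompact (extChartAt (𝓡 n) p '' K) :=
    hKc.image_of_continuousOn ((continuousOn_extChartAt p).mono hKs)
  have hsub : extChartAt (𝓡 n) p '' K ⊆ (extChartAt (𝓡 n) p).target := by
    rintro _ ⟨x, hx, rfl⟩; exact (extChartAt (𝓡 n) p).map_source (hKs hx)
  have hsub2 : (extChartAt (𝓡 n) p).target ∩ (extChartAt (𝓡 n) p).symm ⁻¹' K ⊆
      extChartAt (𝓡 n) p '' K := fun y hy =>
    ⟨_, hy.2, (extChartAt (𝓡 n) p).right_inv hy.1⟩
  refine (lintegral_mono_set hsub2).trans_lt ?_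
  have hi := ((continuousOn_sqrt_det_chartGram g p).mono hsub).integrableOn_compact (μ := volume) himg
  exact (hi.lintegral_lt_top)

theorem isOpenPosMeasure_volMeasure (g : C1Metric n X) :
    (volMeasure g).IsOpenPosMeasure := by
  refine ⟨fun O hO ⟨q, hq⟩ h0 => ?_⟩
  set ψ := (extChartAt (𝓡 n) q).symm
  have hopen : IsOpen ((extChartAt (𝓡 n) q).target ∩ ψ ⁻¹' O) :=
    (continuousOn_extChartAt_symm q).isOpen_inter_preimage (isOpen_extChartAt_target q) hO
  have hle : volMeasure g (O ∩ (extChartAt (𝓡 n) q).source) = 0 :=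
    measure_mono_null inter_subset_left h0
  rw [volMeasure_apply_of_subset_source g q
    (hO.measurableSet.inter (isOpen_extChartAt_source q).measurableSet) inter_subset_right] at hle
  have hset : (extChartAt (𝓡 n) q).target ∩ ψ ⁻¹' (O ∩ (extChartAt (𝓡 n) q).source) =
      (extChartAt (𝓡 n) q).target ∩ ψ ⁻¹' O := by
    ext y; constructor
    · rintro ⟨h1, h2⟩; exact ⟨h1, h2.1⟩
    · rintro ⟨h1, h2⟩; exact ⟨h1, h2, (extChartAt (𝓡 n) q).map_target h1⟩
  rw [hset] at hle
  have hcont := ((continuousOn_sqrt_det_chartGram g q).mono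
    (inter_subset_left (t := ψ ⁻¹' O))).aemeasurable (μ := volume) hopen.measurableSet
  rw [lintegral_eq_zero_iff' hcont.ennreal_ofReal] at hle
  have hne : volume ((extChartAt (𝓡 n) q).target ∩ ψ ⁻¹' O) ≠ 0 := by
    refine hopen.measure_ne_zero volume ⟨extChartAt (𝓡 n) q q, mem_extChartAt_target q, ?_⟩
    rw [mem_preimage, extChartAt_to_inv]; exact hq
  refine hne ?_
  have h3 := (ae_restrict_iff' hopen.measurableSet).1 hle
  refine measure_mono_null (fun y hy => ?_) (ae_iff.1 h3)
  simp only [mem_ofPred_eq, Pi.zero_apply, ENNReal.ofReal_eq_zero, Classical.not_imp, not_le]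
  exact ⟨hy, Real.sqrt_pos.2 (chartGram_det_pos g hy.1)⟩

end Manifold

/-! ### Green's identity -/

section Manifold

variable {n : ℕ} {X : Type*} [TopologicalSpace X] [ChartedSpace (EuclideanSpace ℝ (Fin n)) X]
  [IsManifold (𝓡 n) ∞ X]

theorem coInner_zero_right (A : Matrix (Fin n) (Fin n) ℝ) (v : Fin n → ℝ) :
    coInner A v 0 = 0 := by simp [coInner]

theorem chartDiff_eq_zero {φ : X → ℝ} {q : X} (hq : q ∉ tsupport φ) :
    chartDiff (n := n) φ q = 0 := by
  have h : φ =ᶠ[𝓝 q] fun _ => 0 := notMem_tsupport_iff_eventuallyEq.1 hq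
  rw [chartDiff_congr h]
  ext i
  have : ((fun _ : X => (0:ℝ)) ∘ (extChartAt (𝓡 n) q).symm) = fun _ => 0 := rfl
  simp only [chartDiff, pd_univ, this]
  simp

theorem gradInner_eq_zero_right (g : C1Metric n X) (f : X → ℝ) {φ : X → ℝ} {q : X}
    (hq : q ∉ tsupport φ) : gradInner g univ f φ q = 0 := by
  rw [gradInner_univ, chartDiff_eq_zero hq, coInner_zero_right]

theorem continuous_gradInner_of_tsupport (g : C1Metric n X) {f φ : X → ℝ} {Ω : Set X}
    (hΩ : IsOpen Ω) (hf : ∀ q ∈ Ω, ContMDiffAt (𝓡 n) 𝓘(ℝ, ℝ) 1 f q)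
    (hφ : ContMDiff (𝓡 n) 𝓘(ℝ, ℝ) 1 φ) (hs : tsupport φ ⊆ Ω) :
    Continuous (gradInner g univ f φ) := by
  refine ContinuousOn.continuous_of_tsupport_subset (s := Ω) (fun q hq =>
    (gradInner_continuousAt g (hf q hq) hφ.contMDiffAt).continuousWithinAt) hΩ ?_
  refine (closure_minimal (fun q hq => ?_) (isClosed_tsupport φ)).trans hs
  by_contra h
  exact hq (gradInner_eq_zero_right g f h)

theorem hasCompactSupport_gradInner (g : C1Metric n X) (f : X → ℝ) {φ : X → ℝ}
    (hc : HasCompactSupport φ) : HasCompactSupport (gradInner g univ f φ) := by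
  refine hc.mono' (fun q hq => ?_)
  by_contra h
  exact hq (gradInner_eq_zero_right g f h)

/-- The Laplacian computed in the preferred chart at `p`, as a function on the chart domain. -/
def chartLaplacian (g : C1Metric n X) (p : X) (f : X → ℝ) (q : X) : ℝ :=
  coordLaplacian (chartGram g p) univ (f ∘ (extChartAt (𝓡 n) p).symm) (extChartAt (𝓡 n) p q)

theorem continuousOn_chartLaplacian (g : C1Metric n X) (p : X) {f : X → ℝ} {Ω : Set X}
    (hf : ∀ q ∈ Ω, ContMDiffAt (𝓡 n) 𝓘(ℝ, ℝ) 2 f q) :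
    ContinuousOn (chartLaplacian g p f) (Ω ∩ (extChartAt (𝓡 n) p).source) := by
  have h1 : ContinuousOn (coordLaplacian (chartGram g p) univ (f ∘ (extChartAt (𝓡 n) p).symm))
      ((extChartAt (𝓡 n) p).target ∩ (extChartAt (𝓡 n) p).symm ⁻¹' Ω) :=
    coordLaplacian_continuousOn (fun y hy i j => chartGram_contDiffAt g hy.1 i j)
      (fun y hy => chartGram_det_pos g hy.1)
      (fun y hy => contDiffAt_comp_chart_symm (by norm_cast) hy.1 (hf _ hy.2))
  refine h1.comp ((continuousOn_extChartAt p).mono inter_subset_right) fun q hq => ?_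
  refine ⟨(extChartAt (𝓡 n) p).map_source hq.2, ?_⟩
  rw [mem_preimage, (extChartAt (𝓡 n) p).left_inv hq.2]; exact hq.1

variable [MeasurableSpace X] [BorelSpace X]

/-- Green's formula for a test function supported in a single chart domain. This is the weak
formulation of the Laplacian of that chart, with a right hand side that does not depend on it. -/
theorem integral_mul_chartLaplacian [T2Space X] (g : C1Metric n X) (p : X) {f φ : X → ℝ}
    {Ω : Set X} (hΩ : IsOpen Ω) (hf : ∀ q ∈ Ω, ContMDiffAt (𝓡 n) 𝓘(ℝ, ℝ) 2 f q)
    (hφ : ContMDiff (𝓡 n) 𝓘(ℝ, ℝ) 1 φ) (hc : HasCompactSupport φ)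
    (hs : tsupport φ ⊆ Ω) (hs' : tsupport φ ⊆ (extChartAt (𝓡 n) p).source) :
    ∫ q, φ q * chartLaplacian g p f q ∂(volMeasure g) =
      - ∫ q, gradInner g univ f φ q ∂(volMeasure g) := by
  set ψ := (extChartAt (𝓡 n) p).symm with hψ
  set T := (extChartAt (𝓡 n) p).target with hT
  set O := T ∩ ψ ⁻¹' Ω with hO
  have hTo : IsOpen T := isOpen_extChartAt_target p
  have hOo : IsOpen O := (continuousOn_extChartAt_symm p).isOpen_inter_preimage hTo hΩ
  have hc1 : Continuous fun q => φ q * chartLaplacian g p f q :=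
    continuous_mul_of_tsupport_subset (hΩ.inter (isOpen_extChartAt_source (I := 𝓡 n) p))
      hφ.continuous (subset_inter hs hs') (continuousOn_chartLaplacian g p hf)
  have hc2 : Continuous (gradInner g univ f φ) :=
    continuous_gradInner_of_tsupport g hΩ (fun q hq => (hf q hq).of_le (by norm_num)) hφ hs
  -- transport both integrals to the chart
  have htrans : ∀ {F : X → ℝ}, Continuous F → (∀ q, q ∉ tsupport φ → F q = 0) →
      ∫ q, F q ∂(volMeasure g) = ∫ y in T, √(chartGram g p y).det * F (ψ y) := by
    intro F hF h0
    rw [← setIntegral_eq_integral_of_forall_compl_eq_zero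
      (s := (extChartAt (𝓡 n) p).source) (fun q hq => h0 q fun h => hq (hs' h)),
      volMeasure_restrict_source,
      (isPatch_chart p).integral_patchMeasure g (continuousOn_sqrt_det_chartGram g p)
        (hF.measurable.aestronglyMeasurable)]
    rfl
  rw [htrans hc1 (fun q hq => by rw [image_eq_zero_of_notMem_tsupport hq, zero_mul]),
    htrans hc2 (fun q hq => gradInner_eq_zero_right g f hq)]
  -- the test function in the chart
  set Φ : EuclideanSpace ℝ (Fin n) → ℝ := T.indicator (φ ∘ ψ) with hΦ
  set K := extChartAt (𝓡 n) p '' tsupport φ with hK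
  have hKc : IsCompact K := hc.isCompact.image_of_continuousOn ((continuousOn_extChartAt p).mono hs')
  have hKT : K ⊆ T := by
    rintro _ ⟨x, hx, rfl⟩; exact (extChartAt (𝓡 n) p).map_source (hs' hx)
  have hKO : K ⊆ O := by
    rintro _ ⟨x, hx, rfl⟩
    refine ⟨(extChartAt (𝓡 n) p).map_source (hs' hx), ?_⟩
    rw [mem_preimage, hψ, (extChartAt (𝓡 n) p).left_inv (hs' hx)]; exact hs hx
  have hnK : ∀ y ∈ T, y ∉ K → ψ y ∉ tsupport φ := fun y hy hyK h =>
    hyK ⟨ψ y, h, (extChartAt (𝓡 n) p).right_inv hy⟩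
  have hΦ0 : ∀ y, y ∉ K → Φ y = 0 := by
    intro y hy
    by_cases hyT : y ∈ T
    · rw [hΦ, indicator_of_mem hyT, Function.comp_apply,
        image_eq_zero_of_notMem_tsupport (hnK y hyT hy)]
    · rw [hΦ, indicator_of_notMem hyT]
  have hΦs : tsupport Φ ⊆ K := closure_minimal (fun y hy => by
    by_contra h; exact hy (hΦ0 y h)) hKc.isClosed
  have hΦe : ∀ y ∈ T, Φ =ᶠ[𝓝 y] φ ∘ ψ := fun y hy => by
    filter_upwards [hTo.mem_nhds hy] with z hz
    rw [hΦ, indicator_of_mem hz]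
  have hΦd : ContDiff ℝ 1 Φ := by
    refine contDiff_iff_contDiffAt.2 fun y => ?_
    by_cases hy : y ∈ K
    · exact (contDiffAt_comp_chart_symm (by norm_cast) (hKT hy) hφ.contMDiffAt).congr_of_eventuallyEq
        (hΦe y (hKT hy))
    · refine (contDiffAt_const (c := (0:ℝ))).congr_of_eventuallyEq ?_
      filter_upwards [hKc.isClosed.isOpen_compl.mem_nhds hy] with z hz
      exact hΦ0 z hz
  have hgreen := integral_mul_coordLaplacian (G := chartGram g p) (F := f ∘ ψ) (φ := Φ) hOo
    (fun y hy i j => chartGram_contDiffAt g hy.1 i j) (fun z => gram_isSymm g _ _)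
    (fun y hy => chartGram_det_pos g hy.1)
    (fun y hy => contDiffAt_comp_chart_symm (by norm_cast) hy.1 (hf _ hy.2)) hΦd
    (HasCompactSupport.of_support_subset_isCompact hKc (subset_closure.trans hΦs)) (hΦs.trans hKO)
  have e1 : ∫ y in T, √(chartGram g p y).det * (φ (ψ y) * chartLaplacian g p f (ψ y)) =
      ∫ y, Φ y * (√(chartGram g p y).det * coordLaplacian (chartGram g p) univ (f ∘ ψ) y) := by
    rw [← setIntegral_eq_integral_of_forall_compl_eq_zero (s := T)
      (f := fun y => Φ y * (√(chartGram g p y).det * coordLaplacian (chartGram g p) univ (f ∘ ψ) y))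
      (fun y hy => by rw [hΦ, indicator_of_notMem hy, zero_mul])]
    refine setIntegral_congr_fun hTo.measurableSet fun y hy => ?_
    have : chartLaplacian g p f (ψ y) = coordLaplacian (chartGram g p) univ (f ∘ ψ) y := by
      rw [chartLaplacian, (extChartAt (𝓡 n) p).right_inv hy]
    simp only [this, hΦ, indicator_of_mem hy, Function.comp_apply]; ring
  have e2 : ∫ y in T, √(chartGram g p y).det * gradInner g univ f φ (ψ y) =
      ∫ y, √(chartGram g p y).det * coordGradInner (chartGram g p) univ (f ∘ ψ) Φ y := by
    have hz : ∀ y, y ∉ K → coordGradInner (chartGram g p) univ (f ∘ ψ) Φ y = 0 := by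
      intro y hy
      have : Φ =ᶠ[𝓝 y] fun _ => 0 :=
        notMem_tsupport_iff_eventuallyEq.1 fun h => hy (hΦs h)
      simp [coordGradInner, pd_univ, this.fderiv_eq]
    rw [← setIntegral_eq_integral_of_forall_compl_eq_zero (s := T)
      (f := fun y => √(chartGram g p y).det * coordGradInner (chartGram g p) univ (f ∘ ψ) Φ y)
      (fun y hy => by rw [hz y fun h => hy (hKT h), mul_zero])]
    refine setIntegral_congr_fun hTo.measurableSet fun y hy => ?_
    by_cases hyK : y ∈ K
    · have h1 := gradInner_eq_coInner g (p := p) (q := ψ y) (f := f) (h := φ)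
        ((extChartAt (𝓡 n) p).map_target hy)
        ((hf _ (hKO hyK).2).mdifferentiableAt (by norm_num))
        (hφ.contMDiffAt.mdifferentiableAt (by norm_num))
      rw [(extChartAt (𝓡 n) p).right_inv hy] at h1
      simp only [h1, coordGradInner, pd_univ, (hΦe y hy).fderiv_eq]
      rfl
    · simp only [hz y hyK, gradInner_eq_zero_right g f (hnK y hy hyK)]
  rw [e1, e2, hgreen]

/-- The Laplacian can be computed in any chart. Both expressions are continuous and represent the
divergence of the gradient in the weak sense. -/
theorem chartLaplacian_eq [T2Space X] [SigmaCompactSpace X] (g : C1Metric n X) (p : X)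
    {f : X → ℝ} {Ω : Set X} (hΩ : IsOpen Ω)
    (hf : ∀ q ∈ Ω, ContMDiffAt (𝓡 n) 𝓘(ℝ, ℝ) 2 f q) {q : X} (hq : q ∈ Ω)
    (hqs : q ∈ (extChartAt (𝓡 n) p).source) :
    chartLaplacian g p f q = laplacian g univ f q := by
  have := isLocallyFiniteMeasure_volMeasure g
  have := isOpenPosMeasure_volMeasure g
  set O := (Ω ∩ (extChartAt (𝓡 n) p).source) ∩ (extChartAt (𝓡 n) q).source with hO
  have hOo : IsOpen O := (hΩ.inter (isOpen_extChartAt_source p)).inter (isOpen_extChartAt_source q)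
  have c1 : ContinuousOn (chartLaplacian g p f) O :=
    (continuousOn_chartLaplacian g p hf).mono inter_subset_left
  have c2 : ContinuousOn (chartLaplacian g q f) O :=
    (continuousOn_chartLaplacian g q hf).mono fun x hx => ⟨hx.1.1, hx.2⟩
  have hae : ∀ᵐ x ∂(volMeasure g), x ∈ O → (chartLaplacian g p f x - chartLaplacian g q f x) = 0 := by
    refine hOo.ae_eq_zero_of_integral_contMDiff_smul_eq_zero (𝓡 n)
      ((c1.sub c2).locallyIntegrableOn hOo.measurableSet) fun φ hφ hc hs => ?_
    have hφ1 : ContMDiff (𝓡 n) 𝓘(ℝ, ℝ) 1 φ := hφ.of_le (by norm_cast)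
    have i1 : Integrable (fun x => φ x * chartLaplacian g p f x) (volMeasure g) :=
      (continuous_mul_of_tsupport_subset hOo hφ.continuous hs c1).integrable_of_hasCompactSupport
        hc.mul_right
    have i2 : Integrable (fun x => φ x * chartLaplacian g q f x) (volMeasure g) :=
      (continuous_mul_of_tsupport_subset hOo hφ.continuous hs c2).integrable_of_hasCompactSupport
        hc.mul_right
    simp only [smul_eq_mul, mul_sub]
    rw [integral_sub i1 i2,
      integral_mul_chartLaplacian g p hΩ hf hφ1 hc (fun x hx => (hs hx).1.1) (fun x hx => (hs hx).1.2),
      integral_mul_chartLaplacian g q hΩ hf hφ1 hc (fun x hx => (hs hx).1.1) (fun x hx => (hs hx).2),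
      sub_self]
  have hae' : chartLaplacian g p f =ᵐ[(volMeasure g).restrict O] chartLaplacian g q f := by
    refine (ae_restrict_iff' hOo.measurableSet).2 ?_
    filter_upwards [hae] with x hx hxO
    exact sub_eq_zero.1 (hx hxO)
  exact Measure.eqOn_open_of_ae_eq hae' hOo c1 c2 ⟨⟨hq, hqs⟩, mem_extChartAt_source q⟩

theorem continuousOn_laplacian [T2Space X] [SigmaCompactSpace X] (g : C1Metric n X)
    {f : X → ℝ} {Ω : Set X} (hΩ : IsOpen Ω)
    (hf : ∀ q ∈ Ω, ContMDiffAt (𝓡 n) 𝓘(ℝ, ℝ) 2 f q) :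
    ContinuousOn (laplacian g univ f) Ω := by
  intro q hq
  have hs := mem_extChartAt_source (I := 𝓡 n) q
  have hn : Ω ∩ (extChartAt (𝓡 n) q).source ∈ 𝓝 q :=
    (hΩ.inter (isOpen_extChartAt_source q)).mem_nhds ⟨hq, hs⟩
  refine ContinuousAt.continuousWithinAt ?_
  refine ((continuousOn_chartLaplacian g q hf).continuousAt hn).congr ?_
  filter_upwards [hn] with x hx
  exact chartLaplacian_eq g q hΩ hf hx.1 hx.2

theorem chartDiff_finsetSum {ι : Type*} (s : Finset ι) {f : ι → X → ℝ} {p : X}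
    (hf : ∀ i ∈ s, MDifferentiableAt (𝓡 n) 𝓘(ℝ, ℝ) (f i) p) :
    chartDiff (n := n) (fun q => ∑ i ∈ s, f i q) p = ∑ i ∈ s, chartDiff (f i) p := by
  have hp := mem_extChartAt_source (I := 𝓡 n) p
  ext j
  have h1 := (HasFDerivAt.fun_sum (u := s) fun i hi =>
    (differentiableAt_comp_chart_symm hp (hf i hi)).hasFDerivAt).fderiv
  have h2 := congrArg (fun L : EuclideanSpace ℝ (Fin n) →L[ℝ] ℝ => L (stdVec j)) h1
  simp only [sum_apply] at h2
  simp only [chartDiff, pd_univ, Finset.sum_apply]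
  exact h2

theorem coInner_sum_right {ι : Type*} (s : Finset ι) (A : Matrix (Fin n) (Fin n) ℝ)
    (v : Fin n → ℝ) (w : ι → Fin n → ℝ) :
    coInner A v (∑ i ∈ s, w i) = ∑ i ∈ s, coInner A v (w i) := by
  classical
  induction s using Finset.induction_on with
  | empty => simp [coInner_zero_right]
  | insert a s ha ih => rw [Finset.sum_insert ha, Finset.sum_insert ha, coInner_add_right, ih]

/-- Green's formula for a compactly supported test function. -/
theorem integral_mul_laplacian [T2Space X] [SigmaCompactSpace X] (g : C1Metric n X)
    {f φ : X → ℝ} {Ω : Set X} (hΩ : IsOpen Ω)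
    (hf : ∀ q ∈ Ω, ContMDiffAt (𝓡 n) 𝓘(ℝ, ℝ) 2 f q)
    (hφ : ContMDiff (𝓡 n) 𝓘(ℝ, ℝ) 1 φ) (hc : HasCompactSupport φ) (hs : tsupport φ ⊆ Ω) :
    ∫ q, φ q * laplacian g univ f q ∂(volMeasure g) =
      - ∫ q, gradInner g univ f φ q ∂(volMeasure g) := by
  have := isLocallyFiniteMeasure_volMeasure g
  obtain ⟨t, ht⟩ := hc.isCompact.elim_finite_subcover (fun p : X => (extChartAt (𝓡 n) p).source)
    (fun p => isOpen_extChartAt_source p)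
    (fun x _ => mem_iUnion.2 ⟨x, mem_extChartAt_source x⟩)
  obtain ⟨ρ, hρ⟩ := SmoothPartitionOfUnity.exists_isSubordinate (𝓡 n) (isClosed_tsupport φ)
    (fun p : t => (extChartAt (𝓡 n) (p : X)).source) (fun p => isOpen_extChartAt_source _)
    (fun x hx => by
      obtain ⟨p, hp⟩ := mem_iUnion.1 (ht hx)
      obtain ⟨hp1, hp2⟩ := mem_iUnion.1 hp
      exact mem_iUnion.2 ⟨⟨p, hp1⟩, hp2⟩)
  set φi : t → X → ℝ := fun i x => ρ i x * φ x with hφi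
  have hsum : ∀ x, ∑ i, φi i x = φ x := by
    intro x
    rw [← Finset.sum_mul]
    by_cases hx : x ∈ tsupport φ
    · have := ρ.sum_eq_one hx
      rw [finsum_eq_sum_of_fintype] at this
      rw [this, one_mul]
    · rw [image_eq_zero_of_notMem_tsupport hx, mul_zero]
  have hφid : ∀ i, ContMDiff (𝓡 n) 𝓘(ℝ, ℝ) 1 (φi i) := fun i =>
    ((ρ i).contMDiff.of_le (by norm_cast)).mul hφ
  have hφis : ∀ i, tsupport (φi i) ⊆ tsupport φ := fun i => tsupport_mul_subset_right
  have hφis' : ∀ i, tsupport (φi i) ⊆ (extChartAt (𝓡 n) (i : X)).source := fun i =>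
    tsupport_mul_subset_left.trans (hρ i)
  have hφic : ∀ i, HasCompactSupport (φi i) := fun i => hc.mul_left
  have hlap := continuousOn_laplacian g hΩ hf
  have i1 : ∀ i, Integrable (fun x => φi i x * laplacian g univ f x) (volMeasure g) := fun i =>
    (continuous_mul_of_tsupport_subset hΩ (hφid i).continuous ((hφis i).trans hs)
      hlap).integrable_of_hasCompactSupport (hφic i).mul_right
  have i2 : ∀ i, Integrable (fun x => gradInner g univ f (φi i) x) (volMeasure g) := fun i =>
    (continuous_gradInner_of_tsupport g hΩ (fun q hq => (hf q hq).of_le (by norm_num)) (hφid i)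
      ((hφis i).trans hs)).integrable_of_hasCompactSupport (hasCompactSupport_gradInner g f (hφic i))
  have e1 : ∀ x, φ x * laplacian g univ f x = ∑ i, φi i x * laplacian g univ f x := fun x => by
    rw [← Finset.sum_mul, hsum]
  have e2 : ∀ x, gradInner g univ f φ x = ∑ i, gradInner g univ f (φi i) x := fun x => by
    have h1 := chartDiff_finsetSum (n := n) Finset.univ (f := φi) (p := x) fun i _ =>
      (hφid i).contMDiffAt.mdifferentiableAt (by norm_num)
    simp only [hsum] at h1
    simp only [gradInner_univ]
    rw [← coInner_sum_right, ← h1]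
  simp only [e1, e2]
  rw [integral_finsetSum _ fun i _ => i1 i, integral_finsetSum _ fun i _ => i2 i,
    ← Finset.sum_neg_distrib]
  refine Finset.sum_congr rfl fun i _ => ?_
  rw [← integral_mul_chartLaplacian g (i : X) hΩ hf (hφid i) (hφic i) ((hφis i).trans hs) (hφis' i)]
  refine integral_congr_ae (Eventually.of_forall fun x => ?_)
  by_cases hx : x ∈ tsupport (φi i)
  · simp only [chartLaplacian_eq g (i : X) hΩ hf (hs (hφis i hx)) (hφis' i hx)]
  · simp only [image_eq_zero_of_notMem_tsupport hx, zero_mul]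

end Manifold

/-! ### Flattening the level sets of a function -/

section Slices

variable {m : ℕ}

theorem fderiv_euclidean_apply {k : ℕ} {E : Type*} [NormedAddCommGroup E] [NormedSpace ℝ E]
    {f : E → EuclideanSpace ℝ (Fin k)} {y : E} (hf : DifferentiableAt ℝ f y) (v : E) (a : Fin k) :
    (fderiv ℝ f y v) a = fderiv ℝ (fun z => f z a) y v := by
  have h := (EuclideanSpace.proj a : EuclideanSpace ℝ (Fin k) →L[ℝ] ℝ).hasFDerivAt.comp y hf.hasFDerivAt
  have h2 := congrArg (fun L : E →L[ℝ] ℝ => L v) h.fderiv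
  exact h2.symm

/-- The point with first coordinate `t` and remaining coordinates `y`. -/
def sliceMap (t : ℝ) (y : EuclideanSpace ℝ (Fin m)) : EuclideanSpace ℝ (Fin (m + 1)) :=
  WithLp.toLp 2 (Fin.cons t y.ofLp)

/-- The projection forgetting the first coordinate. -/
def tailMap (z : EuclideanSpace ℝ (Fin (m + 1))) : EuclideanSpace ℝ (Fin m) :=
  WithLp.toLp 2 (fun j => z j.succ)

@[simp] theorem sliceMap_zero (t : ℝ) (y : EuclideanSpace ℝ (Fin m)) : sliceMap t y 0 = t := rfl
@[simp] theorem sliceMap_succ (t : ℝ) (y : EuclideanSpace ℝ (Fin m)) (j : Fin m) :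
    sliceMap t y j.succ = y j := rfl
@[simp] theorem tailMap_apply (z : EuclideanSpace ℝ (Fin (m + 1))) (j : Fin m) :
    tailMap z j = z j.succ := rfl

theorem tailMap_sliceMap (t : ℝ) (y : EuclideanSpace ℝ (Fin m)) : tailMap (sliceMap t y) = y := by
  ext j; simp

theorem sliceMap_tailMap (z : EuclideanSpace ℝ (Fin (m + 1))) : sliceMap (z 0) (tailMap z) = z := by
  ext j; refine Fin.cases ?_ (fun i => ?_) j <;> simp

theorem contDiff_coord {k : ℕ} (a : Fin k) {l : WithTop ℕ∞} :
    ContDiff ℝ l fun z : EuclideanSpace ℝ (Fin k) => z a :=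
  (EuclideanSpace.proj a : EuclideanSpace ℝ (Fin k) →L[ℝ] ℝ).contDiff

theorem contDiff_sliceMap (t : ℝ) {l : WithTop ℕ∞} : ContDiff ℝ l (sliceMap (m := m) t) := by
  refine contDiff_euclidean.2 fun i => ?_
  refine Fin.cases ?_ (fun j => ?_) i
  · exact contDiff_const
  · exact contDiff_coord j

theorem contDiff_tailMap {l : WithTop ℕ∞} : ContDiff ℝ l (tailMap (m := m)) :=
  contDiff_euclidean.2 fun i => contDiff_coord i.succ

theorem fderiv_coord {k : ℕ} (a : Fin k) (y : EuclideanSpace ℝ (Fin k)) :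
    fderiv ℝ (fun z : EuclideanSpace ℝ (Fin k) => z a) y = EuclideanSpace.proj a :=
  (EuclideanSpace.proj a : EuclideanSpace ℝ (Fin k) →L[ℝ] ℝ).fderiv

theorem jacobian_sliceMap (t : ℝ) (y : EuclideanSpace ℝ (Fin m)) (a : Fin (m + 1)) (j : Fin m) :
    jacobian (sliceMap t) y a j = if a = j.succ then 1 else 0 := by
  rw [jacobian, Matrix.of_apply,
    fderiv_euclidean_apply ((contDiff_sliceMap (l := 1) t).differentiable (by norm_num) y)]
  refine Fin.cases ?_ (fun i => ?_) a
  · simp [(Fin.succ_ne_zero j).symm]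
  · simp only [sliceMap_succ, fderiv_coord, stdVec]
    simp

/-- Pulling back a bilinear form to a slice deletes the first row and column of its matrix. -/
theorem jacobian_sliceMap_conj (A : Matrix (Fin (m + 1)) (Fin (m + 1)) ℝ) (t : ℝ)
    (y : EuclideanSpace ℝ (Fin m)) :
    (jacobian (sliceMap t) y).transpose * A * jacobian (sliceMap t) y =
      A.submatrix Fin.succ Fin.succ := by
  ext i j
  simp [Matrix.mul_apply, jacobian_sliceMap]

/-- Lebesgue measure is the product of the Lebesgue measures of the first and of the other
coordinates. -/
theorem measurePreserving_sliceMap :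
    MeasurePreserving (fun x : ℝ × EuclideanSpace ℝ (Fin m) => sliceMap x.1 x.2) := by
  have h1 : MeasurePreserving (Prod.map id WithLp.ofLp : ℝ × EuclideanSpace ℝ (Fin m) → ℝ × (Fin m → ℝ)) :=
    (MeasurePreserving.id volume).prod (PiLp.volume_preserving_ofLp (Fin m))
  have h2 := (volume_preserving_piFinSuccAbove (fun _ : Fin (m + 1) => ℝ) 0).symm
  have h3 := PiLp.volume_preserving_toLp (Fin (m + 1))
  convert h3.comp (h2.comp h1) using 1
  ext x i
  refine Fin.cases ?_ (fun j => ?_) i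
  · rfl
  · rfl

/-- A `C¹` function with nonvanishing differential at `y₀` is the first coordinate of a local `C¹`
coordinate system. -/
theorem exists_flattening {F : EuclideanSpace ℝ (Fin (m + 1)) → ℝ}
    {T : Set (EuclideanSpace ℝ (Fin (m + 1)))} (hT : IsOpen T)
    (hF : ∀ y ∈ T, ContDiffAt ℝ 1 F y) {y₀ : EuclideanSpace ℝ (Fin (m + 1))} (hy₀ : y₀ ∈ T)
    {i₀ : Fin (m + 1)} (hi₀ : fderiv ℝ F y₀ (stdVec i₀) ≠ 0) :
    ∃ (W V : Set (EuclideanSpace ℝ (Fin (m + 1))))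
      (τ Φ : EuclideanSpace ℝ (Fin (m + 1)) → EuclideanSpace ℝ (Fin (m + 1))),
      IsOpen W ∧ IsOpen V ∧ V ⊆ T ∧ y₀ ∈ V ∧ (∀ z ∈ W, ContDiffAt ℝ 1 τ z) ∧
      (∀ y ∈ V, ContDiffAt ℝ 1 Φ y) ∧ (∀ z ∈ W, τ z ∈ V ∧ Φ (τ z) = z) ∧
      (∀ y ∈ V, Φ y ∈ W ∧ τ (Φ y) = y) ∧ ∀ y, (Φ y) 0 = F y := by
  -- delete the coordinate `i₀` and put `F` in front; then apply the inverse function theorem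
  set Φ : EuclideanSpace ℝ (Fin (m + 1)) → EuclideanSpace ℝ (Fin (m + 1)) :=
    fun y => WithLp.toLp 2 (Fin.cons (F y) fun j => y (i₀.succAbove j)) with hΦ
  have hΦ0 : ∀ y, (Φ y) 0 = F y := fun y => rfl
  have hΦs : ∀ y j, (Φ y) (Fin.succ j) = y (i₀.succAbove j) := fun y j => rfl
  have hΦd : ∀ y ∈ T, ContDiffAt ℝ 1 Φ y := by
    intro y hy
    refine contDiffAt_euclidean.2 fun i => ?_
    refine Fin.cases ?_ (fun j => ?_) i
    · exact hF y hy
    · exact (contDiff_coord (i₀.succAbove j)).contDiffAt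
  have hdiff := (hΦd y₀ hy₀).differentiableAt (by norm_num)
  have hinj : Function.Injective (fderiv ℝ Φ y₀) := by
    refine (injective_iff_map_eq_zero _).2 fun v hv => ?_
    have hvs : ∀ j, v (i₀.succAbove j) = 0 := by
      intro j
      have h := fderiv_euclidean_apply hdiff v j.succ
      rw [hv] at h
      simp only [hΦs, fderiv_coord] at h
      exact h.symm
    have hv1 : v = v i₀ • stdVec i₀ := by
      ext i
      by_cases hi : i = i₀
      · subst hi; simp [stdVec]
      · obtain ⟨j, rfl⟩ := Fin.exists_succAbove_eq hi
        simp [stdVec, hvs, hi]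
    have h := fderiv_euclidean_apply hdiff v 0
    rw [hv] at h
    simp only [hΦ0] at h
    rw [hv1, map_smul, smul_eq_mul] at h
    have : v i₀ = 0 := by
      rcases mul_eq_zero.1 h.symm with h | h
      · exact h
      · exact absurd h hi₀
    rw [hv1, this, zero_smul]
  set L : EuclideanSpace ℝ (Fin (m + 1)) ≃L[ℝ] EuclideanSpace ℝ (Fin (m + 1)) :=
    (LinearEquiv.ofInjectiveEndo (fderiv ℝ Φ y₀ : _ →ₗ[ℝ] _) hinj).toContinuousLinearEquiv with hL
  have hL' : HasFDerivAt Φ (L : EuclideanSpace ℝ (Fin (m + 1)) →L[ℝ] _) y₀ := by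
    have : (L : EuclideanSpace ℝ (Fin (m + 1)) →L[ℝ] EuclideanSpace ℝ (Fin (m + 1))) =
        fderiv ℝ Φ y₀ := by
      ext v : 1
      simp [hL]
    rw [this]; exact hdiff.hasFDerivAt
  set e := (hΦd y₀ hy₀).toOpenPartialHomeomorph Φ hL' one_ne_zero with he
  have hey : y₀ ∈ e.source := (hΦd y₀ hy₀).mem_toOpenPartialHomeomorph_source hL' one_ne_zero
  have het : Φ y₀ ∈ e.target := e.map_source hey
  have hsymm : e.symm (Φ y₀) = y₀ := e.left_inv hey
  have hsd : ContDiffAt ℝ 1 e.symm (Φ y₀) := (hΦd y₀ hy₀).to_localInverse hL' one_ne_zero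
  have hnhds : e.target ∩ e.symm ⁻¹' T ∩ {z | ContDiffAt ℝ 1 e.symm z} ∈ 𝓝 (Φ y₀) := by
    refine inter_mem (inter_mem (e.open_target.mem_nhds het) ?_) (hsd.eventually (by norm_num))
    exact hsd.continuousAt.preimage_mem_nhds (by rw [hsymm]; exact hT.mem_nhds hy₀)
  obtain ⟨W, hW, hWo, hWm⟩ := mem_nhds_iff.1 hnhds
  have hVo : IsOpen (T ∩ (e.source ∩ Φ ⁻¹' W)) :=
    hT.inter (e.continuousOn.isOpen_inter_preimage e.open_source hWo)
  refine ⟨W, T ∩ (e.source ∩ Φ ⁻¹' W), e.symm, Φ, hWo, hVo, inter_subset_left, ⟨hy₀, hey, hWm⟩,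
    fun z hz => (hW hz).2, fun y hy => hΦd y hy.1, fun z hz => ?_, fun y hy => ?_, hΦ0⟩
  · have h1 : Φ (e.symm z) = z := e.right_inv (hW hz).1.1
    refine ⟨⟨(hW hz).1.2, e.map_target (hW hz).1.1, ?_⟩, h1⟩
    rw [mem_preimage, h1]; exact hz
  · exact ⟨hy.2.2, e.left_inv hy.2.1⟩

end Slices

/-! ### The coarea formula -/

section Coarea

variable {m : ℕ} {X : Type*} [TopologicalSpace X]
  [ChartedSpace (EuclideanSpace ℝ (Fin (m + 1))) X] [IsManifold (𝓡 (m + 1)) ∞ X]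

/-- Cramer's rule for the entry of the inverse metric belonging to the first coordinate. -/
theorem inv_zero_zero_mul_det {A : Matrix (Fin (m + 1)) (Fin (m + 1)) ℝ} (hA : 0 < A.det) :
    A⁻¹ 0 0 * A.det = (A.submatrix Fin.succ Fin.succ).det := by
  rw [Matrix.inv_def, Ring.inverse_eq_inv, Matrix.smul_apply, smul_eq_mul,
    Matrix.adjugate_fin_succ_eq_det_submatrix]
  have : (0 : Fin (m + 1)).succAbove = Fin.succ := by ext j; simp
  rw [this]
  field_simp
  simp

variable [MeasurableSpace X] [BorelSpace X]

theorem chartDiff_ne_zero (g : C1Metric (m + 1) X) (r : X → ℝ) (p : X)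
    (h : gradNorm g univ r p ≠ 0) : chartDiff (n := m + 1) r p ≠ 0 := by
  intro h0
  apply h
  rw [gradNorm, gradInner_univ, h0, coInner_zero_right, Real.sqrt_zero]

/-- The coarea formula near a point at which `r` has no critical point. -/
theorem exists_local_coarea (g : C1Metric (m + 1) X) {r : X → ℝ}
    (hr : ContMDiff (𝓡 (m + 1)) 𝓘(ℝ, ℝ) 1 r) (p : X) (hp : gradNorm g univ r p ≠ 0) :
    ∃ U : Set X, IsOpen U ∧ p ∈ U ∧ ∀ f : X → ℝ≥0∞, Measurable f →
      AEMeasurable (fun t : ℝ => ∫⁻ x in U, f x ∂(areaMeasure g m {q | r q = t})) volume ∧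
      ∫⁻ x in U, f x * ENNReal.ofReal (gradNorm g univ r x) ∂(volMeasure g) =
        ∫⁻ t : ℝ, ∫⁻ x in U, f x ∂(areaMeasure g m {q | r q = t}) := by
  set φ := extChartAt (𝓡 (m + 1)) p with hφ
  have hTo : IsOpen φ.target := isOpen_extChartAt_target p
  have hSo : IsOpen φ.source := isOpen_extChartAt_source p
  have hps : p ∈ φ.source := mem_extChartAt_source p
  obtain ⟨i₀, hi₀⟩ : ∃ i₀, chartDiff (n := m + 1) r p i₀ ≠ 0 := by
    by_contra hcon
    push Not at hcon
    exact chartDiff_ne_zero g r p hp (funext hcon)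
  rw [chartDiff, pd_univ] at hi₀
  obtain ⟨W, V, τ, Φ, hWo, hVo, hVT, hpV, hτ, hΦ, hτV, hΦW, hΦ0⟩ := exists_flattening hTo
    (fun y hy => contDiffAt_comp_chart_symm (by norm_cast) hy hr.contMDiffAt)
    (φ.map_source hps) hi₀
  -- `Θ` parametrizes `U` with `r` as the first coordinate, and `P` is its inverse
  set U : Set X := φ.source ∩ φ ⁻¹' V with hU
  have hUo : IsOpen U := (continuousOn_extChartAt p).isOpen_inter_preimage hSo hVo
  set Θ : EuclideanSpace ℝ (Fin (m + 1)) → X := φ.symm ∘ τ with hΘ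
  set P : X → EuclideanSpace ℝ (Fin (m + 1)) := Φ ∘ φ with hP
  have hφs : ∀ y ∈ φ.target, ContMDiffAt (𝓡 (m + 1)) (𝓡 (m + 1)) 1 φ.symm y := fun y hy =>
    (contMDiffOn_extChartAt_symm (n := 1) p).contMDiffAt (hTo.mem_nhds hy)
  have hφd : ∀ x ∈ φ.source, ContMDiffAt (𝓡 (m + 1)) (𝓡 (m + 1)) 1 φ x := fun x hx =>
    contMDiffAt_extChartAt' (by simpa [hφ] using hx)
  have hΘd : ∀ z ∈ W, ContMDiffAt (𝓡 (m + 1)) (𝓡 (m + 1)) 1 Θ z := fun z hz =>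
    (hφs _ (hVT (hτV z hz).1)).comp z (contMDiffAt_iff_contDiffAt.2 (hτ z hz))
  have hPd : ∀ x ∈ U, ContMDiffAt (𝓡 (m + 1)) (𝓡 (m + 1)) 1 P x := fun x hx =>
    (contMDiffAt_iff_contDiffAt.2 (hΦ _ hx.2)).comp x (hφd x hx.1)
  have hPΘ : ∀ z ∈ W, P (Θ z) = z := fun z hz => by
    simp only [hP, hΘ, Function.comp_apply, φ.right_inv (hVT (hτV z hz).1), (hτV z hz).2]
  have hΘU : MapsTo Θ W U := fun z hz => by
    refine ⟨φ.map_target (hVT (hτV z hz).1), ?_⟩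
    simp only [mem_preimage, hΘ, Function.comp_apply, φ.right_inv (hVT (hτV z hz).1)]
    exact (hτV z hz).1
  have hΘP : ∀ x ∈ U, P x ∈ W ∧ Θ (P x) = x := fun x hx => by
    refine ⟨(hΦW _ hx.2).1, ?_⟩
    simp only [hP, hΘ, Function.comp_apply, (hΦW _ hx.2).2, φ.left_inv hx.1]
  have hrP : ∀ x ∈ U, (P x) 0 = r x := fun x hx => by
    simp only [hP, Function.comp_apply, hΦ0]
    exact congrArg r (φ.left_inv hx.1)
  have hrΘ : ∀ z ∈ W, r (Θ z) = z 0 := fun z hz => by rw [← hrP _ (hΘU hz), hPΘ z hz]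
  have hpatch : IsPatch (n := m + 1) (univ : Set X) W Θ :=
    { isOpen := hWo
      contMDiffOn := fun z hz => (hΘd z hz).contMDiffWithinAt
      injOn := fun z hz w hw h => by rw [← hPΘ z hz, ← hPΘ w hw, h]
      immersion := fun z hz => mfderiv_injective_of_leftInverse
        ((hΘd z hz).mdifferentiableAt (by norm_num))
        ((hPd _ (hΘU hz)).mdifferentiableAt (by norm_num))
        (by filter_upwards [hWo.mem_nhds hz] with w hw using hPΘ w hw)
      mapsTo := fun _ _ => mem_univ _ }
  have hvol : (volMeasure g).restrict U = patchMeasure g W Θ :=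
    areaMeasure_restrict_eq g hpatch hUo hΘU (fun x hx => (hPd x hx).contMDiffWithinAt)
      fun x hx => hΘP x hx.2
  have hslice : ∀ t : ℝ, IsPatch (n := m + 1) {q | r q = t} (sliceMap t ⁻¹' W) (Θ ∘ sliceMap t) := by
    intro t
    have hd : ∀ y ∈ sliceMap t ⁻¹' W, ContMDiffAt (𝓡 m) (𝓡 (m + 1)) 1 (Θ ∘ sliceMap t) y :=
      fun y hy => (hΘd _ hy).comp y
        (contMDiffAt_iff_contDiffAt.2 (contDiff_sliceMap (l := 1) t).contDiffAt)
    have ho : IsOpen (sliceMap (m := m) t ⁻¹' W) :=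
      hWo.preimage (contDiff_sliceMap (l := 1) t).continuous
    have hl : ∀ y ∈ sliceMap t ⁻¹' W, (tailMap ∘ P) ((Θ ∘ sliceMap t) y) = y := fun y hy => by
      simp only [Function.comp_apply, hPΘ _ hy, tailMap_sliceMap]
    exact
    { isOpen := ho
      contMDiffOn := fun y hy => (hd y hy).contMDiffWithinAt
      injOn := fun y hy w hw h => by rw [← hl y hy, ← hl w hw, h]
      immersion := fun y hy => mfderiv_injective_of_leftInverse
        ((hd y hy).mdifferentiableAt (by norm_num))
        (((contMDiffAt_iff_contDiffAt.2 (contDiff_tailMap (l := 1)).contDiffAt).comp _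
          (hPd _ (hΘU hy))).mdifferentiableAt (by norm_num))
        (by filter_upwards [ho.mem_nhds hy] with w hw using hl w hw)
      mapsTo := fun y hy => by
        show r (Θ (sliceMap t y)) = t
        rw [hrΘ _ hy, sliceMap_zero] }
  have harea : ∀ t : ℝ, (areaMeasure g m {q | r q = t}).restrict U =
      patchMeasure g (sliceMap t ⁻¹' W) (Θ ∘ sliceMap t) := by
    intro t
    refine areaMeasure_restrict_eq g (π := tailMap ∘ P) (hslice t) hUo (fun y hy => hΘU hy)
      (fun x hx => ((contMDiffAt_iff_contDiffAt.2 (contDiff_tailMap (l := 1)).contDiffAt).comp _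
          (hPd x hx)).contMDiffWithinAt) fun x hx => ?_
    have h1 : sliceMap t ((tailMap ∘ P) x) = P x := by
      have : t = (P x) 0 := by rw [hrP x hx.2]; exact hx.1.symm
      rw [this]; exact sliceMap_tailMap _
    refine ⟨?_, ?_⟩
    · rw [mem_preimage, h1]; exact (hΘP x hx.2).1
    · rw [Function.comp_apply, h1]; exact (hΘP x hx.2).2
  -- the two area densities
  have hgramΘ : ∀ z ∈ W, gram g Θ z =
      (jacobian τ z).transpose * chartGram g p (τ z) * jacobian τ z := fun z hz =>
    gram_comp g ((hφs _ (hVT (hτV z hz).1)).mdifferentiableAt (by norm_num))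
      ((hτ z hz).differentiableAt (by norm_num))
  have hgramc : ∀ i j, ContinuousOn (fun z => gram g Θ z i j) W := by
    intro i j
    have hJ : ∀ a i, ContinuousOn (fun z => jacobian τ z a i) W := fun a i z hz => by
      have h1 := ((hτ z hz).fderiv_right (m := 0) (by norm_num)).continuousAt
      have h2 : ContinuousAt (fun z => fderiv ℝ τ z (stdVec i)) z := h1.clm_apply continuousAt_const
      exact ((contDiff_coord (l := 0) a).continuous.continuousAt.comp h2).continuousWithinAt
    have hC : ∀ a b, ContinuousOn (fun z => chartGram g p (τ z) a b) W := fun a b z hz =>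
      (ContinuousAt.comp (f := τ) (chartGram_contDiffAt g (hVT (hτV z hz).1) a b).continuousAt
        (hτ z hz).continuousAt).continuousWithinAt
    have : ContinuousOn (fun z => ∑ b, (∑ a, jacobian τ z a i * chartGram g p (τ z) a b) *
        jacobian τ z b j) W := continuousOn_finsetSum _ fun b _ =>
      (continuousOn_finsetSum _ fun a _ => (hJ a i).mul (hC a b)).mul (hJ b j)
    refine this.congr fun z hz => ?_
    simp only [hgramΘ z hz, Matrix.mul_apply, Matrix.transpose_apply]
  have hdetc : ∀ {k : ℕ} (A : EuclideanSpace ℝ (Fin (m + 1)) → Matrix (Fin k) (Fin k) ℝ),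
      (∀ i j, ContinuousOn (fun z => A z i j) W) → ContinuousOn (fun z => √(A z).det) W := by
    intro k A hA
    refine ContinuousOn.sqrt ?_
    simp only [Matrix.det_apply]
    exact continuousOn_finsetSum _ fun σ _ =>
      (continuousOn_finsetProd _ fun i _ => hA _ _).const_smul _
  have hgs : ∀ t, ∀ y ∈ sliceMap t ⁻¹' W, gram g (Θ ∘ sliceMap t) y =
      (gram g Θ (sliceMap t y)).submatrix Fin.succ Fin.succ := fun t y hy => by
    rw [gram_comp g ((hΘd _ hy).mdifferentiableAt (by norm_num))
      ((contDiff_sliceMap (l := 1) t).differentiable (by norm_num) y), jacobian_sliceMap_conj]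
  set δ : EuclideanSpace ℝ (Fin (m + 1)) → ℝ :=
    fun z => √((gram g Θ z).submatrix Fin.succ Fin.succ).det with hδ
  have hδc : ContinuousOn δ W := hdetc _ fun i j => hgramc _ _
  -- `|∇r|²` is the entry `0 0` of the inverse metric, so this is Cramer's rule
  have hdens : ∀ z ∈ W, √(gram g Θ z).det * gradNorm g univ r (Θ z) = δ z := by
    intro z hz
    have hdet : 0 < (gram g Θ z).det := (gram_posDef g (hpatch.immersion z hz)).det_pos
    have h1 : gradInner g univ r r (Θ z) = (gram g Θ z)⁻¹ 0 0 := by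
      have hτT := hVT (hτV z hz).1
      have hrd : MDifferentiableAt (𝓡 (m + 1)) 𝓘(ℝ, ℝ) r (Θ z) :=
        hr.contMDiffAt.mdifferentiableAt (by norm_num)
      have h2 := gradInner_eq_coInner g (p := p) (q := Θ z) (hΘU hz).1 hrd hrd
      have h3 : extChartAt (𝓡 (m + 1)) p (Θ z) = τ z := φ.right_inv hτT
      have hFd : DifferentiableAt ℝ (r ∘ φ.symm) (τ z) := by
        rw [← h3]; exact differentiableAt_comp_chart_symm (hΘU hz).1 hrd
      have h4 := coordGradInner_gram_comp g (ψ := φ.symm) (τ := τ) (y := z)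
        ((hφs _ hτT).mdifferentiableAt (by norm_num)) ((hτ z hz).differentiableAt (by norm_num))
        hdet.ne' hFd hFd
      have h5 : (fun i => pd univ ((r ∘ φ.symm) ∘ τ) i z) = Pi.single 0 1 := by
        ext i
        have : (r ∘ φ.symm) ∘ τ =ᶠ[𝓝 z] fun z => z 0 := by
          filter_upwards [hWo.mem_nhds hz] with w hw using hrΘ w hw
        rw [pd_univ, this.fderiv_eq, fderiv_coord]
        simp [stdVec, Pi.single_apply, eq_comm]
      rw [h5] at h4
      rw [h2, h3]
      refine h4.symm.trans ?_
      rw [coInner_eq]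
      simp [hΘ]
    rw [gradNorm, h1, hδ, ← Real.sqrt_mul hdet.le, mul_comm, inv_zero_zero_mul_det hdet]
  refine ⟨U, hUo, ⟨hps, hpV⟩, fun f hf => ?_⟩
  -- the density of the product integral
  set H : EuclideanSpace ℝ (Fin (m + 1)) → ℝ≥0∞ :=
    W.indicator fun z => ENNReal.ofReal (δ z) * f (Θ z) with hH
  have hHm : AEMeasurable H volume := by
    refine (aemeasurable_indicator_iff hWo.measurableSet).2 ?_
    exact (hδc.aemeasurable hWo.measurableSet).ennreal_ofReal.mul
      (hf.comp_aemeasurable (hpatch.contMDiffOn.continuousOn.aemeasurable hWo.measurableSet))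
  have hHm' : AEMeasurable (fun x : ℝ × EuclideanSpace ℝ (Fin m) => H (sliceMap x.1 x.2))
      (volume.prod volume) :=
    hHm.comp_quasiMeasurePreserving measurePreserving_sliceMap.quasiMeasurePreserving
  have hsl : ∀ t : ℝ, ∫⁻ x in U, f x ∂(areaMeasure g m {q | r q = t}) =
      ∫⁻ y : EuclideanSpace ℝ (Fin m), H (sliceMap t y) := by
    intro t
    have hWt := (hslice t).isOpen.measurableSet
    have hc : ContinuousOn (fun y => √(gram g (Θ ∘ sliceMap t) y).det) (sliceMap t ⁻¹' W) :=
      (hδc.comp (contDiff_sliceMap (l := 1) t).continuous.continuousOn fun y hy => hy).congr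
        fun y hy => by rw [hgs t y hy]; rfl
    rw [harea t, (hslice t).lintegral_patchMeasure g hc hf, ← lintegral_indicator hWt]
    refine lintegral_congr fun y => ?_
    by_cases hy : y ∈ sliceMap t ⁻¹' W
    · rw [indicator_of_mem hy, hH, indicator_of_mem (show sliceMap t y ∈ W from hy), hgs t y hy]
      rfl
    · rw [indicator_of_notMem hy, hH, indicator_of_notMem (show sliceMap t y ∉ W from hy)]
  simp only [hsl]
  refine ⟨hHm'.lintegral_prod_right', ?_⟩
  rw [← lintegral_prod _ hHm']
  have hgm : Measurable fun x => f x * ENNReal.ofReal (gradNorm g univ r x) := by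
    refine hf.mul (Measurable.ennreal_ofReal (Continuous.measurable ?_))
    exact (continuous_iff_continuousAt.2 fun q =>
      gradInner_continuousAt g hr.contMDiffAt hr.contMDiffAt).sqrt
  rw [hvol, hpatch.lintegral_patchMeasure g (hdetc _ hgramc) hgm, ← lintegral_indicator hWo.measurableSet]
  have h6 : ∫⁻ x : ℝ × EuclideanSpace ℝ (Fin m), H (sliceMap x.1 x.2) ∂(volume.prod volume) =
      ∫⁻ z, H z := by
    have hm := measurePreserving_sliceMap (m := m)
    rw [← hm.map_eq] at hHm
    rw [← hm.map_eq]
    exact (lintegral_map' hHm hm.measurable.aemeasurable).symm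
  rw [h6]
  refine lintegral_congr fun z => ?_
  by_cases hz : z ∈ W
  · rw [indicator_of_mem hz, hH, indicator_of_mem hz, ← hdens z hz,
      ENNReal.ofReal_mul (Real.sqrt_nonneg _)]
    ring
  · rw [indicator_of_notMem hz, hH, indicator_of_notMem hz]

/-- The coarea formula for a function without critical points. -/
theorem lintegral_coarea [SecondCountableTopology X] (g : C1Metric (m + 1) X) {r : X → ℝ}
    (hr : ContMDiff (𝓡 (m + 1)) 𝓘(ℝ, ℝ) 1 r) (hr' : ∀ p, gradNorm g univ r p ≠ 0)
    {f : X → ℝ≥0∞} (hf : Measurable f) :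
    AEMeasurable (fun t : ℝ => ∫⁻ x, f x ∂(areaMeasure g m {q | r q = t})) volume ∧
    ∫⁻ x, f x * ENNReal.ofReal (gradNorm g univ r x) ∂(volMeasure g) =
      ∫⁻ t : ℝ, ∫⁻ x, f x ∂(areaMeasure g m {q | r q = t}) := by
  rcases isEmpty_or_nonempty X with hX | hX
  · have h0 : ∀ μ : Measure X, μ = 0 := fun μ => Measure.eq_zero_of_isEmpty μ
    simp only [h0 (volMeasure g), h0 (areaMeasure g m _), lintegral_zero_measure, lintegral_zero]
    exact ⟨aemeasurable_const, trivial⟩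
  choose U hUo hpU hU using fun p => exists_local_coarea g hr p (hr' p)
  obtain ⟨s, hsc, hs⟩ := TopologicalSpace.countable_cover_nhds fun p => (hUo p).mem_nhds (hpU p)
  have hsne : s.Nonempty := by
    by_contra hne
    rw [not_nonempty_iff_eq_empty] at hne
    rw [hne] at hs
    simp only [mem_empty_iff_false, iUnion_of_empty, iUnion_empty] at hs
    exact empty_ne_univ hs
  obtain ⟨c, rfl⟩ := hsc.exists_eq_range hsne
  rw [biUnion_range] at hs
  -- cut `X` into countably many measurable pieces on which the local formula applies
  set A : ℕ → Set X := disjointed fun i => U (c i) with hA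
  have hAm : ∀ i, MeasurableSet (A i) := fun i =>
    MeasurableSet.disjointed (fun j => (hUo (c j)).measurableSet) i
  have hAU : ∀ i, A i ⊆ U (c i) := fun i => disjointed_subset _ i
  have hAun : ⋃ i, A i = univ := by rw [hA, iUnion_disjointed, hs]
  have hAd : Pairwise (Function.onFun Disjoint A) := disjoint_disjointed _
  have hsplit : ∀ (μ : Measure X) (F : X → ℝ≥0∞), ∫⁻ x, F x ∂μ = ∑' i, ∫⁻ x in A i, F x ∂μ := by
    intro μ F
    rw [← lintegral_iUnion hAm hAd, hAun, Measure.restrict_univ]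
  have hloc : ∀ (i : ℕ) (μ : Measure X) (F : X → ℝ≥0∞),
      ∫⁻ x in U (c i), (A i).indicator F x ∂μ = ∫⁻ x in A i, F x ∂μ := by
    intro i μ F
    rw [lintegral_indicator (hAm i), Measure.restrict_restrict (hAm i),
      inter_eq_self_of_subset_left (hAU i)]
  have hmeas : ∀ i, AEMeasurable (fun t : ℝ => ∫⁻ x in A i, f x ∂(areaMeasure g m {q | r q = t}))
      volume := fun i => by
    have := (hU (c i) _ (hf.indicator (hAm i))).1
    simpa only [hloc] using this
  have heq : ∀ i, ∫⁻ x in A i, f x * ENNReal.ofReal (gradNorm g univ r x) ∂(volMeasure g) =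
      ∫⁻ t : ℝ, ∫⁻ x in A i, f x ∂(areaMeasure g m {q | r q = t}) := fun i => by
    have := (hU (c i) _ (hf.indicator (hAm i))).2
    simp only [hloc] at this
    rw [← this, ← hloc]
    refine lintegral_congr fun x => ?_
    by_cases hx : x ∈ A i
    · simp only [indicator_of_mem hx]
    · simp only [indicator_of_notMem hx, zero_mul]
  refine ⟨?_, ?_⟩
  · have : (fun t : ℝ => ∫⁻ x, f x ∂(areaMeasure g m {q | r q = t})) =
        fun t => ∑' i, ∫⁻ x in A i, f x ∂(areaMeasure g m {q | r q = t}) := by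
      ext t; exact hsplit _ _
    rw [this]
    exact AEMeasurable.tsum hmeas
  · rw [hsplit (volMeasure g)]
    simp only [heq]
    rw [← lintegral_tsum hmeas]
    exact lintegral_congr fun t => (hsplit _ _).symm

end Coarea

/-! ### A Riccati type differential inequality -/

/-- The algebraic inequality making `z = -E - lam w² - K w³`, `w = s^{-1/2}`, `E' = -E / 64`, a strict
subsolution of the Riccati inequality for small `w`. -/
theorem barrier_bracket_nonpos {E w lam N C K A : ℝ} (hE0 : 0 ≤ E) (hE : E ≤ 7 / 32) (hw0 : 0 < w)
    (hw1 : w ≤ 1) (hC : 0 ≤ C) (hK : K = 4 * C + 4) (hA : A = |lam| + K)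
    (h1 : w * (A ^ 2 + (2 * C + |N|) * A + 2 * A) ≤ 1)
    (h2 : (2 * A + 2 * C + |N|) * w ^ 2 ≤ 1 / 64) :
    (-E - lam * w ^ 2 - K * w ^ 3) / 4 + (-E - lam * w ^ 2 - K * w ^ 3) ^ 2 +
      C * w ^ 2 * |-E - lam * w ^ 2 - K * w ^ 3| + lam * w ^ 2 / 4 + C * w ^ 3 +
      (E / 64 + lam * w ^ 4 + 3 / 2 * K * w ^ 5) +
      |-E - lam * w ^ 2 - K * w ^ 3| * (|N| * w ^ 2 / 2) +
      |-E - lam * w ^ 2 - K * w ^ 3| * (C * w ^ 4) ≤ 0 := by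
  have hL : 0 ≤ |lam| := abs_nonneg _
  have hN : 0 ≤ |N| := abs_nonneg _
  have hK0 : 0 ≤ K := by rw [hK]; positivity
  have hA0 : 0 ≤ A := by rw [hA]; positivity
  set ζ := lam * w ^ 2 + K * w ^ 3 with hζ
  have hw3 : w ^ 3 ≤ w ^ 2 := pow_le_pow_of_le_one hw0.le hw1 (by norm_num)
  have hw5 : w ^ 5 ≤ w ^ 4 := pow_le_pow_of_le_one hw0.le hw1 (by norm_num)
  have hw42 : w ^ 4 ≤ w ^ 2 := pow_le_pow_of_le_one hw0.le hw1 (by norm_num)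
  have hζa : |ζ| ≤ A * w ^ 2 := by
    have e1 : |lam * w ^ 2| = |lam| * w ^ 2 := by rw [abs_mul, abs_of_pos (by positivity : 0 < w ^ 2)]
    have e2 : |K * w ^ 3| ≤ K * w ^ 2 := by
      rw [abs_of_nonneg (by positivity)]; exact mul_le_mul_of_nonneg_left hw3 hK0
    calc |ζ| ≤ |lam * w ^ 2| + |K * w ^ 3| := abs_add_le _ _
      _ ≤ |lam| * w ^ 2 + K * w ^ 2 := by rw [e1]; linarith
      _ = A * w ^ 2 := by rw [hA]; ring
  have hz : -E - lam * w ^ 2 - K * w ^ 3 = -(E + ζ) := by rw [hζ]; ring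
  rw [hz, abs_neg]
  have hza : |E + ζ| ≤ E + A * w ^ 2 :=
    (abs_add_le _ _).trans (by rw [abs_of_nonneg hE0]; linarith)
  have hsq : (-(E + ζ)) ^ 2 ≤ E ^ 2 + 2 * E * (A * w ^ 2) + A ^ 2 * w ^ 4 := by
    have : (-(E + ζ)) ^ 2 = |E + ζ| ^ 2 := by rw [sq_abs]; ring
    rw [this]
    calc |E + ζ| ^ 2 ≤ (E + A * w ^ 2) ^ 2 := pow_le_pow_left₀ (abs_nonneg _) hza 2
      _ = _ := by ring
  have t1 : C * w ^ 2 * |E + ζ| ≤ C * w ^ 2 * (E + A * w ^ 2) :=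
    mul_le_mul_of_nonneg_left hza (by positivity)
  have t2 : |E + ζ| * (|N| * w ^ 2 / 2) ≤ |N| * w ^ 2 * (E + A * w ^ 2) := by
    have : 0 ≤ |N| * w ^ 2 * |E + ζ| := by positivity
    calc |E + ζ| * (|N| * w ^ 2 / 2) ≤ |N| * w ^ 2 * |E + ζ| := by linarith
      _ ≤ _ := mul_le_mul_of_nonneg_left hza (by positivity)
  have t3 : |E + ζ| * (C * w ^ 4) ≤ C * w ^ 2 * (E + A * w ^ 2) :=
    calc |E + ζ| * (C * w ^ 4) ≤ |E + ζ| * (C * w ^ 2) :=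
          mul_le_mul_of_nonneg_left (mul_le_mul_of_nonneg_left hw42 hC) (abs_nonneg _)
      _ = C * w ^ 2 * |E + ζ| := by ring
      _ ≤ _ := t1
  have t4 : lam * w ^ 4 + 3 / 2 * K * w ^ 5 ≤ 2 * A * w ^ 4 := by
    have e1 : lam * w ^ 4 ≤ |lam| * w ^ 4 := mul_le_mul_of_nonneg_right (le_abs_self _) (by positivity)
    have e2 : K * w ^ 5 ≤ K * w ^ 4 := mul_le_mul_of_nonneg_left hw5 hK0
    have e3 : 0 ≤ K * w ^ 4 := by positivity
    have e4 : 0 ≤ |lam| * w ^ 4 := by positivity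
    have : 2 * A * w ^ 4 = 2 * (|lam| * w ^ 4) + 2 * (K * w ^ 4) := by rw [hA]; ring
    linarith
  have t5 : w ^ 4 * (A ^ 2 + (2 * C + |N|) * A + 2 * A) ≤ w ^ 3 := by
    have := mul_le_mul_of_nonneg_left h1 (by positivity : (0:ℝ) ≤ w ^ 3)
    linarith [this, (by ring : w ^ 3 * (w * (A ^ 2 + (2 * C + |N|) * A + 2 * A)) =
      w ^ 4 * (A ^ 2 + (2 * C + |N|) * A + 2 * A))]
  have t6 : E * (-(1 / 4) + E + 1 / 64 + (2 * A + 2 * C + |N|) * w ^ 2) ≤ 0 :=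
    mul_nonpos_of_nonneg_of_nonpos hE0 (by linarith)
  have t7 : -(E + ζ) / 4 + lam * w ^ 2 / 4 + C * w ^ 3 = -E / 4 - w ^ 3 := by rw [hζ, hK]; ring
  nlinarith [hsq, t1, t2, t3, t4, t5, t6, t7]

theorem hasDerivAt_inv_sqrt {s : ℝ} (hs : 0 < s) :
    HasDerivAt (fun t => (√t)⁻¹) (-(1 / 2) * ((√s)⁻¹) ^ 3) s := by
  have h := (Real.hasDerivAt_sqrt hs.ne').inv (Real.sqrt_pos.2 hs).ne'
  refine h.congr_deriv ?_
  have := (Real.sqrt_pos.2 hs).ne'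
  field_simp

set_option maxHeartbeats 1000000 in
/-- Exponential decay from a Riccati type differential inequality for `d / b`. The quotient either
stays below `-3/16`, or is eventually trapped above a barrier asymptotic to `-lam / s`, in which case
`b` is bounded below by a multiple of `s ^ (N / 2 - 2 lam)`. -/
theorem exp_decay_of_riccati {b d b' d' : ℝ → ℝ} {s₁ C lam N : ℝ} (hs₁ : 1 ≤ s₁) (hC : 0 ≤ C)
    (hb0 : ∀ s, s₁ ≤ s → 0 ≤ b s) (hb : ∀ s, s₁ ≤ s → HasDerivAt b (b' s) s)
    (hd : ∀ s, s₁ ≤ s → HasDerivAt d (d' s) s)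
    (hb' : ∀ s, s₁ ≤ s → |b' s - 2 * d s - N / (2 * s) * b s| ≤ C / s ^ 2 * b s)
    (hd' : ∀ s, s₁ ≤ s → ∀ z : ℝ, -(d s) / 4 -
      (z ^ 2 + C / s * |z| + lam / (4 * s) + C / (s * √s)) * b s ≤ d' s - 2 * z * d s)
    (ho : b =o[atTop] fun s => s ^ (-2 * lam + N / 2)) :
    ∃ s₂, s₁ ≤ s₂ ∧ ∃ K, ∀ s, s₂ ≤ s → b s ≤ K * Real.exp (-s / 3) := by
  set K := 4 * C + 4 with hK
  set A := |lam| + K with hA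
  have hL : 0 ≤ |lam| := abs_nonneg _
  have hN : 0 ≤ |N| := abs_nonneg _
  have hK0 : 0 ≤ K := by positivity
  have hA0 : 0 ≤ A := by positivity
  set B₀ := A ^ 2 + (2 * C + |N|) * A + 2 * A + 64 * (2 * A + 2 * C + |N|) + 1 with hB₀
  have hB₀1 : 1 ≤ B₀ := by
    have : 0 ≤ A ^ 2 + (2 * C + |N|) * A + 2 * A + 64 * (2 * A + 2 * C + |N|) := by positivity
    linarith
  set s₂ := max (s₁ + 1) (B₀ ^ 2) with hs₂
  have hs₂₁ : s₁ + 1 ≤ s₂ := le_max_left _ _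
  -- the small parameter `w = s^{-1/2}`
  have hwfacts : ∀ s, s₂ ≤ s → 0 < s ∧ 0 < (√s)⁻¹ ∧ (√s)⁻¹ ≤ 1 ∧
      (√s)⁻¹ * (A ^ 2 + (2 * C + |N|) * A + 2 * A) ≤ 1 ∧
      (2 * A + 2 * C + |N|) * ((√s)⁻¹) ^ 2 ≤ 1 / 64 ∧ ((√s)⁻¹) ^ 2 = 1 / s := by
    intro s hs
    have hspos : 0 < s := by linarith
    have hsq : B₀ ≤ √s := Real.le_sqrt_of_sq_le ((le_max_right _ _).trans hs)
    have hsp : 0 < √s := lt_of_lt_of_le (by linarith) hsq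
    have hw0 : 0 < (√s)⁻¹ := inv_pos.2 hsp
    have hwB : (√s)⁻¹ * B₀ ≤ 1 := by
      rw [inv_mul_le_iff₀ hsp]; linarith
    have hw1 : (√s)⁻¹ ≤ 1 := inv_le_one_of_one_le₀ (hB₀1.trans hsq)
    refine ⟨hspos, hw0, hw1, ?_, ?_, ?_⟩
    · refine le_trans (mul_le_mul_of_nonneg_left ?_ hw0.le) hwB
      have : 0 ≤ 64 * (2 * A + 2 * C + |N|) + 1 := by positivity
      linarith
    · have h1 : ((√s)⁻¹) ^ 2 ≤ (√s)⁻¹ := pow_le_of_le_one hw0.le hw1 (by norm_num)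
      have h2 : (√s)⁻¹ * (64 * (2 * A + 2 * C + |N|)) ≤ 1 := by
        refine le_trans (mul_le_mul_of_nonneg_left ?_ hw0.le) hwB
        have : 0 ≤ A ^ 2 + (2 * C + |N|) * A + 2 * A + 1 := by positivity
        linarith
      have h3 : (2 * A + 2 * C + |N|) * ((√s)⁻¹) ^ 2 ≤ (2 * A + 2 * C + |N|) * (√s)⁻¹ :=
        mul_le_mul_of_nonneg_left h1 (by positivity)
      linarith
    · rw [inv_pow, Real.sq_sqrt hspos.le, one_div]
  have hlow : ∀ s, s₂ ≤ s → s₁ ≤ s := fun s hs => by linarith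
  -- the frequency stays below `-3/16`
  have hfreq : ∀ s, s₂ ≤ s → d s ≤ -(3 / 16) * b s := by
    intro s₀ hs₀
    rcases (hb0 s₀ (hlow s₀ hs₀)).eq_or_lt with hz | hpos
    -- a zero of `b` is a minimum, so that `b'`, and with it `d`, vanishes there
    · have hmin : IsLocalMin b s₀ := by
        filter_upwards [Ici_mem_nhds (show s₁ < s₀ by linarith)] with s hs
        rw [← hz]; exact hb0 s hs
      have h1 := hmin.hasDerivAt_eq_zero (hb s₀ (hlow s₀ hs₀))
      have h2 := hb' s₀ (hlow s₀ hs₀)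
      rw [h1, ← hz] at h2
      simp only [mul_zero, sub_zero, zero_sub, abs_neg] at h2
      have h3 : 2 * d s₀ = 0 := abs_eq_zero.1 (le_antisymm h2 (abs_nonneg _))
      rw [← hz]; linarith
    by_contra hcon
    push Not at hcon
    -- The barrier `z` starts below `-3/16`, since `E s₀ = 7/32`. Dropping the terms that vanish as
    -- `s → ∞`, it obeys `z' + z² + z / 4 ≤ 0`: this is `E (-1/4 + E + 1/64) ≤ 0`, and
    -- `7/32 + 1/64 < 1/4`.
    set E : ℝ → ℝ := fun s => 7 / 32 * Real.exp (-(s - s₀) / 64) with hE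
    set z : ℝ → ℝ := fun s => -E s - lam * ((√s)⁻¹) ^ 2 - K * ((√s)⁻¹) ^ 3 with hz
    have hE0 : ∀ s, 0 ≤ E s := fun s => by positivity
    have hE1 : ∀ s, s₀ ≤ s → E s ≤ 7 / 32 := fun s hs => by
      have : Real.exp (-(s - s₀) / 64) ≤ 1 := Real.exp_le_one_iff.2 (by linarith)
      simp only [hE]; linarith
    have hEd : ∀ s, HasDerivAt E (-(E s) / 64) s := fun s => by
      have h := ((((hasDerivAt_id s).sub_const s₀).neg.div_const 64).exp).const_mul (7 / 32)
      refine h.congr_deriv ?_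
      simp only [hE, id, Pi.neg_apply]; ring
    have hzd : ∀ s, s₀ ≤ s → HasDerivAt z
        (E s / 64 + lam * ((√s)⁻¹) ^ 4 + 3 / 2 * K * ((√s)⁻¹) ^ 5) s := fun s hs => by
      have hw := hasDerivAt_inv_sqrt (hwfacts s (hs₀.trans hs)).1
      have h := ((hEd s).neg.sub ((hw.pow 2).const_mul lam)).sub ((hw.pow 3).const_mul K)
      refine h.congr_deriv ?_
      push_cast; ring
    -- `e^{s/4} (d - z b)` is nondecreasing: use the inequality for `d'` with the value of `z` at `s`
    have hdz : ∀ s, s₀ ≤ s → 0 ≤ d s - z s * b s := by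
      set Y : ℝ → ℝ := fun s => Real.exp (s / 4) * (d s - z s * b s) with hY
      have hYd : ∀ s, s₀ ≤ s → HasDerivAt Y (Real.exp (s / 4) * (1 / 4) * (d s - z s * b s) +
          Real.exp (s / 4) * (d' s - ((E s / 64 + lam * ((√s)⁻¹) ^ 4 +
            3 / 2 * K * ((√s)⁻¹) ^ 5) * b s + z s * b' s))) s := fun s hs =>
        ((hasDerivAt_id s).div_const 4).exp.mul ((hd s (hlow s (hs₀.trans hs))).sub
          ((hzd s hs).mul (hb s (hlow s (hs₀.trans hs)))))
      have hmono : MonotoneOn Y (Ici s₀) := by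
        refine monotoneOn_of_deriv_nonneg (convex_Ici s₀)
          (fun s hs => (hYd s hs).continuousAt.continuousWithinAt)
          (fun s hs => ((hYd s (interior_subset hs)).differentiableAt).differentiableWithinAt) ?_
        intro s hs
        have hs' : s₀ ≤ s := interior_subset hs
        have hs1 := hlow s (hs₀.trans hs')
        rw [(hYd s hs').deriv]
        obtain ⟨hsp, hw0, hw1, hw2, hw3, hw4⟩ := hwfacts s (hs₀.trans hs')
        have hbr := barrier_bracket_nonpos (N := N) (hE0 s) (hE1 s hs') hw0 hw1 hC hK hA hw2 hw3
        set w := (√s)⁻¹ with hw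
        have hzs : -E s - lam * w ^ 2 - K * w ^ 3 = z s := rfl
        rw [hzs] at hbr
        have e1 : C / s = C * w ^ 2 := by rw [hw4]; ring
        have e2 : C / s ^ 2 = C * w ^ 4 := by
          rw [show w ^ 4 = (w ^ 2) ^ 2 by ring, hw4]; field_simp
        have e3 : lam / (4 * s) = lam * w ^ 2 / 4 := by rw [hw4]; field_simp
        have e4 : C / (s * √s) = C * w ^ 3 := by
          rw [show w ^ 3 = w ^ 2 * w by ring, hw4, hw]; field_simp
        have e5 : N / (2 * s) = N * w ^ 2 / 2 := by rw [hw4]; field_simp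
        have hb1 := hb' s hs1
        have hd1 := hd' s hs1 (z s)
        rw [e2, e5] at hb1
        rw [e1, e3, e4] at hd1
        have hbs := hb0 s hs1
        set err := b' s - 2 * d s - N * w ^ 2 / 2 * b s with herr
        have hbe : b' s = 2 * d s + N * w ^ 2 / 2 * b s + err := by rw [herr]; ring
        have h1 : z s * err ≤ |z s| * (C * w ^ 4) * b s := by
          calc z s * err ≤ |z s * err| := le_abs_self _
            _ = |z s| * |err| := abs_mul _ _
            _ ≤ |z s| * (C * w ^ 4 * b s) := mul_le_mul_of_nonneg_left hb1 (abs_nonneg _)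
            _ = _ := by ring
        have h2 : z s * (N * w ^ 2 / 2 * b s) ≤ |z s| * (|N| * w ^ 2 / 2) * b s := by
          calc z s * (N * w ^ 2 / 2 * b s) ≤ |z s * (N * w ^ 2 / 2 * b s)| := le_abs_self _
            _ = |z s| * (|N| * w ^ 2 / 2) * b s := by
              rw [abs_mul, abs_mul, abs_div, abs_mul, abs_of_nonneg hbs,
                abs_of_pos (by positivity : 0 < w ^ 2)]
              norm_num; ring
        have h3 : 0 ≤ (1 / 4) * (d s - z s * b s) + (d' s - ((E s / 64 + lam * w ^ 4 +
            3 / 2 * K * w ^ 5) * b s + z s * b' s)) := by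
          have h4 := mul_nonneg (neg_nonneg.2 hbr) hbs
          rw [hbe]
          clear_value w E z K A B₀ s₂ err
          linear_combination h1 + h2 + hd1 + h4
        have h5 := mul_nonneg (Real.exp_pos (s / 4)).le h3
        calc (0:ℝ) ≤ _ := h5
          _ = _ := by ring
      have hY0 : 0 ≤ Y s₀ := by
        refine mul_nonneg (Real.exp_pos _).le ?_
        obtain ⟨hsp, hw0, hw1, hw2, hw3, hw4⟩ := hwfacts s₀ hs₀
        set w := (√s₀)⁻¹ with hw
        have hEs : E s₀ = 7 / 32 := by simp [hE]
        have h1 : z s₀ = -(7 / 32) - lam * w ^ 2 - K * w ^ 3 := by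
          simp only [hz, hEs, hw]
        have h2 : -(lam * w ^ 2) ≤ |lam| * w ^ 2 := by
          rw [← neg_mul]; exact mul_le_mul_of_nonneg_right (neg_le_abs _) (by positivity)
        have h3 : 0 ≤ K * w ^ 3 := by positivity
        have h4 : |lam| * w ^ 2 ≤ 1 / 64 := by
          refine le_trans (mul_le_mul_of_nonneg_right ?_ (by positivity)) hw3
          rw [hA]; linarith
        have h5 : z s₀ ≤ -(3 / 16) := by rw [h1]; linarith
        have h6 := mul_le_mul_of_nonneg_right h5 hpos.le
        linarith
      intro s hs
      have h1 := hY0.trans (hmono self_mem_Ici hs hs)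
      exact nonneg_of_mul_nonneg_right h1 (Real.exp_pos _)
    -- The resulting lower bound for `b`: `Wf` is an antiderivative of the lower bound
    -- `2 z + N / 2s - C / s²` for `b' / b`, and is at least `(N / 2 - 2 lam) log s`.
    set Wf : ℝ → ℝ := fun s => (N / 2 - 2 * lam) * Real.log s + 4 * K * (√s)⁻¹ + 128 * E s + C / s
      with hWf
    have hWd : ∀ s, s₀ ≤ s → HasDerivAt Wf
        ((N / 2 - 2 * lam) * s⁻¹ + 4 * K * (-(1 / 2) * ((√s)⁻¹) ^ 3) + 128 * (-(E s) / 64) +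
          C * (-(s ^ 2)⁻¹)) s := fun s hs => by
      have hsp := (hwfacts s (hs₀.trans hs)).1
      exact (((((Real.hasDerivAt_log hsp.ne').const_mul _)).add
        ((hasDerivAt_inv_sqrt hsp).const_mul (4 * K))).add ((hEd s).const_mul 128)).add
        ((hasDerivAt_inv hsp.ne').const_mul C)
    have hmono : MonotoneOn (fun s => Real.exp (-Wf s) * b s) (Ici s₀) := by
      have hder : ∀ s, s₀ ≤ s → HasDerivAt (fun s => Real.exp (-Wf s) * b s)
          (Real.exp (-Wf s) * -((N / 2 - 2 * lam) * s⁻¹ + 4 * K * (-(1 / 2) * ((√s)⁻¹) ^ 3) +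
            128 * (-(E s) / 64) + C * (-(s ^ 2)⁻¹)) * b s + Real.exp (-Wf s) * b' s) s :=
        fun s hs => (hWd s hs).neg.exp.mul (hb s (hlow s (hs₀.trans hs)))
      refine monotoneOn_of_deriv_nonneg (convex_Ici s₀)
        (fun s hs => (hder s hs).continuousAt.continuousWithinAt)
        (fun s hs => ((hder s (interior_subset hs)).differentiableAt).differentiableWithinAt) ?_
      intro s hs
      have hs' : s₀ ≤ s := interior_subset hs
      have hs1 := hlow s (hs₀.trans hs')
      rw [(hder s hs').deriv]
      obtain ⟨hsp, hw0, hw1, hw2, hw3, hw4⟩ := hwfacts s (hs₀.trans hs')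
      have h1 := (abs_le.1 (hb' s hs1)).1
      have h2 := hdz s hs'
      have h3 : z s = -E s - lam * (1 / s) - K * ((√s)⁻¹) ^ 3 := by rw [← hw4]
      rw [h3] at h2
      have h4 : 0 ≤ b' s - ((N / 2 - 2 * lam) * s⁻¹ + 4 * K * (-(1 / 2) * ((√s)⁻¹) ^ 3) +
            128 * (-(E s) / 64) + C * (-(s ^ 2)⁻¹)) * b s := by
        have e1 : N / (2 * s) = N / 2 * s⁻¹ := by field_simp
        have e2 : C / s ^ 2 = C * (s ^ 2)⁻¹ := by rw [div_eq_mul_inv]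
        rw [e1, e2] at h1
        rw [one_div] at h2
        clear_value E z K A B₀ s₂ Wf
        linear_combination h1 + 2 * h2
      have h5 := mul_nonneg (Real.exp_pos (-Wf s)).le h4
      calc (0:ℝ) ≤ _ := h5
        _ = _ := by ring
    set c := Real.exp (-Wf s₀) * b s₀ with hc
    have hcpos : 0 < c := mul_pos (Real.exp_pos _) hpos
    have hlower : ∀ s, s₀ ≤ s → c * s ^ (-2 * lam + N / 2) ≤ b s := by
      intro s hs
      have h1 : c ≤ Real.exp (-Wf s) * b s := hmono self_mem_Ici hs hs
      have hsp := (hwfacts s (hs₀.trans hs)).1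
      have h2 : c * Real.exp (Wf s) ≤ b s := by
        calc c * Real.exp (Wf s) ≤ (Real.exp (-Wf s) * b s) * Real.exp (Wf s) :=
              mul_le_mul_of_nonneg_right h1 (Real.exp_pos _).le
          _ = b s := by
              rw [mul_right_comm, ← Real.exp_add]; simp
      refine le_trans (mul_le_mul_of_nonneg_left ?_ hcpos.le) h2
      rw [Real.rpow_def_of_pos hsp]
      refine Real.exp_le_exp.2 ?_
      have h3 : 0 ≤ 4 * K * (√s)⁻¹ := by positivity
      have h4 : 0 ≤ C / s := by positivity
      have h5 := hE0 s
      simp only [hWf]; linarith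
    have hev := (ho.bound (c := c / 2) (by positivity)).and (eventually_ge_atTop s₀)
    obtain ⟨s, hs, hs'⟩ := hev.exists
    have hsp := (hwfacts s (hs₀.trans hs')).1
    have h1 := hlower s hs'
    have h2 : 0 < s ^ (-2 * lam + N / 2) := Real.rpow_pos_of_pos hsp _
    rw [Real.norm_of_nonneg (hb0 s (hlow s (hs₀.trans hs'))), Real.norm_of_nonneg h2.le] at hs
    nlinarith [mul_pos hcpos h2]
  -- integrate `b' ≤ (-3/8 + 1/24) b = -b / 3`
  have hanti : AntitoneOn (fun s => Real.exp (s / 3) * b s) (Ici s₂) := by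
    have hder : ∀ s, s₂ ≤ s → HasDerivAt (fun s => Real.exp (s / 3) * b s)
        (Real.exp (s / 3) * (1 / 3) * b s + Real.exp (s / 3) * b' s) s := fun s hs =>
      ((hasDerivAt_id s).div_const 3).exp.mul (hb s (hlow s hs))
    refine antitoneOn_of_deriv_nonpos (convex_Ici s₂)
      (fun s hs => (hder s hs).continuousAt.continuousWithinAt)
      (fun s hs => ((hder s (interior_subset hs)).differentiableAt).differentiableWithinAt) ?_
    intro s hs
    have hs' : s₂ ≤ s := interior_subset hs
    rw [(hder s hs').deriv]
    obtain ⟨hsp, hw0, hw1, hw2, hw3, hw4⟩ := hwfacts s hs'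
    have hbs := hb0 s (hlow s hs')
    have h1 := (abs_le.1 (hb' s (hlow s hs'))).2
    have h2 := hfreq s hs'
    have h3 : N / (2 * s) + C / s ^ 2 ≤ 1 / 24 := by
      have e1 : N / (2 * s) ≤ |N| * ((√s)⁻¹) ^ 2 := by
        rw [hw4]
        have : 0 ≤ |N| * (1 / s) := by positivity
        calc N / (2 * s) ≤ |N| / (2 * s) := by gcongr; exact le_abs_self _
          _ = (|N| * (1 / s)) / 2 := by field_simp
          _ ≤ _ := by linarith
      have e2 : C / s ^ 2 ≤ C * ((√s)⁻¹) ^ 2 := by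
        rw [show C / s ^ 2 = C * (1 / s) ^ 2 by field_simp, ← hw4]
        refine mul_le_mul_of_nonneg_left ?_ hC
        exact pow_le_of_le_one (by positivity) (pow_le_one₀ hw0.le hw1) (by norm_num)
      have e3 : (|N| + C) * ((√s)⁻¹) ^ 2 ≤ (2 * A + 2 * C + |N|) * ((√s)⁻¹) ^ 2 :=
        mul_le_mul_of_nonneg_right (by linarith) (by positivity)
      linarith
    have h4 : (1 / 3) * b s + b' s ≤ 0 := by
      have := mul_le_mul_of_nonneg_right h3 hbs
      linarith
    have h5 := mul_nonpos_of_nonneg_of_nonpos (Real.exp_pos (s / 3)).le h4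
    calc _ = Real.exp (s / 3) * ((1 / 3) * b s + b' s) := by ring
      _ ≤ 0 := h5
  refine ⟨s₂, by linarith, Real.exp (s₂ / 3) * b s₂, fun s hs => ?_⟩
  have h1 : Real.exp (s / 3) * b s ≤ Real.exp (s₂ / 3) * b s₂ := hanti self_mem_Ici hs hs
  have h2 : b s = (Real.exp (s / 3) * b s) * Real.exp (-s / 3) := by
    rw [mul_right_comm, ← Real.exp_add, show s / 3 + -s / 3 = 0 by ring, Real.exp_zero, one_mul]
  rw [h2]
  exact mul_le_mul_of_nonneg_right h1 (Real.exp_pos _).le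

/-! ### Pointwise estimates on unit shells -/

/-- The consequences of `S = 4 x + O(1 / x)` on the shell `|x - s| ≤ 1`. -/
theorem shell_S_bounds {x s S C : ℝ} (hC : 0 ≤ C) (hs : C + 4 ≤ s) (hx : |x - s| ≤ 1)
    (hS : |S - 4 * x| ≤ C / x) : s / 2 ≤ x ∧ s ≤ S ∧ |S - 4 * x| ≤ 2 * C / s := by
  have h1 := abs_le.1 hx
  have hx2 : s / 2 ≤ x := by linarith
  have hxp : 0 < x := by linarith
  have hsp : 0 < s := by linarith
  have h2 : C / x ≤ 2 * C / s := by
    rw [div_le_div_iff₀ hxp hsp]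
    linarith [mul_le_mul_of_nonneg_left hx2 hC]
  have h3 : 2 * C / s ≤ 2 := by
    rw [div_le_iff₀ hsp]; linarith
  have h4 := abs_le.1 (hS.trans h2)
  exact ⟨hx2, by linarith, hS.trans h2⟩

/-- On a shell, `u² h` equals `N / 2s` times `S u²` up to a relative error `O(s⁻²)`, provided that
`h = 2 N + O(1 / x)`. -/
theorem shell_laplacian_bound {x s u S h C N : ℝ} (hC : 0 ≤ C) (hs : C + 4 ≤ s) (hx : |x - s| ≤ 1)
    (hS : |S - 4 * x| ≤ C / x) (hh : |h - 2 * N| ≤ C / x) :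
    |u ^ 2 * h - N / (2 * s) * (S * u ^ 2)| ≤ (2 * |N| + 2 * C + |N| * C) / s ^ 2 * (S * u ^ 2) := by
  obtain ⟨hx2, hsS, hS'⟩ := shell_S_bounds hC hs hx hS
  have hsp : 0 < s := by linarith
  have hxp : 0 < x := by linarith
  have hh' : |h - 2 * N| ≤ 2 * C / s := by
    refine hh.trans ?_
    rw [div_le_div_iff₀ hxp hsp]
    linarith [mul_le_mul_of_nonneg_left hx2 hC]
  set C' := 2 * |N| + 2 * C + |N| * C with hC'
  have hC'0 : 0 ≤ C' := by positivity
  have key : |h - N / (2 * s) * S| ≤ C' / s := by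
    have e : h - N / (2 * s) * S = (h - 2 * N) - 2 * N / s * (x - s) - N / (2 * s) * (S - 4 * x) := by
      field_simp; ring
    have t1 : |2 * N / s * (x - s)| ≤ 2 * |N| / s := by
      rw [abs_mul, abs_div, abs_mul, abs_of_pos hsp, abs_two]
      exact mul_le_of_le_one_right (by positivity) hx
    have t2 : |N / (2 * s) * (S - 4 * x)| ≤ |N| * C / s := by
      rw [abs_mul, abs_div, abs_of_pos (by positivity : 0 < 2 * s)]
      calc |N| / (2 * s) * |S - 4 * x| ≤ |N| / (2 * s) * (2 * C) := by
            gcongr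
            exact hS'.trans (div_le_self (by positivity) (by linarith))
        _ = |N| * C / s := by field_simp
    rw [e]
    calc _ ≤ |h - 2 * N| + |2 * N / s * (x - s)| + |N / (2 * s) * (S - 4 * x)| :=
          (abs_sub _ _).trans (by gcongr; exact abs_sub _ _)
      _ ≤ 2 * C / s + 2 * |N| / s + |N| * C / s := by linarith
      _ = C' / s := by rw [hC']; ring
  have e : u ^ 2 * h - N / (2 * s) * (S * u ^ 2) = u ^ 2 * (h - N / (2 * s) * S) := by ring
  rw [e, abs_mul, abs_of_nonneg (sq_nonneg u)]
  calc u ^ 2 * |h - N / (2 * s) * S| ≤ u ^ 2 * (C' / s) := by gcongr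
    _ = C' / s ^ 2 * (s * u ^ 2) := by field_simp
    _ ≤ _ := by gcongr

/-- Completing the square in the equation `f = -Q / 4 - lam u + O(x^{-1/2} (|u| + √P))`. -/
theorem shell_riccati_bound {x s u S Q P f C lam : ℝ} (hC : 0 ≤ C) (hs : C + 4 ≤ s)
    (hx : |x - s| ≤ 1) (hS : |S - 4 * x| ≤ C / x) (hP : 0 ≤ P) (hQ : Q ^ 2 ≤ S * P)
    (hf : |f + Q / 4 + lam * u| ≤ C / √x * (|u| + √P)) (z : ℝ) :
    0 ≤ P + u * f - 2 * z * (u * Q) + u * Q / 4 +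
      (z ^ 2 + (2 * C + C ^ 2 + |lam| * (1 + C)) / s * |z| + lam / (4 * s) +
        (2 * C + C ^ 2 + |lam| * (1 + C)) / (s * √s)) * (S * u ^ 2) := by
  obtain ⟨hx2, hsS, hS'⟩ := shell_S_bounds hC hs hx hS
  have hsp : 0 < s := by linarith
  have hxp : 0 < x := by linarith
  have hSp : 0 < S := by linarith
  set C' := 2 * C + C ^ 2 + |lam| * (1 + C) with hC'
  have hC'0 : 0 ≤ C' := by positivity
  set a := √P
  set v := |u|
  set σ := √S
  set τ := √s
  have ha : 0 ≤ a := Real.sqrt_nonneg _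
  have hv : 0 ≤ v := abs_nonneg _
  have haP : a ^ 2 = P := Real.sq_sqrt hP
  have hvu : v ^ 2 = u ^ 2 := sq_abs u
  have hσS : σ ^ 2 = S := Real.sq_sqrt hSp.le
  have hτs : τ ^ 2 = s := Real.sq_sqrt hsp.le
  have hτ : 0 < τ := Real.sqrt_pos.2 hsp
  have hτ1 : 1 ≤ τ := Real.one_le_sqrt.2 (by linarith)
  have hσ : τ ≤ σ := Real.sqrt_le_sqrt hsS
  have hσ0 : 0 < σ := hτ.trans_le hσ
  have hk : C / √x ≤ 2 * C / τ := by
    have h1 : τ / 2 ≤ √x := by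
      apply Real.le_sqrt_of_sq_le
      calc (τ / 2) ^ 2 = s / 4 := by rw [div_pow, hτs]; norm_num
        _ ≤ x := by linarith
    rw [div_le_div_iff₀ (Real.sqrt_pos.2 hxp) hτ]
    linarith [mul_le_mul_of_nonneg_left h1 hC]
  have hQa : |Q| ≤ σ * a := by
    refine abs_le_of_sq_le_sq ?_ (by positivity)
    rw [mul_pow, hσS, haP]; exact hQ
  set k := 2 * C / τ with hkdef
  have hk0 : 0 ≤ k := by positivity
  set e := f + Q / 4 + lam * u with he
  have hue : -(v * (k * (v + a))) ≤ u * e := by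
    have h1 : |u * e| ≤ v * (k * (v + a)) := by
      rw [abs_mul]
      exact mul_le_mul_of_nonneg_left (hf.trans (by gcongr)) hv
    exact (abs_le.1 h1).1
  have hzQ : -(2 * |z| * v * (σ * a)) ≤ -2 * z * (u * Q) := by
    have h1 : |-2 * z * (u * Q)| ≤ 2 * |z| * v * (σ * a) := by
      rw [abs_mul, abs_mul, abs_mul, abs_neg, abs_two]
      calc 2 * |z| * (v * |Q|) ≤ 2 * |z| * (v * (σ * a)) := by gcongr
        _ = _ := by ring
    exact (abs_le.1 h1).1
  set T := a - |z| * v * σ with hT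
  -- Young's inequality for the cross term of the error
  have hya : v * a * k ≤ T ^ 2 + k ^ 2 * v ^ 2 / 4 + k * |z| * v ^ 2 * σ := by
    have h0 : v * a * k = k * v * T + k * |z| * v ^ 2 * σ := by rw [hT]; ring
    have h1 : 0 ≤ (T - k * v / 2) ^ 2 := sq_nonneg _
    rw [h0]; linear_combination h1
  have hTsq : T ^ 2 = P - 2 * |z| * v * (σ * a) + z ^ 2 * (S * u ^ 2) := by
    rw [hT, ← haP, ← hσS, ← hvu, ← sq_abs z]; ring
  have hu2 : v ^ 2 ≤ S * v ^ 2 / s := by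
    rw [le_div_iff₀ hsp, mul_comm]; gcongr
  have hk1 : k * v ^ 2 ≤ 2 * C / (s * τ) * (S * v ^ 2) := by
    calc k * v ^ 2 ≤ k * (S * v ^ 2 / s) := by gcongr
      _ = _ := by rw [hkdef]; field_simp
  have hk2 : k ^ 2 * v ^ 2 / 4 ≤ C ^ 2 / (s * τ) * (S * v ^ 2) := by
    calc k ^ 2 * v ^ 2 / 4 = C ^ 2 / τ ^ 2 * v ^ 2 := by rw [hkdef]; field_simp; ring
      _ ≤ C ^ 2 / τ * v ^ 2 := by
          gcongr
          exact le_self_pow₀ hτ1 (by norm_num)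
      _ ≤ C ^ 2 / τ * (S * v ^ 2 / s) := by gcongr
      _ = _ := by field_simp
  have hk3 : k * |z| * v ^ 2 * σ ≤ 2 * C / s * |z| * (S * v ^ 2) := by
    calc k * |z| * v ^ 2 * σ = 2 * C / τ ^ 2 * |z| * v ^ 2 * (τ * σ) := by
          rw [hkdef]; field_simp
      _ ≤ 2 * C / τ ^ 2 * |z| * v ^ 2 * (σ * σ) := by gcongr
      _ = _ := by rw [hτs, ← hσS]; ring
  have hl : |lam * v ^ 2 - lam / (4 * s) * (S * v ^ 2)| ≤ |lam| * (1 + C) / (s * τ) * (S * v ^ 2) := by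
    have e1 : lam * v ^ 2 - lam / (4 * s) * (S * v ^ 2) =
        lam * v ^ 2 * (-(x - s) / s - (S - 4 * x) / (4 * s)) := by field_simp; ring
    have e2 : |-(x - s) / s - (S - 4 * x) / (4 * s)| ≤ (1 + C) / s := by
      refine (abs_sub _ _).trans ?_
      rw [abs_div, abs_div, abs_neg, abs_of_pos hsp, abs_of_pos (by positivity : 0 < 4 * s)]
      have h1 : |S - 4 * x| ≤ 2 * C := hS'.trans (div_le_self (by positivity) (by linarith))
      calc |x - s| / s + |S - 4 * x| / (4 * s) ≤ 1 / s + 2 * C / (4 * s) := by gcongr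
        _ ≤ 1 / s + 4 * C / (4 * s) := by gcongr; linarith
        _ = _ := by field_simp
    rw [e1, abs_mul, abs_mul, abs_of_nonneg (sq_nonneg v)]
    calc |lam| * v ^ 2 * |-(x - s) / s - (S - 4 * x) / (4 * s)|
        ≤ |lam| * (S * v ^ 2 / s) * ((1 + C) / s) := by gcongr
      _ = |lam| * (1 + C) / (s * τ ^ 2) * (S * v ^ 2) := by rw [hτs]; field_simp
      _ ≤ |lam| * (1 + C) / (s * τ) * (S * v ^ 2) := by
          gcongr
          exact le_self_pow₀ hτ1 (by norm_num)
  have hl' := (abs_le.1 hl).2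
  have hadd : C' / (s * τ) * (S * v ^ 2) = 2 * C / (s * τ) * (S * v ^ 2) +
      C ^ 2 / (s * τ) * (S * v ^ 2) + |lam| * (1 + C) / (s * τ) * (S * v ^ 2) := by
    rw [hC']; ring
  have hC'z : 2 * C / s * |z| * (S * v ^ 2) ≤ C' / s * |z| * (S * v ^ 2) := by
    gcongr
    rw [hC']
    have : 0 ≤ C ^ 2 + |lam| * (1 + C) := by positivity
    linarith
  have hfe : u * f = u * e - u * Q / 4 - lam * v ^ 2 := by rw [he, hvu]; ring
  rw [hfe, ← hvu]
  rw [← hvu] at hTsq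
  clear_value k T e C' a v σ τ
  linear_combination hue + hzQ + hya + hTsq + hk1 + hk2 + hk3 + hl' - hadd + hC'z

/-- The pointwise form of Caccioppoli's inequality; `c` stands for a cutoff, `c'` for its
derivative. -/
theorem shell_caccioppoli_bound {x s u S Q P f C lam c c' : ℝ} (hC : 0 ≤ C) (hs : C + 4 ≤ s)
    (hx : |x - s| ≤ 1) (hS : |S - 4 * x| ≤ C / x) (hP : 0 ≤ P) (hQ : Q ^ 2 ≤ S * P)
    (hf : |f + Q / 4 + lam * u| ≤ C / √x * (|u| + √P)) :
    -(c ^ 2 * (u * f)) - 2 * c * c' * (u * Q) ≤ 1 / 2 * (c ^ 2 * P) +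
      (4 * c' ^ 2 + (1 + |lam| + C + 2 * C ^ 2) * c ^ 2) * (S * u ^ 2) := by
  obtain ⟨hx2, hsS, hS'⟩ := shell_S_bounds hC hs hx hS
  have hsp : 0 < s := by linarith
  have hxp : 0 < x := by linarith
  have hSp : 0 < S := by linarith
  set a := √P
  set v := |u|
  set σ := √S
  have ha : 0 ≤ a := Real.sqrt_nonneg _
  have hv : 0 ≤ v := abs_nonneg _
  have haP : a ^ 2 = P := Real.sq_sqrt hP
  have hvu : v ^ 2 = u ^ 2 := sq_abs u
  have hσS : σ ^ 2 = S := Real.sq_sqrt hSp.le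
  have hσ0 : 0 ≤ σ := Real.sqrt_nonneg _
  have hk : C / √x ≤ C := div_le_self hC (Real.one_le_sqrt.2 (by linarith))
  have hQa : |Q| ≤ σ * a := by
    refine abs_le_of_sq_le_sq ?_ (by positivity)
    rw [mul_pow, hσS, haP]; exact hQ
  set e := f + Q / 4 + lam * u with he
  have h1 : -(u * e) ≤ v * (C * (v + a)) := by
    have h1 : |u * e| ≤ v * (C * (v + a)) := by
      rw [abs_mul]
      exact mul_le_mul_of_nonneg_left (hf.trans (by gcongr)) hv
    linarith [(abs_le.1 h1).1]
  have hvQ : |u * Q| ≤ v * (σ * a) := by rw [abs_mul]; gcongr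
  have h2 : u * Q / 4 ≤ v * (σ * a) / 4 := by linarith [le_abs_self (u * Q)]
  have h3 : lam * v ^ 2 ≤ |lam| * v ^ 2 := by gcongr; exact le_abs_self _
  have h4 : -(2 * c * c' * (u * Q)) ≤ 2 * |c| * |c'| * (v * (σ * a)) := by
    calc -(2 * c * c' * (u * Q)) ≤ |2 * c * c' * (u * Q)| := neg_le_abs _
      _ = 2 * |c| * |c'| * |u * Q| := by rw [abs_mul, abs_mul, abs_mul, abs_two]
      _ ≤ _ := by gcongr
  have y1 : 2 * |c| * |c'| * (v * (σ * a)) ≤ 1 / 4 * (c ^ 2 * P) + 4 * c' ^ 2 * (S * v ^ 2) := by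
    rw [← haP, ← hσS, ← sq_abs c, ← sq_abs c']
    linear_combination sq_nonneg (|c| * a / 2 - 2 * |c'| * v * σ)
  have y2 : v * (C * (v + a)) ≤ C * v ^ 2 + P / 8 + 2 * C ^ 2 * v ^ 2 := by
    rw [← haP]
    linear_combination 1 / 8 * sq_nonneg (a - 4 * C * v)
  have y3 : v * (σ * a) / 4 ≤ P / 8 + S * v ^ 2 / 8 := by
    rw [← haP, ← hσS]
    linear_combination 1 / 8 * sq_nonneg (a - σ * v)
  have h5 : v ^ 2 ≤ S * v ^ 2 := le_mul_of_one_le_left (sq_nonneg _) (by linarith)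
  have h6 : -(u * f) ≤ 1 / 4 * P + (1 + |lam| + C + 2 * C ^ 2) * (S * v ^ 2) := by
    have hfe : u * f = u * e - u * Q / 4 - lam * v ^ 2 := by rw [he, hvu]; ring
    have h7 : (|lam| + C + 2 * C ^ 2) * v ^ 2 ≤ (|lam| + C + 2 * C ^ 2) * (S * v ^ 2) := by gcongr
    have h8 : 0 ≤ S * v ^ 2 := by positivity
    rw [hfe]
    linarith
  have h9 := mul_le_mul_of_nonneg_left h6 (sq_nonneg c)
  rw [← hvu]
  linarith

/-! ### A smooth cutoff on the line -/

section

/-- A smooth function on `ℝ` that is `1` on `[-1/2, 1/2]` and vanishes outside `[-1, 1]`. -/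
def cutoff : ℝ → ℝ := (⟨1 / 2, 1, by norm_num, by norm_num⟩ : ContDiffBump (0 : ℝ))

/-- The square of `cutoff`. Being a square, it satisfies `|bump'|² ≤ C bump`. -/
def bump (t : ℝ) : ℝ := cutoff t ^ 2

theorem contDiff_cutoff : ContDiff ℝ ∞ cutoff := ContDiffBump.contDiff _

theorem contDiff_bump : ContDiff ℝ ∞ bump := contDiff_cutoff.pow 2

theorem cutoff_eq_one {t : ℝ} (ht : |t| ≤ 1 / 2) : cutoff t = 1 :=
  ContDiffBump.one_of_mem_closedBall _ (by simpa [Real.dist_eq] using ht)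

theorem tsupport_cutoff : tsupport cutoff = Metric.closedBall 0 1 := ContDiffBump.tsupport_eq _

theorem hasCompactSupport_cutoff : HasCompactSupport cutoff := by
  rw [HasCompactSupport, tsupport_cutoff]; exact isCompact_closedBall _ _

theorem support_cutoff_subset : Function.support cutoff ⊆ Icc (-1) 1 := fun t ht => by
  have := subset_tsupport _ ht
  rw [tsupport_cutoff] at this
  simpa [Real.dist_eq, abs_le] using this

theorem support_deriv_cutoff_subset : Function.support (deriv cutoff) ⊆ Icc (-1) 1 := fun t ht => by
  have := support_deriv_subset ht
  rw [tsupport_cutoff] at this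
  simpa [Real.dist_eq, abs_le] using this

theorem support_bump_subset : Function.support bump ⊆ Icc (-1) 1 := fun t ht =>
  support_cutoff_subset (fun h => ht (by simp [bump, h]))

theorem bump_nonneg (t : ℝ) : 0 ≤ bump t := sq_nonneg _

theorem bump_eq_one {t : ℝ} (ht : |t| ≤ 1 / 2) : bump t = 1 := by simp [bump, cutoff_eq_one ht]

theorem deriv_bump (t : ℝ) : deriv bump t = 2 * cutoff t * deriv cutoff t := by
  have h := ((contDiff_cutoff.differentiable (by simp)) t).hasDerivAt.pow 2
  rw [show bump = cutoff ^ 2 from rfl, h.deriv]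
  simp

/-- The shells of radius `1` around `s` are covered by the regions where the bumps around `s - 1`, `s`
and `s + 1` equal `1`. -/
theorem one_le_bump_add {t : ℝ} (ht : t ∈ Icc (-1 : ℝ) 1) :
    1 ≤ bump (t - 1) + bump t + bump (t + 1) := by
  have h1 := bump_nonneg (t - 1)
  have h2 := bump_nonneg t
  have h3 := bump_nonneg (t + 1)
  rcases le_or_gt t (-(1 / 2)) with h | h
  · have := bump_eq_one (t := t + 1) (by rw [abs_le]; constructor <;> linarith [ht.1, ht.2])
    linarith
  rcases le_or_gt t (1 / 2) with h' | h'
  · have := bump_eq_one (t := t) (by rw [abs_le]; constructor <;> linarith)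
    linarith
  · have := bump_eq_one (t := t - 1) (by rw [abs_le]; constructor <;> linarith [ht.1, ht.2])
    linarith

/-- The terms with a differentiated cutoff in Caccioppoli's inequality are controlled by three
neighbouring bumps. -/
theorem exists_cutoff_majorant {A : ℝ} (hA : 0 ≤ A) : ∃ D, 0 ≤ D ∧ ∀ t,
    4 * deriv cutoff t ^ 2 + A * cutoff t ^ 2 ≤ D * (bump (t - 1) + bump t + bump (t + 1)) := by
  obtain ⟨D₁, hD₁⟩ := (hasCompactSupport_cutoff.deriv).exists_bound_of_continuous
    (contDiff_cutoff.continuous_deriv (by simp))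
  obtain ⟨D₂, hD₂⟩ := hasCompactSupport_cutoff.exists_bound_of_continuous contDiff_cutoff.continuous
  refine ⟨4 * D₁ ^ 2 + A * D₂ ^ 2, by positivity, fun t => ?_⟩
  by_cases ht : t ∈ Icc (-1 : ℝ) 1
  · have h1 : deriv cutoff t ^ 2 ≤ D₁ ^ 2 := sq_le_sq' (abs_le.1 (hD₁ t)).1 (abs_le.1 (hD₁ t)).2
    have h2 : cutoff t ^ 2 ≤ D₂ ^ 2 := sq_le_sq' (abs_le.1 (hD₂ t)).1 (abs_le.1 (hD₂ t)).2
    calc 4 * deriv cutoff t ^ 2 + A * cutoff t ^ 2 ≤ 4 * D₁ ^ 2 + A * D₂ ^ 2 := by gcongr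
      _ ≤ _ := le_mul_of_one_le_right (by positivity) (one_le_bump_add ht)
  · have h1 : cutoff t = 0 := by
      by_contra h; exact ht (support_cutoff_subset h)
    have h2 : deriv cutoff t = 0 := by
      by_contra h; exact ht (support_deriv_cutoff_subset h)
    rw [h1, h2]
    have := bump_nonneg (t - 1)
    have := bump_nonneg t
    have := bump_nonneg (t + 1)
    simp only [ne_eq, OfNat.ofNat_ne_zero, not_false_eq_true, zero_pow, mul_zero, add_zero]
    positivity

/-! ### Energy estimates on the shells of a proper function -/

variable {X : Type*} [TopologicalSpace X] [MeasurableSpace X]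

/-- The data entering the energy estimates on the shells of a function `x`, with
`S = |∇x|²`, `Q = g(∇u, ∇x)`, `P = |∇u|²`, `h = Δx` and `f = Δu`: Green's identities on
`{x > x₀}`, and the asymptotics of the coefficients. -/
structure ShellSystem (μ : Measure X) (x u S Q P h f : X → ℝ) (x₀ C N lam : ℝ) : Prop where
  C_nonneg : 0 ≤ C
  continuous : Continuous x
  isCompact : ∀ a b, x₀ < a → IsCompact {p | a ≤ x p ∧ x p ≤ b}
  u_cont : ContinuousOn u {p | x₀ < x p}
  S_cont : ContinuousOn S {p | x₀ < x p}
  Q_cont : ContinuousOn Q {p | x₀ < x p}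
  P_cont : ContinuousOn P {p | x₀ < x p}
  h_cont : ContinuousOn h {p | x₀ < x p}
  f_cont : ContinuousOn f {p | x₀ < x p}
  green_x : ∀ (ψ : ℝ → ℝ) (a b : ℝ), ContDiff ℝ ∞ ψ → Function.support ψ ⊆ Icc a b → x₀ < a →
    ∫ p, deriv ψ (x p) * (S p * u p ^ 2) ∂μ =
      -∫ p, ψ (x p) * (2 * (u p * Q p) + u p ^ 2 * h p) ∂μ
  green_u : ∀ (ψ : ℝ → ℝ) (a b : ℝ), ContDiff ℝ ∞ ψ → Function.support ψ ⊆ Icc a b → x₀ < a →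
    ∫ p, deriv ψ (x p) * (u p * Q p) ∂μ = -∫ p, ψ (x p) * (P p + u p * f p) ∂μ
  P_nonneg : ∀ p, x₀ < x p → 0 ≤ P p
  Q_sq_le : ∀ p, x₀ < x p → Q p ^ 2 ≤ S p * P p
  S_bound : ∀ p, x₀ < x p → |S p - 4 * x p| ≤ C / x p
  h_bound : ∀ p, x₀ < x p → |h p - 2 * N| ≤ C / x p
  f_bound : ∀ p, x₀ < x p → |f p + Q p / 4 + lam * u p| ≤ C / √(x p) * (|u p| + √(P p))

variable [BorelSpace X] {μ : Measure X} [IsFiniteMeasureOnCompacts μ]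

/-- A function that is continuous on `{x > x₀}` is integrable against a cutoff in `x` whose support is
compact in `(x₀, ∞)`. -/
theorem integrable_of_support_subset {x : X → ℝ} {x₀ a b : ℝ} (hx : Continuous x)
    (hc : ∀ a b, x₀ < a → IsCompact {p | a ≤ x p ∧ x p ≤ b}) {ψ : ℝ → ℝ} (hψ : Continuous ψ)
    (hs : Function.support ψ ⊆ Icc a b) (ha : x₀ < a) {G : X → ℝ}
    (hG : ContinuousOn G {p | x₀ < x p}) : Integrable (fun p => ψ (x p) * G p) μ := by
  have hcl : IsClosed {p | a ≤ x p ∧ x p ≤ b} :=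
    (isClosed_le continuous_const hx).inter (isClosed_le hx continuous_const)
  have hts : tsupport (fun p => ψ (x p)) ⊆ {p | a ≤ x p ∧ x p ≤ b} :=
    closure_minimal (fun p hp => hs hp) hcl
  refine Continuous.integrable_of_hasCompactSupport ?_ ?_
  · exact continuous_mul_of_tsupport_subset (isOpen_lt continuous_const hx) (hψ.comp hx)
      (hts.trans fun p hp => ha.trans_le hp.1) hG
  · refine (hc a b ha).of_isClosed_subset (isClosed_tsupport _) ?_
    exact (tsupport_mul_subset_left (f := fun p => ψ (x p)) (g := G)).trans hts

/-- Shell averages are differentiable in the position `s` of the shell. -/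
theorem hasDerivAt_integral_shell {x : X → ℝ} {x₀ : ℝ} (hx : Continuous x)
    (hc : ∀ a b, x₀ < a → IsCompact {p | a ≤ x p ∧ x p ≤ b}) {G : X → ℝ}
    (hG : ContinuousOn G {p | x₀ < x p}) {η : ℝ → ℝ} (hη : ContDiff ℝ ∞ η)
    (hs : Function.support η ⊆ Icc (-1) 1) {s : ℝ} (hs₀ : x₀ + 1 < s) :
    HasDerivAt (fun s => ∫ p, η (x p - s) * G p ∂μ) (-∫ p, deriv η (x p - s) * G p ∂μ) s := by
  have hηt : tsupport η ⊆ Icc (-1) 1 := closure_minimal hs isClosed_Icc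
  have hηc : HasCompactSupport η := isCompact_Icc.of_isClosed_subset (isClosed_tsupport _) hηt
  have hη' : Continuous (deriv η) := hη.continuous_deriv (by simp)
  obtain ⟨D, hD⟩ := hηc.deriv.exists_bound_of_continuous hη'
  have hD0 : 0 ≤ D := (norm_nonneg _).trans (hD 0)
  have hds : Function.support (deriv η) ⊆ Icc (-1) 1 := support_deriv_subset.trans hηt
  set ε := (s - (x₀ + 1)) / 2 with hε
  have hε0 : 0 < ε := by rw [hε]; linarith
  have hshift : ∀ {θ : ℝ → ℝ}, Function.support θ ⊆ Icc (-1) 1 → ∀ t,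
      Function.support (fun y => θ (y - t)) ⊆ Icc (t - 1) (t + 1) := by
    intro θ hθ t y hy
    have h1 := hθ (show y - t ∈ Function.support θ from hy)
    exact ⟨by linarith [h1.1], by linarith [h1.2]⟩
  have hint : ∀ {θ : ℝ → ℝ}, Continuous θ → Function.support θ ⊆ Icc (-1) 1 → ∀ t, x₀ + 1 < t →
      Integrable (fun p => θ (x p - t) * G p) μ := fun hθ hθs t ht =>
    integrable_of_support_subset (ψ := fun y => _) hx hc (hθ.comp (continuous_id.sub continuous_const))
      (hshift hθs t) (by linarith) hG
  -- for `t` within `ε` of `s`, all the integrands are supported in the compact shell `K`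
  set K := {p | s - 1 - ε ≤ x p ∧ x p ≤ s + 1 + ε} with hK
  have hKc : IsCompact K := hc _ _ (by rw [hε]; linarith)
  have hKm : MeasurableSet K :=
    ((isClosed_le continuous_const hx).inter (isClosed_le hx continuous_const)).measurableSet
  have hGK : IntegrableOn G K μ := ContinuousOn.integrableOn_compact' hKc hKm
    (hG.mono fun p hp => by
      have := hp.1
      change x₀ < x p
      rw [hε] at this; linarith)
  have hmain := hasDerivAt_integral_of_dominated_loc_of_deriv_le (𝕜 := ℝ) (μ := μ)
    (F := fun t p => η (x p - t) * G p) (F' := fun t p => -(deriv η (x p - t) * G p)) (x₀ := s)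
    (bound := K.indicator fun p => D * |G p|) (Metric.ball_mem_nhds s hε0) ?_
    (hint hη.continuous hs s hs₀) (hint hη' hds s hs₀).neg.aestronglyMeasurable ?_
    ((integrable_indicator_iff hKm).2 (hGK.abs.const_mul D)) ?_
  · have := hmain.2
    rwa [integral_neg] at this
  · filter_upwards [Ioi_mem_nhds hs₀] with t ht
    exact (hint hη.continuous hs t ht).aestronglyMeasurable
  · refine Eventually.of_forall fun p t ht => ?_
    rw [norm_neg, norm_mul]
    by_cases hp : p ∈ K
    · rw [indicator_of_mem hp]
      exact mul_le_mul_of_nonneg_right (hD _) (abs_nonneg _)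
    · have h0 : deriv η (x p - t) = 0 := by
        by_contra h
        have h1 := hds h
        rw [Metric.mem_ball, Real.dist_eq, abs_lt] at ht
        exact hp ⟨by linarith [h1.1, ht.1], by linarith [h1.2, ht.2]⟩
      rw [indicator_of_notMem hp, h0]; simp
  · refine Eventually.of_forall fun p t _ => ?_
    have h1 : HasDerivAt (fun t => η (x p - t)) (-deriv η (x p - t)) t := by
      have := HasDerivAt.comp t ((hη.differentiable (by simp)) (x p - t)).hasDerivAt
        ((hasDerivAt_id t).const_sub (x p))
      exact this.congr_deriv (by simp)
    exact (h1.mul_const (G p)).congr_deriv (by ring)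

end

section

variable {X : Type*} [TopologicalSpace X] [MeasurableSpace X]
variable [BorelSpace X] {μ : Measure X} [IsFiniteMeasureOnCompacts μ]
variable {x u S Q P h f : X → ℝ} {x₀ C N lam : ℝ}

theorem contDiff_bump_sub (s : ℝ) : ContDiff ℝ ∞ fun t => bump (t - s) :=
  contDiff_bump.comp (contDiff_id.sub contDiff_const)

theorem support_bump_sub_subset (s : ℝ) :
    Function.support (fun t => bump (t - s)) ⊆ Icc (s - 1) (s + 1) := fun t ht => by
  have := support_bump_subset (show t - s ∈ Function.support bump from ht)
  exact ⟨by linarith [this.1], by linarith [this.2]⟩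

theorem deriv_bump_sub (s t : ℝ) : deriv (fun t => bump (t - s)) t = deriv bump (t - s) :=
  deriv_comp_sub_const (f := bump) s t

namespace ShellSystem

theorem integrable_bump (H : ShellSystem μ x u S Q P h f x₀ C N lam) {G : X → ℝ}
    (hG : ContinuousOn G {p | x₀ < x p}) {s : ℝ} (hs : x₀ + 1 < s) :
    Integrable (fun p => bump (x p - s) * G p) μ :=
  integrable_of_support_subset (ψ := fun t => bump (t - s)) H.continuous H.isCompact
    (contDiff_bump_sub s).continuous (support_bump_sub_subset s) (by linarith) hG

/-- Two functions that compare pointwise on the shell `|x - s| ≤ 1` have comparable averages. -/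
theorem integral_bump_mono (H : ShellSystem μ x u S Q P h f x₀ C N lam) {G G' : X → ℝ}
    (hG : ContinuousOn G {p | x₀ < x p}) (hG' : ContinuousOn G' {p | x₀ < x p}) {s : ℝ}
    (hs : x₀ + 1 < s) (hle : ∀ p, |x p - s| ≤ 1 → G p ≤ G' p) :
    ∫ p, bump (x p - s) * G p ∂μ ≤ ∫ p, bump (x p - s) * G' p ∂μ := by
  refine integral_mono (H.integrable_bump hG hs) (H.integrable_bump hG' hs) fun p => ?_
  by_cases hp : |x p - s| ≤ 1
  · exact mul_le_mul_of_nonneg_left (hle p hp) (bump_nonneg _)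
  · have : bump (x p - s) = 0 := by
      by_contra hne
      exact hp (abs_le.2 (support_bump_subset hne))
    simp [this]

/-- The smoothed boundary norm decays exponentially, unless it grows at least like
`s ^ (N / 2 - 2 lam)`. -/
theorem exp_decay (H : ShellSystem μ x u S Q P h f x₀ C N lam)
    (ho : (fun s => ∫ p, bump (x p - s) * (S p * u p ^ 2) ∂μ) =o[atTop]
      fun s => s ^ (-2 * lam + N / 2)) :
    ∃ s₂, ∃ K, 0 ≤ K ∧ ∀ s, s₂ ≤ s →
      ∫ p, bump (x p - s) * (S p * u p ^ 2) ∂μ ≤ K * Real.exp (-s / 3) := by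
  have hC := H.C_nonneg
  set C₁ := 2 * |N| + 2 * C + |N| * C with hC₁
  set C₂ := 2 * C + C ^ 2 + |lam| * (1 + C) with hC₂
  have hC₁0 : 0 ≤ C₁ := by positivity
  have hC₂0 : 0 ≤ C₂ := by positivity
  set s₁ := max (x₀ + 2) (C + 4) with hs₁
  have hsx : ∀ s, s₁ ≤ s → x₀ + 1 < s := fun s hs => by
    linarith [le_max_left (x₀ + 2) (C + 4)]
  have hsC : ∀ s, s₁ ≤ s → C + 4 ≤ s := fun s hs => (le_max_right _ _).trans hs
  have hin : ∀ s, s₁ ≤ s → ∀ p, |x p - s| ≤ 1 → x₀ < x p := fun s hs p hp => by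
    linarith [(abs_le.1 hp).1, hsx s hs]
  have cSu : ContinuousOn (fun p => S p * u p ^ 2) {p | x₀ < x p} := H.S_cont.mul (H.u_cont.pow 2)
  have cuQ : ContinuousOn (fun p => u p * Q p) {p | x₀ < x p} := H.u_cont.mul H.Q_cont
  have cuh : ContinuousOn (fun p => u p ^ 2 * h p) {p | x₀ < x p} := (H.u_cont.pow 2).mul H.h_cont
  have cPf : ContinuousOn (fun p => P p + u p * f p) {p | x₀ < x p} :=
    H.P_cont.add (H.u_cont.mul H.f_cont)
  have ccuQ : ∀ c : ℝ, ContinuousOn (fun p => c * (u p * Q p)) {p | x₀ < x p} := fun c =>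
    continuousOn_const.mul cuQ
  set b : ℝ → ℝ := fun s => ∫ p, bump (x p - s) * (S p * u p ^ 2) ∂μ with hb
  set d : ℝ → ℝ := fun s => ∫ p, bump (x p - s) * (u p * Q p) ∂μ with hd
  set b' : ℝ → ℝ := fun s => ∫ p, bump (x p - s) * (2 * (u p * Q p) + u p ^ 2 * h p) ∂μ with hb'
  set d' : ℝ → ℝ := fun s => ∫ p, bump (x p - s) * (P p + u p * f p) ∂μ with hd'
  have hbd : ∀ s, s₁ ≤ s → HasDerivAt b (b' s) s := fun s hs => by
    have h1 := hasDerivAt_integral_shell (μ := μ) H.continuous H.isCompact cSu contDiff_bump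
      support_bump_subset (hsx s hs)
    have h2 := H.green_x _ _ _ (contDiff_bump_sub s) (support_bump_sub_subset s)
      (by linarith [hsx s hs])
    simp only [deriv_bump_sub] at h2
    rw [h2, neg_neg] at h1
    exact h1
  have hdd : ∀ s, s₁ ≤ s → HasDerivAt d (d' s) s := fun s hs => by
    have h1 := hasDerivAt_integral_shell (μ := μ) H.continuous H.isCompact cuQ contDiff_bump
      support_bump_subset (hsx s hs)
    have h2 := H.green_u _ _ _ (contDiff_bump_sub s) (support_bump_sub_subset s)
      (by linarith [hsx s hs])
    simp only [deriv_bump_sub] at h2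
    rw [h2, neg_neg] at h1
    exact h1
  have hb0 : ∀ s, s₁ ≤ s → 0 ≤ b s := fun s hs => by
    have := H.integral_bump_mono (G := fun _ => 0) continuousOn_const cSu (hsx s hs) fun p hp => by
      have := (shell_S_bounds hC (hsC s hs) hp (H.S_bound p (hin s hs p hp))).2.1
      have : 0 ≤ S p := by linarith [hsC s hs]
      positivity
    simpa using this
  have hcmul : ∀ (c s : ℝ) (G : X → ℝ), ∫ p, bump (x p - s) * (c * G p) ∂μ =
      c * ∫ p, bump (x p - s) * G p ∂μ := fun c s G => by
    rw [← integral_const_mul]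
    exact integral_congr_ae (Eventually.of_forall fun p => mul_left_comm _ _ _)
  have hadd : ∀ s, s₁ ≤ s → ∀ G G' : X → ℝ, ContinuousOn G {p | x₀ < x p} →
      ContinuousOn G' {p | x₀ < x p} → ∫ p, bump (x p - s) * (G p + G' p) ∂μ =
      ∫ p, bump (x p - s) * G p ∂μ + ∫ p, bump (x p - s) * G' p ∂μ := fun s hs G G' hG hG' => by
    rw [← integral_add (H.integrable_bump hG (hsx s hs)) (H.integrable_bump hG' (hsx s hs))]
    exact integral_congr_ae (Eventually.of_forall fun p => mul_add _ _ _)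
  have hM : 0 ≤ max C₁ C₂ := hC₁0.trans (le_max_left _ _)
  -- enlarge `K` to make it nonnegative
  suffices hdec : ∃ s₂, s₁ ≤ s₂ ∧ ∃ K, ∀ s, s₂ ≤ s → b s ≤ K * Real.exp (-s / 3) by
    obtain ⟨s₂, hs₂, K, hK⟩ := hdec
    refine ⟨s₂, max K 0, le_max_right _ _, fun s hs => (hK s hs).trans ?_⟩
    exact mul_le_mul_of_nonneg_right (le_max_left _ _) (Real.exp_pos _).le
  refine exp_decay_of_riccati (b := b) (d := d) (b' := b') (d' := d')
    (s₁ := s₁) (C := max C₁ C₂) (lam := lam) (N := N) (by linarith [hsC s₁ le_rfl]) hM hb0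
    hbd hdd ?_ ?_ ho
  · intro s hs
    have hs0 : 0 < s := by linarith [hsC s hs]
    have hsplit : b' s = 2 * d s + ∫ p, bump (x p - s) * (u p ^ 2 * h p) ∂μ := by
      rw [hb', hd]; dsimp only
      rw [hadd s hs _ _ (ccuQ _) cuh, hcmul]
    have hpt : ∀ p, |x p - s| ≤ 1 → |u p ^ 2 * h p - N / (2 * s) * (S p * u p ^ 2)| ≤
        C₁ / s ^ 2 * (S p * u p ^ 2) := fun p hp =>
      shell_laplacian_bound hC (hsC s hs) hp (H.S_bound p (hin s hs p hp))
        (H.h_bound p (hin s hs p hp))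
    have hup := H.integral_bump_mono cuh (G' := fun p => (N / (2 * s) + C₁ / s ^ 2) * (S p * u p ^ 2))
      (continuousOn_const.mul cSu) (hsx s hs) fun p hp => by
        linarith [(abs_le.1 (hpt p hp)).2]
    have hlo := H.integral_bump_mono (G := fun p => (N / (2 * s) - C₁ / s ^ 2) * (S p * u p ^ 2))
      (continuousOn_const.mul cSu) cuh (hsx s hs) fun p hp => by
        linarith [(abs_le.1 (hpt p hp)).1]
    rw [hcmul] at hup hlo
    have hle : C₁ / s ^ 2 * b s ≤ max C₁ C₂ / s ^ 2 * b s := by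
      have := hb0 s hs
      gcongr
      exact le_max_left _ _
    rw [hsplit, abs_le]
    constructor <;> linarith
  · intro s hs z
    have hs0 : 0 < s := by linarith [hsC s hs]
    have h1 := H.integral_bump_mono (G := fun p => (-(z ^ 2 + C₂ / s * |z| + lam / (4 * s) +
        C₂ / (s * √s))) * (S p * u p ^ 2)) (G' := fun p => (P p + u p * f p) +
          (-2 * z + 1 / 4) * (u p * Q p)) (continuousOn_const.mul cSu)
        (cPf.add (ccuQ _)) (hsx s hs) fun p hp => by
      have hp' := hin s hs p hp
      linarith [shell_riccati_bound hC (hsC s hs) hp (H.S_bound p hp') (H.P_nonneg p hp')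
        (H.Q_sq_le p hp') (H.f_bound p hp') z]
    rw [hcmul, hadd s hs _ _ cPf (ccuQ _), hcmul] at h1
    have hle : (C₂ / s * |z| + C₂ / (s * √s)) * b s ≤
        (max C₁ C₂ / s * |z| + max C₁ C₂ / (s * √s)) * b s := by
      have := hb0 s hs
      gcongr <;> exact le_max_right _ _
    change _ ≤ d' s + (-2 * z + 1 / 4) * d s at h1
    change -(z ^ 2 + C₂ / s * |z| + lam / (4 * s) + C₂ / (s * √s)) * b s ≤ _ at h1
    linarith

/-- **Caccioppoli's inequality** on shells. -/
theorem integral_gradient_le (H : ShellSystem μ x u S Q P h f x₀ C N lam) :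
    ∃ D, 0 ≤ D ∧ ∀ s, x₀ + 3 ≤ s → C + 6 ≤ s → ∫ p, bump (x p - s) * P p ∂μ ≤
      D * (∫ p, bump (x p - (s + 1)) * (S p * u p ^ 2) ∂μ +
        ∫ p, bump (x p - s) * (S p * u p ^ 2) ∂μ +
        ∫ p, bump (x p - (s - 1)) * (S p * u p ^ 2) ∂μ) := by
  have hC := H.C_nonneg
  obtain ⟨D, hD0, hD⟩ := exists_cutoff_majorant (A := 1 + |lam| + C + 2 * C ^ 2) (by positivity)
  refine ⟨2 * D, by positivity, fun s hs hsC => ?_⟩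
  have cSu : ContinuousOn (fun p => S p * u p ^ 2) {p | x₀ < x p} := H.S_cont.mul (H.u_cont.pow 2)
  have cuQ : ContinuousOn (fun p => u p * Q p) {p | x₀ < x p} := H.u_cont.mul H.Q_cont
  have cuf : ContinuousOn (fun p => u p * f p) {p | x₀ < x p} := H.u_cont.mul H.f_cont
  have hsx : x₀ + 1 < s := by linarith
  have green := H.green_u _ _ _ (contDiff_bump_sub s) (support_bump_sub_subset s) (by linarith)
  simp only [deriv_bump_sub] at green
  have iP := H.integrable_bump H.P_cont hsx
  have iuf := H.integrable_bump cuf hsx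
  have iuf' : Integrable (fun p => -(bump (x p - s) * (u p * f p))) μ := iuf.neg
  have iuQ : Integrable (fun p => deriv bump (x p - s) * (u p * Q p)) μ := by
    refine integrable_of_support_subset (ψ := fun t => deriv bump (t - s)) H.continuous H.isCompact
      ((contDiff_bump.continuous_deriv (by simp)).comp (continuous_id.sub continuous_const))
      (a := s - 1) (b := s + 1) ?_ (by linarith) cuQ
    intro t ht
    have h1 : cutoff (t - s) ≠ 0 := fun h0 => ht (by simp [deriv_bump, h0])
    have := support_cutoff_subset h1
    exact ⟨by linarith [this.1], by linarith [this.2]⟩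
  have i1 := H.integrable_bump cSu (s := s + 1) (by linarith)
  have i2 := H.integrable_bump cSu hsx
  have i3 := H.integrable_bump cSu (s := s - 1) (by linarith)
  have hsum : ∫ p, bump (x p - s) * (P p + u p * f p) ∂μ =
      ∫ p, bump (x p - s) * P p ∂μ + ∫ p, bump (x p - s) * (u p * f p) ∂μ := by
    rw [← integral_add iP iuf]
    exact integral_congr_ae (Eventually.of_forall fun p => mul_add _ _ _)
  have i123 : Integrable (fun p => bump (x p - (s + 1)) * (S p * u p ^ 2) +
      bump (x p - s) * (S p * u p ^ 2) + bump (x p - (s - 1)) * (S p * u p ^ 2)) μ := (i1.add i2).add i3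
  have i12 : Integrable (fun p => bump (x p - (s + 1)) * (S p * u p ^ 2) +
      bump (x p - s) * (S p * u p ^ 2)) μ := i1.add i2
  have hle : ∫ p, (-(bump (x p - s) * (u p * f p)) - deriv bump (x p - s) * (u p * Q p)) ∂μ ≤
      ∫ p, (1 / 2 * (bump (x p - s) * P p) + D * (bump (x p - (s + 1)) * (S p * u p ^ 2) +
        bump (x p - s) * (S p * u p ^ 2) + bump (x p - (s - 1)) * (S p * u p ^ 2))) ∂μ := by
    refine integral_mono (iuf'.sub iuQ)
      ((iP.const_mul _).add (i123.const_mul _)) fun p => ?_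
    dsimp only
    by_cases hin : x₀ < x p ∧ C + 4 ≤ x p
    · have hS : 0 ≤ S p := by
        have := (shell_S_bounds hC (s := x p) hin.2 (by simp) (H.S_bound p hin.1)).2.1
        linarith
      have hmaj := mul_le_mul_of_nonneg_right (hD (x p - s))
        (mul_nonneg hS (sq_nonneg (u p)))
      by_cases hp : |x p - s| ≤ 1
      · have := shell_caccioppoli_bound (c := cutoff (x p - s)) (c' := deriv cutoff (x p - s)) hC
          (by linarith) hp (H.S_bound p hin.1) (H.P_nonneg p hin.1) (H.Q_sq_le p hin.1)
          (H.f_bound p hin.1)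
        rw [deriv_bump, show x p - (s + 1) = x p - s - 1 by ring,
          show x p - (s - 1) = x p - s + 1 by ring]
        change -(cutoff (x p - s) ^ 2 * (u p * f p)) - _ ≤ 1 / 2 * (cutoff (x p - s) ^ 2 * P p) + _
        linarith
      · have h0 : cutoff (x p - s) = 0 := by
          by_contra hne
          exact hp (abs_le.2 (support_cutoff_subset hne))
        have h1 : 0 ≤ S p * u p ^ 2 := mul_nonneg hS (sq_nonneg _)
        have h2 := mul_nonneg (bump_nonneg (x p - (s + 1))) h1
        have h3 := mul_nonneg (bump_nonneg (x p - (s - 1))) h1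
        have h4 : bump (x p - s) = 0 := by simp [bump, h0]
        rw [deriv_bump, h4, h0]
        have : 0 ≤ D * (bump (x p - (s + 1)) * (S p * u p ^ 2) +
          bump (x p - (s - 1)) * (S p * u p ^ 2)) := by positivity
        linarith
    · -- here `x p < s - 2`, so that all the cutoffs vanish
      have hlt : x p < s - 2 := by
        by_contra! hcon
        exact hin ⟨by linarith, by linarith⟩
      have hz : ∀ t, s - 1 ≤ t → bump (x p - t) = 0 := fun t ht => by
        by_contra hne
        linarith [(support_bump_sub_subset t (show x p ∈ Function.support _ from hne)).1]
      have h0 : cutoff (x p - s) = 0 := by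
        by_contra hne
        linarith [(support_cutoff_subset hne).1]
      rw [hz s (by linarith), hz (s + 1) (by linarith), hz (s - 1) le_rfl, deriv_bump, h0]
      simp
  rw [integral_sub iuf' iuQ, integral_neg, integral_add (iP.const_mul _)
    (i123.const_mul _), integral_const_mul, integral_const_mul,
    integral_add i12 i3, integral_add i1 i2, green, hsum] at hle
  linarith

/-- Exponential integrability of the energy. Any exponent below the decay rate `1/3` of the shell
averages is admissible; `3/10` leaves room for the weights, which cost a little more than `1/4`. -/
theorem lintegral_exp_lt_top (H : ShellSystem μ x u S Q P h f x₀ C N lam)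
    (ho : (fun s => ∫ p, bump (x p - s) * (S p * u p ^ 2) ∂μ) =o[atTop]
      fun s => s ^ (-2 * lam + N / 2)) :
    ∃ x₂, x₀ < x₂ ∧ C + 4 ≤ x₂ ∧ ∫⁻ p in {p | x₂ ≤ x p},
      ENNReal.ofReal ((S p * u p ^ 2 + P p) * Real.exp (3 / 10 * x p)) ∂μ < ⊤ := by
  have hC := H.C_nonneg
  obtain ⟨s₂, K, hK0, hK⟩ := H.exp_decay ho
  obtain ⟨D, hD0, hD⟩ := H.integral_gradient_le
  have cSu : ContinuousOn (fun p => S p * u p ^ 2) {p | x₀ < x p} := H.S_cont.mul (H.u_cont.pow 2)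
  obtain ⟨k₀, hk₀⟩ := exists_nat_ge (max (s₂ + 1) (max (x₀ + 3) (C + 6)))
  obtain ⟨hk1, hk2⟩ := max_le_iff.1 hk₀
  obtain ⟨hk2, hk3⟩ := max_le_iff.1 hk2
  set K' := K + D * (3 * (K * Real.exp (1 / 3))) with hK'
  have hG : ContinuousOn (fun p => S p * u p ^ 2 + P p) {p | x₀ < x p} := cSu.add H.P_cont
  have hGi : ∀ s : ℝ, k₀ ≤ s → ∫ p, bump (x p - s) * (S p * u p ^ 2 + P p) ∂μ ≤
      K' * Real.exp (-s / 3) := fun s hs => by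
    have e : ∀ t, s - 1 ≤ t → ∫ p, bump (x p - t) * (S p * u p ^ 2) ∂μ ≤
        K * Real.exp (1 / 3) * Real.exp (-s / 3) := fun t ht => by
      refine (hK t (by linarith)).trans ?_
      rw [mul_assoc, ← Real.exp_add]
      gcongr
      linarith
    have h1 := hD s (by linarith) (by linarith)
    have h2 := hK s (by linarith)
    have h3 := e (s + 1) (by linarith)
    have h4 := e s (by linarith)
    have h5 := e (s - 1) le_rfl
    have h6 := mul_le_mul_of_nonneg_left (add_le_add (add_le_add h3 h4) h5) hD0
    have h7 : ∫ p, bump (x p - s) * (S p * u p ^ 2 + P p) ∂μ =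
        ∫ p, bump (x p - s) * (S p * u p ^ 2) ∂μ + ∫ p, bump (x p - s) * P p ∂μ := by
      rw [← integral_add (H.integrable_bump cSu (by linarith))
        (H.integrable_bump H.P_cont (by linarith))]
      exact integral_congr_ae (Eventually.of_forall fun p => mul_add _ _ _)
    rw [h7, hK']
    linarith
  have hGnn : ∀ p, k₀ - 1 ≤ x p → 0 ≤ S p * u p ^ 2 + P p := fun p hp => by
    have hp' : x₀ < x p := by linarith
    have := (shell_S_bounds hC (s := x p) (by linarith) (by simp) (H.S_bound p hp')).2.1
    have h0 : 0 ≤ S p := by linarith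
    have := H.P_nonneg p hp'
    positivity
  refine ⟨k₀, by linarith, by linarith, ?_⟩
  set A : ℕ → Set X := fun k => {p | |x p - (k₀ + k)| ≤ 1 / 2} with hA
  have hAm : ∀ k, MeasurableSet (A k) := fun k =>
    (isClosed_le ((H.continuous.sub continuous_const).abs) continuous_const).measurableSet
  have hcover : {p | (k₀ : ℝ) ≤ x p} ⊆ ⋃ k, A k := fun p hp => by
    have hp' : (k₀ : ℝ) ≤ x p := hp
    refine mem_iUnion.2 ⟨⌊x p - k₀ + 1 / 2⌋₊, ?_⟩
    have h1 := Nat.floor_le (show 0 ≤ x p - k₀ + 1 / 2 by linarith)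
    have h2 := Nat.lt_floor_add_one (x p - k₀ + 1 / 2)
    change |x p - (k₀ + (⌊x p - k₀ + 1 / 2⌋₊ : ℝ))| ≤ 1 / 2
    rw [abs_le]
    constructor <;> linarith
  set c := Real.exp (3 / 10 * (k₀ + 1)) * (K' * Real.exp (-k₀ / 3)) with hc
  -- the contribution of the `k`-th shell decays geometrically, with ratio `e^{3/10 - 1/3}`
  have hterm : ∀ k : ℕ, ∫⁻ p in A k,
      ENNReal.ofReal ((S p * u p ^ 2 + P p) * Real.exp (3 / 10 * x p)) ∂μ ≤
      ENNReal.ofReal (c * Real.exp (-1 / 30) ^ k) := fun k => by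
    have hs : (k₀ : ℝ) ≤ k₀ + k := by simp
    set ε := Real.exp (3 / 10 * (k₀ + k + 1)) with hε
    have hint := (H.integrable_bump hG (s := k₀ + k) (by linarith)).const_mul ε
    calc _ ≤ ∫⁻ p in A k, ENNReal.ofReal (ε * (bump (x p - (k₀ + k)) *
          (S p * u p ^ 2 + P p))) ∂μ := by
          refine setLIntegral_mono' (hAm k) fun p hp => ENNReal.ofReal_le_ofReal ?_
          have hp' : |x p - (k₀ + k)| ≤ 1 / 2 := hp
          rw [bump_eq_one hp', one_mul, mul_comm]
          have h1 := abs_le.1 hp'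
          refine mul_le_mul_of_nonneg_right (Real.exp_le_exp.2 ?_) (hGnn p ?_) <;> linarith
      _ ≤ ∫⁻ p, ENNReal.ofReal (ε * (bump (x p - (k₀ + k)) * (S p * u p ^ 2 + P p))) ∂μ :=
          setLIntegral_le_lintegral _ _
      _ = ENNReal.ofReal (∫ p, ε * (bump (x p - (k₀ + k)) * (S p * u p ^ 2 + P p)) ∂μ) := by
          refine (ofReal_integral_eq_lintegral_ofReal hint (Eventually.of_forall fun p => ?_)).symm
          refine mul_nonneg (Real.exp_pos _).le ?_
          by_cases hp : bump (x p - (k₀ + k)) = 0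
          · simp [hp]
          · have h1 := support_bump_subset (show _ ∈ Function.support bump from hp)
            exact mul_nonneg (bump_nonneg _) (hGnn p (by linarith [h1.1]))
      _ ≤ _ := by
          refine ENNReal.ofReal_le_ofReal ?_
          rw [integral_const_mul]
          refine (mul_le_mul_of_nonneg_left (hGi _ hs) (Real.exp_pos _).le).trans (le_of_eq ?_)
          have e1 : Real.exp (3 / 10 * (k₀ + k + 1)) =
              Real.exp (3 / 10 * (k₀ + 1)) * Real.exp (3 / 10 * k) := by
            rw [← Real.exp_add]; ring_nf
          have e2 : Real.exp (-(k₀ + k : ℝ) / 3) = Real.exp (-k₀ / 3) * Real.exp (-k / 3) := by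
            rw [← Real.exp_add]; ring_nf
          have e3 : Real.exp (-1 / 30) ^ k = Real.exp (3 / 10 * k) * Real.exp (-k / 3) := by
            rw [← Real.exp_nat_mul, ← Real.exp_add]; ring_nf
          rw [e1, e2, e3, hc]; ring
  have hsummable : Summable fun k : ℕ => c * Real.exp (-1 / 30) ^ k :=
    (summable_geometric_of_lt_one (Real.exp_pos _).le
      (Real.exp_lt_one_iff.2 (by norm_num))).mul_left c
  calc _ ≤ ∫⁻ p in ⋃ k, A k,
        ENNReal.ofReal ((S p * u p ^ 2 + P p) * Real.exp (3 / 10 * x p)) ∂μ :=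
        lintegral_mono_set hcover
    _ ≤ ∑' k, ∫⁻ p in A k,
        ENNReal.ofReal ((S p * u p ^ 2 + P p) * Real.exp (3 / 10 * x p)) ∂μ :=
        lintegral_iUnion_le _ _
    _ ≤ ∑' k : ℕ, ENNReal.ofReal (c * Real.exp (-1 / 30) ^ k) := ENNReal.tsum_le_tsum hterm
    _ < ⊤ := hsummable.tsum_ofReal_ne_top.lt_top

end ShellSystem

end

section

variable {n : ℕ} {X : Type*} [TopologicalSpace X] [ChartedSpace (EuclideanSpace ℝ (Fin n)) X]
  [IsManifold (𝓡 n) ∞ X]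

/-! ### One-sided derivatives at interior points -/

theorem preimage_chart_symm_mem_nhds {n : ℕ} {X : Type*} [TopologicalSpace X]
    [ChartedSpace (EuclideanSpace ℝ (Fin n)) X] {s : Set X} {p : X} (hs : s ∈ 𝓝 p) :
    (extChartAt (𝓡 n) p).symm ⁻¹' s ∈ 𝓝 (extChartAt (𝓡 n) p p) :=
  (continuousAt_extChartAt_symm (I := 𝓡 n) p).preimage_mem_nhds
    (by rwa [extChartAt_to_inv (I := 𝓡 n) p])

theorem pd_of_mem_nhds {s : Set (EuclideanSpace ℝ (Fin n))} {y : EuclideanSpace ℝ (Fin n)}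
    (hs : s ∈ 𝓝 y) (F : EuclideanSpace ℝ (Fin n) → ℝ) (i : Fin n) : pd s F i y = pd univ F i y := by
  rw [pd, pd, fderivWithin_of_mem_nhds hs, fderivWithin_univ]

theorem gradInner_of_mem_nhds (g : C1Metric n X) {s : Set X} {p : X} (hs : s ∈ 𝓝 p) (f h : X → ℝ) :
    gradInner g s f h p = gradInner g univ f h p := by
  have h1 := preimage_chart_symm_mem_nhds (n := n) hs
  simp only [gradInner, coordGradInner, preimage_univ, pd_of_mem_nhds h1]

theorem gradNorm_of_mem_nhds (g : C1Metric n X) {s : Set X} {p : X} (hs : s ∈ 𝓝 p) (f : X → ℝ) :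
    gradNorm g s f p = gradNorm g univ f p := by
  rw [gradNorm, gradNorm, gradInner_of_mem_nhds g hs]

theorem laplacian_of_mem_nhds (g : C1Metric n X) {s : Set X} {p : X} (hs : s ∈ 𝓝 p) (f : X → ℝ) :
    laplacian g s f p = laplacian g univ f p := by
  have h1 := preimage_chart_symm_mem_nhds (n := n) hs
  have h2 : ∀ (F : EuclideanSpace ℝ (Fin n) → ℝ) (i j : Fin n),
      pd ((extChartAt (𝓡 n) p).symm ⁻¹' s) (pd ((extChartAt (𝓡 n) p).symm ⁻¹' s) F j) i
        (extChartAt (𝓡 n) p p) = pd univ (pd univ F j) i (extChartAt (𝓡 n) p p) := fun F i j => by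
    rw [pd_of_mem_nhds h1, pd, pd, fderivWithin_univ, fderivWithin_univ]
    have : pd ((extChartAt (𝓡 n) p).symm ⁻¹' s) F j =ᶠ[𝓝 (extChartAt (𝓡 n) p p)] pd univ F j := by
      filter_upwards [eventually_mem_nhds_iff.2 h1] with y hy
      exact pd_of_mem_nhds hy F j
    rw [this.fderiv_eq]
  simp only [laplacian, coordLaplacian, coordHess, preimage_univ, Matrix.of_apply, h2,
    pd_of_mem_nhds h1]

theorem gradNorm_univ_sq (g : C1Metric n X) (f : X → ℝ) (p : X) :
    gradNorm g univ f p ^ 2 = gradInner g univ f f p :=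
  Real.sq_sqrt (coInner_self_nonneg (metricAt_posDef g p) _)

theorem gradInner_univ_comm (g : C1Metric n X) (f h : X → ℝ) (p : X) :
    gradInner g univ f h p = gradInner g univ h f p :=
  coInner_comm (metricAt_isSymm g p) _ _

theorem gradInner_univ_sq_le (g : C1Metric n X) (f h : X → ℝ) (p : X) :
    gradInner g univ f h p ^ 2 ≤ gradInner g univ f f p * gradInner g univ h h p :=
  coInner_sq_le (metricAt_posDef g p) _ _

theorem gradInner_univ_self_nonneg (g : C1Metric n X) (f : X → ℝ) (p : X) :
    0 ≤ gradInner g univ f f p := coInner_self_nonneg (metricAt_posDef g p) _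

/-- The Laplacian is the trace of the Hessian, so that `∇²f ≈ c g` implies `Δf ≈ c n`. -/
theorem abs_laplacian_sub_le (g : C1Metric n X) (f : X → ℝ) (p : X) (c : ℝ) :
    |laplacian g univ f p - c * n| ≤
      √n * tensorNorm (metricAt g p) (hess g univ f p - c • metricAt g p) := by
  refine le_trans (le_of_eq ?_) (abs_trace_le_tensorNorm (metricAt_posDef g p) _)
  congr 1
  have hu : IsUnit (metricAt g p).det := (metricAt_posDef g p).det_pos.ne'.isUnit
  have h1 : ∑ i, ∑ j, (metricAt g p)⁻¹ i j * metricAt g p i j = n := by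
    have h2 : Matrix.trace ((metricAt g p)⁻¹ * (metricAt g p)) = n := by
      rw [Matrix.nonsing_inv_mul _ hu, Matrix.trace_one, Fintype.card_fin]
    rw [← h2, Matrix.trace]
    refine Finset.sum_congr rfl fun i _ => ?_
    rw [Matrix.diag_apply, Matrix.mul_apply]
    exact Finset.sum_congr rfl fun j _ => by rw [(metricAt_isSymm g p).apply]
  have h3 : laplacian g univ f p = ∑ i, ∑ j, (metricAt g p)⁻¹ i j * hess g univ f p i j := rfl
  rw [h3, ← h1, Finset.mul_sum, ← Finset.sum_sub_distrib]
  refine Finset.sum_congr rfl fun i _ => ?_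
  rw [Finset.mul_sum, ← Finset.sum_sub_distrib]
  refine Finset.sum_congr rfl fun j _ => ?_
  simp only [Matrix.sub_apply, Matrix.smul_apply, smul_eq_mul]
  ring

theorem chartDiff_sq {f : X → ℝ} {p : X} (hf : MDifferentiableAt (𝓡 n) 𝓘(ℝ, ℝ) f p) :
    chartDiff (n := n) (fun q => f q ^ 2) p = (2 * f p) • chartDiff f p := by
  have h := chartDiff_comp (n := n) (θ := fun t => t ^ 2) (f := f) (p := p)
    (differentiableAt_pow 2) hf
  rw [h]
  congr 1
  simp

/-- **Green's identity** for a test function of the form `ψ(x) w`. -/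
theorem integral_deriv_comp_mul_gradInner [T2Space X] [SigmaCompactSpace X] [MeasurableSpace X]
    [BorelSpace X] (g : C1Metric n X) {x f w : X → ℝ} {x₀ a b : ℝ}
    (hx : ContMDiff (𝓡 n) 𝓘(ℝ, ℝ) 2 x)
    (hc : ∀ a b, x₀ < a → IsCompact {p | a ≤ x p ∧ x p ≤ b})
    (hf : ∀ p, x₀ < x p → ContMDiffAt (𝓡 n) 𝓘(ℝ, ℝ) 2 f p)
    (hw : ∀ p, x₀ < x p → ContMDiffAt (𝓡 n) 𝓘(ℝ, ℝ) 1 w p) {ψ : ℝ → ℝ} (hψ : ContDiff ℝ ∞ ψ)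
    (hs : Function.support ψ ⊆ Icc a b) (ha : x₀ < a) :
    ∫ p, deriv ψ (x p) * (w p * gradInner g univ f x p) ∂(volMeasure g) =
      -∫ p, ψ (x p) * (gradInner g univ f w p + w p * laplacian g univ f p) ∂(volMeasure g) := by
  have := isLocallyFiniteMeasure_volMeasure g
  have hxc := hx.continuous
  have hΩ : IsOpen {p | x₀ < x p} := isOpen_lt continuous_const hxc
  have hf1 : ∀ p, x₀ < x p → ContMDiffAt (𝓡 n) 𝓘(ℝ, ℝ) 1 f p := fun p hp =>
    (hf p hp).of_le (by norm_num)
  set φ : X → ℝ := fun p => ψ (x p) * w p with hφ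
  have hcl : IsClosed {p | a ≤ x p ∧ x p ≤ b} :=
    (isClosed_le continuous_const hxc).inter (isClosed_le hxc continuous_const)
  have hts : tsupport φ ⊆ {p | a ≤ x p ∧ x p ≤ b} :=
    closure_minimal (fun p hp => hs (left_ne_zero_of_mul hp)) hcl
  have htsψ : tsupport ψ ⊆ Icc a b := closure_minimal hs isClosed_Icc
  have hψx : ∀ p, ContMDiffAt (𝓡 n) 𝓘(ℝ, ℝ) 1 (fun q => ψ (x q)) p := fun p =>
    ((hψ.of_le (by simp)).contMDiff.comp (hx.of_le (by norm_num))).contMDiffAt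
  have hφ1 : ContMDiff (𝓡 n) 𝓘(ℝ, ℝ) 1 φ := contMDiff_of_tsupport fun p hp =>
    (hψx p).mul (hw p (ha.trans_le (hts hp).1))
  have hgreen := integral_mul_laplacian g (f := f) (φ := φ) hΩ hf hφ1
    ((hc a b ha).of_isClosed_subset (isClosed_tsupport _) hts) (hts.trans fun p hp => ha.trans_le hp.1)
  have hgrad : ∀ p, gradInner g univ f φ p =
      ψ (x p) * gradInner g univ f w p + deriv ψ (x p) * (w p * gradInner g univ f x p) := by
    intro p
    by_cases hp : a ≤ x p ∧ x p ≤ b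
    · have hp' : x₀ < x p := ha.trans_le hp.1
      have hxd := (hx.contMDiffAt (x := p)).mdifferentiableAt (by norm_num)
      rw [gradInner_univ, hφ, chartDiff_mul ((hψx p).mdifferentiableAt (by norm_num))
        ((hw p hp').mdifferentiableAt (by norm_num)), coInner_add_right, coInner_smul_right,
        coInner_smul_right, chartDiff_comp ((hψ.differentiable (by simp)) _) hxd,
        coInner_smul_right, gradInner_univ, gradInner_univ]
      ring
    · have h1 : ψ (x p) = 0 := by
        by_contra h; exact hp (hs h)
      have h2 : deriv ψ (x p) = 0 := by
        by_contra h; exact hp (htsψ (support_deriv_subset h))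
      rw [gradInner_eq_zero_right g f fun h => hp (hts h), h1, h2]
      ring
  have cw : ContinuousOn w {p | x₀ < x p} := fun p hp => (hw p hp).continuousAt.continuousWithinAt
  have cl : ContinuousOn (laplacian g univ f) {p | x₀ < x p} := continuousOn_laplacian g hΩ hf
  have cfw : ContinuousOn (gradInner g univ f w) {p | x₀ < x p} := fun p hp =>
    (gradInner_continuousAt g (hf1 p hp) (hw p hp)).continuousWithinAt
  have cfx : ContinuousOn (gradInner g univ f x) {p | x₀ < x p} := fun p hp =>
    (gradInner_continuousAt g (hf1 p hp) (hx.contMDiffAt.of_le (by norm_num))).continuousWithinAt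
  have cwl : ContinuousOn (fun p => w p * laplacian g univ f p) {p | x₀ < x p} := cw.mul cl
  have cwf : ContinuousOn (fun p => w p * gradInner g univ f x p) {p | x₀ < x p} := cw.mul cfx
  have i1 := integrable_of_support_subset (μ := volMeasure g) hxc hc hψ.continuous hs ha cwl
  have i2 := integrable_of_support_subset (μ := volMeasure g) hxc hc hψ.continuous hs ha cfw
  have i3 := integrable_of_support_subset (μ := volMeasure g) hxc hc (hψ.continuous_deriv (by simp))
    (support_deriv_subset.trans htsψ) ha cwf
  have e1 : ∫ p, φ p * laplacian g univ f p ∂(volMeasure g) =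
      ∫ p, ψ (x p) * (w p * laplacian g univ f p) ∂(volMeasure g) :=
    integral_congr_ae (Eventually.of_forall fun p => mul_assoc _ _ _)
  have e2 : ∫ p, gradInner g univ f φ p ∂(volMeasure g) =
      ∫ p, ψ (x p) * gradInner g univ f w p ∂(volMeasure g) +
        ∫ p, deriv ψ (x p) * (w p * gradInner g univ f x p) ∂(volMeasure g) := by
    rw [← integral_add i2 i3]
    exact integral_congr_ae (Eventually.of_forall hgrad)
  have e3 : ∫ p, ψ (x p) * (gradInner g univ f w p + w p * laplacian g univ f p) ∂(volMeasure g) =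
      ∫ p, ψ (x p) * gradInner g univ f w p ∂(volMeasure g) +
        ∫ p, ψ (x p) * (w p * laplacian g univ f p) ∂(volMeasure g) := by
    rw [← integral_add i2 i1]
    exact integral_congr_ae (Eventually.of_forall fun p => mul_add _ _ _)
  rw [e1, e2] at hgreen
  rw [e3]
  linarith

end

section

variable {n : ℕ} {X : Type*} [TopologicalSpace X] [ChartedSpace (EuclideanSpace ℝ (Fin n)) X]
  [IsManifold (𝓡 n) ∞ X]

/-! ### Weakly conical ends -/

variable {g : C1Metric n X} {r : X → ℝ} {R₀ : ℝ}

theorem IsWeaklyConicalEnd.isCompact_shell (hX : IsWeaklyConicalEnd g r R₀) {a b : ℝ}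
    (ha : R₀ < a) : IsCompact {p | a ≤ r p ∧ r p ≤ b} := by
  have hK : IsCompact {y : Ioi R₀ | a ≤ (y : ℝ) ∧ (y : ℝ) ≤ b} := by
    rw [Subtype.isCompact_iff]
    have : (Subtype.val '' {y : Ioi R₀ | a ≤ (y : ℝ) ∧ (y : ℝ) ≤ b}) = Icc a b := by
      ext t
      constructor
      · rintro ⟨y, hy, rfl⟩; exact hy
      · intro ht; exact ⟨⟨t, ha.trans_le ht.1⟩, ht, rfl⟩
    rw [this]; exact isCompact_Icc
  exact hX.proper.isCompact_preimage hK

theorem IsWeaklyConicalEnd.one_lt (hX : IsWeaklyConicalEnd g r R₀) (p : X) : 1 < r p :=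
  hX.one_le.trans_lt (hX.lt p)

theorem IsWeaklyConicalEnd.half_le_gradNorm (hX : IsWeaklyConicalEnd g r R₀) (p : X) :
    1 / 2 ≤ gradNorm g univ r p := by
  obtain ⟨Λ, -, h⟩ := hX.conical
  obtain ⟨h1, h2, -⟩ := h p
  linarith [(abs_le.1 (h1.trans h2)).1]

theorem IsWeaklyConicalEnd.gradInner_sq (hX : IsWeaklyConicalEnd g r R₀) (u : X → ℝ) (p : X) :
    gradInner g univ u (fun q => r q ^ 2) p = 2 * r p * gradInner g univ u r p := by
  rw [gradInner_univ, chartDiff_sq (hX.contMDiff.contMDiffAt.mdifferentiableAt (by norm_num)),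
    coInner_smul_right, gradInner_univ]

theorem IsWeaklyConicalEnd.gradInner_sq_self (hX : IsWeaklyConicalEnd g r R₀) (p : X) :
    gradInner g univ (fun q => r q ^ 2) (fun q => r q ^ 2) p =
      4 * r p ^ 2 * gradNorm g univ r p ^ 2 := by
  rw [hX.gradInner_sq, gradInner_univ_comm, hX.gradInner_sq, gradNorm_univ_sq]
  ring

theorem IsWeaklyConicalEnd.continuous_gradNorm (hX : IsWeaklyConicalEnd g r R₀) :
    Continuous (gradNorm g univ r) := by
  have h1 : ContMDiff (𝓡 n) 𝓘(ℝ, ℝ) 1 r := hX.contMDiff.of_le (by norm_num)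
  exact (continuous_iff_continuousAt.2 fun p =>
    gradInner_continuousAt g h1.contMDiffAt h1.contMDiffAt).sqrt

theorem closedEnd_mem_nhds (hr : Continuous r) {R : ℝ} {p : X} (hp : R < r p) :
    closedEnd r R ∈ 𝓝 p :=
  mem_of_superset ((isOpen_lt continuous_const hr).mem_nhds hp) fun q hq => show R ≤ r q from
    le_of_lt (show R < r q from hq)

/-- The energy estimates on shells apply to the squared radius `r²` on a weakly conical end. -/
theorem IsWeaklyConicalEnd.exists_shellSystem [T2Space X] [SigmaCompactSpace X] [MeasurableSpace X]
    [BorelSpace X] (hX : IsWeaklyConicalEnd g r R₀) {R : ℝ} (hR : R₀ < R) {lam M : ℝ} {u : X → ℝ}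
    (hu : ContMDiffOn (𝓡 n) 𝓘(ℝ, ℝ) 2 u (closedEnd r R))
    (heq : ∀ p ∈ closedEnd r R, |driftPlus g r 0 (closedEnd r R) u p + lam * u p| ≤
      M * (r p)⁻¹ * (|u p| + gradNorm g (closedEnd r R) u p)) :
    ∃ C, ShellSystem (volMeasure g) (fun p => r p ^ 2) u
      (gradInner g univ (fun p => r p ^ 2) fun p => r p ^ 2)
      (gradInner g univ u fun p => r p ^ 2) (gradInner g univ u u)
      (laplacian g univ fun p => r p ^ 2) (laplacian g univ u) (R ^ 2) C n lam := by
  obtain ⟨Λ, hΛ, hcon⟩ := hX.conical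
  have hR0 : 0 < R := by linarith [hX.one_le]
  have hr0 : ∀ p, 0 < r p := fun p => by linarith [hX.one_lt p]
  have hlt : ∀ p, R ^ 2 < r p ^ 2 → R < r p := fun p hp => lt_of_pow_lt_pow_left₀ 2 (hr0 p).le hp
  have hxs : ContMDiff (𝓡 n) 𝓘(ℝ, ℝ) 2 fun p => r p ^ 2 := hX.contMDiff.pow 2
  have hrc : Continuous r := hX.contMDiff.continuous
  have hcomp : ∀ a b, R ^ 2 < a → IsCompact {p | a ≤ r p ^ 2 ∧ r p ^ 2 ≤ b} := fun a b ha => by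
    have h1 : {p | a ≤ r p ^ 2 ∧ r p ^ 2 ≤ b} = {p | √a ≤ r p ∧ r p ≤ √b} := by
      ext p
      exact and_congr (Real.sqrt_le_left (hr0 p).le).symm (Real.le_sqrt' (hr0 p)).symm
    rw [h1]
    exact hX.isCompact_shell (hR.trans (Real.lt_sqrt_of_sq_lt ha))
  have hu2 : ∀ p, R ^ 2 < r p ^ 2 → ContMDiffAt (𝓡 n) 𝓘(ℝ, ℝ) 2 u p := fun p hp =>
    hu.contMDiffAt (closedEnd_mem_nhds hrc (hlt p hp))
  have hu1 : ∀ p, R ^ 2 < r p ^ 2 → ContMDiffAt (𝓡 n) 𝓘(ℝ, ℝ) 1 u p := fun p hp =>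
    (hu2 p hp).of_le (by norm_num)
  have hx1 : ∀ p, ContMDiffAt (𝓡 n) 𝓘(ℝ, ℝ) 1 (fun p => r p ^ 2) p := fun p =>
    hxs.contMDiffAt.of_le (by norm_num)
  have hΩ : IsOpen {p | R ^ 2 < r p ^ 2} := isOpen_lt continuous_const hxs.continuous
  have hn : 0 ≤ √(n : ℝ) := Real.sqrt_nonneg _
  have hC1 : 10 * Λ ≤ 10 * Λ + √n * Λ + |M| := by
    have : 0 ≤ √n * Λ + |M| := by positivity
    linarith
  have hC2 : √n * Λ ≤ 10 * Λ + √n * Λ + |M| := by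
    have : 0 ≤ 10 * Λ + |M| := by positivity
    linarith
  have hC3 : |M| ≤ 10 * Λ + √n * Λ + |M| := by
    have : 0 ≤ 10 * Λ + √n * Λ := by positivity
    linarith
  refine ⟨10 * Λ + √n * Λ + |M|, ?_⟩
  constructor
  · positivity
  · exact hxs.continuous
  · exact hcomp
  · exact fun p hp => (hu2 p hp).continuousAt.continuousWithinAt
  · exact fun p hp => (gradInner_continuousAt g (hx1 p) (hx1 p)).continuousWithinAt
  · exact fun p hp => (gradInner_continuousAt g (hu1 p hp) (hx1 p)).continuousWithinAt
  · exact fun p hp => (gradInner_continuousAt g (hu1 p hp) (hu1 p hp)).continuousWithinAt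
  · exact continuousOn_laplacian g hΩ fun p _ => hxs.contMDiffAt
  · exact continuousOn_laplacian g hΩ hu2
  · intro ψ a b hψ hs ha
    have h := integral_deriv_comp_mul_gradInner g (w := fun p => u p ^ 2) hxs hcomp
      (fun p _ => hxs.contMDiffAt) (fun p hp => (hu1 p hp).pow 2) hψ hs ha
    have e1 : ∫ p, deriv ψ (r p ^ 2) * (gradInner g univ (fun p => r p ^ 2) (fun p => r p ^ 2) p *
        u p ^ 2) ∂(volMeasure g) = ∫ p, deriv ψ (r p ^ 2) * (u p ^ 2 *
        gradInner g univ (fun p => r p ^ 2) (fun p => r p ^ 2) p) ∂(volMeasure g) :=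
      integral_congr_ae (Eventually.of_forall fun p => by dsimp only; ring)
    rw [e1, h]
    congr 1
    refine integral_congr_ae (Eventually.of_forall fun p => ?_)
    dsimp only
    by_cases hp : ψ (r p ^ 2) = 0
    · rw [hp]; ring
    · have hp' : R ^ 2 < r p ^ 2 := ha.trans_le (hs hp).1
      rw [gradInner_univ, chartDiff_sq ((hu1 p hp').mdifferentiableAt (by norm_num)),
        coInner_smul_right, gradInner_univ, coInner_comm (metricAt_isSymm g p)]
      ring
  · intro ψ a b hψ hs ha
    exact integral_deriv_comp_mul_gradInner g hxs hcomp hu2 hu1 hψ hs ha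
  · exact fun p _ => gradInner_univ_self_nonneg g u p
  · intro p _
    rw [mul_comm]
    exact gradInner_univ_sq_le g _ _ p
  · intro p _
    obtain ⟨h1, h2, -⟩ := hcon p
    have hrp := hr0 p
    rw [hX.gradInner_sq_self]
    set q := gradNorm g univ r p
    have h3 := abs_le.1 (h1.trans h2)
    have e : 4 * r p ^ 2 * q ^ 2 - 4 * r p ^ 2 = 4 * r p ^ 2 * ((q + 1) * (q - 1)) := by ring
    rw [e, abs_mul, abs_of_pos (by positivity : 0 < 4 * r p ^ 2), abs_mul,
      abs_of_pos (by linarith : 0 < q + 1)]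
    calc 4 * r p ^ 2 * ((q + 1) * |q - 1|) ≤ 4 * r p ^ 2 * (5 / 2 * (Λ / r p ^ 4)) := by
          gcongr; linarith
      _ = 10 * Λ / r p ^ 2 := by field_simp; ring
      _ ≤ _ := by gcongr
  · intro p _
    obtain ⟨-, -, h3, -⟩ := hcon p
    calc _ ≤ √n * tensorNorm (metricAt g p)
          (hess g univ (fun q => r q ^ 2) p - (2 : ℝ) • metricAt g p) := abs_laplacian_sub_le g _ p 2
      _ ≤ √n * (Λ / r p ^ 2) := by gcongr; exact h3
      _ = √n * Λ / r p ^ 2 := by ring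
      _ ≤ _ := by gcongr
  · intro p hp
    have hrp := hr0 p
    have hnh := closedEnd_mem_nhds hrc (hlt p hp)
    have h := heq p (hlt p hp).le
    rw [driftPlus, laplacian_of_mem_nhds g hnh, gradInner_of_mem_nhds g hnh,
      gradNorm_of_mem_nhds g hnh, gradInner_univ_comm] at h
    have hn0 : 0 ≤ gradNorm g univ u p := Real.sqrt_nonneg _
    rw [hX.gradInner_sq, Real.sqrt_sq hrp.le]
    have e : laplacian g univ u p + 2 * r p * gradInner g univ u r p / 4 + lam * u p =
        laplacian g univ u p + r p / 2 * gradInner g univ u r p +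
          0 / r p * gradInner g univ u r p + lam * u p := by ring
    rw [e]
    refine h.trans ?_
    rw [← div_eq_mul_inv]
    refine mul_le_mul_of_nonneg_right ?_ (by positivity)
    gcongr
    exact (le_abs_self M).trans hC3

end

/-! ### From boundary norms to shell averages -/

section

theorem rpow_le_of_mem_Icc {y s γ : ℝ} (hs : 0 < s) (h1 : s / 2 ≤ y) (h2 : y ≤ 2 * s) :
    y ^ γ ≤ 2 ^ |γ| * s ^ γ := by
  have hy : 0 < y := by linarith
  rcases le_or_gt 0 γ with hγ | hγ
  · rw [abs_of_nonneg hγ, ← Real.mul_rpow (by norm_num) hs.le]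
    exact Real.rpow_le_rpow hy.le h2 hγ
  · rw [abs_of_neg hγ]
    calc y ^ γ ≤ (s / 2) ^ γ := Real.rpow_le_rpow_of_nonpos (by positivity) h1 hγ.le
      _ = 2 ^ (-γ) * s ^ γ := by
        rw [Real.div_rpow hs.le (by norm_num), Real.rpow_neg (by norm_num)]; ring

theorem bump_le_one (t : ℝ) : bump t ≤ 1 :=
  pow_le_one₀ (ContDiffBump.nonneg _) (ContDiffBump.le_one _)

theorem sqrt_add_one_sub_sqrt_le {s : ℝ} (hs : 1 < s) : √(s + 1) - √(s - 1) ≤ 2 / √s := by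
  have h0 : 0 < √s := Real.sqrt_pos.2 (by linarith)
  have h1 := Real.sq_sqrt (show 0 ≤ s + 1 by linarith)
  have h2 := Real.sq_sqrt (show 0 ≤ s - 1 by linarith)
  have h3 : √s ≤ √(s + 1) := Real.sqrt_le_sqrt (by linarith)
  have h4 : √(s - 1) ≤ √(s + 1) := Real.sqrt_le_sqrt (by linarith)
  have h5 := Real.sqrt_nonneg (s - 1)
  rw [le_div_iff₀ h0]
  calc (√(s + 1) - √(s - 1)) * √s ≤ (√(s + 1) - √(s - 1)) * (√(s + 1) + √(s - 1)) :=
        mul_le_mul_of_nonneg_left (by linarith) (by linarith)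
    _ = 2 := by linear_combination h1 - h2

variable {m : ℕ} {X : Type*} [TopologicalSpace X] [ChartedSpace (EuclideanSpace ℝ (Fin (m + 1))) X]
  [IsManifold (𝓡 (m + 1)) ∞ X] [MeasurableSpace X] [BorelSpace X]
  {g : C1Metric (m + 1) X} {r u : X → ℝ} {R₀ R : ℝ}

theorem areaMeasure_level_ae (g : C1Metric (m + 1) X) (hr : Continuous r) (t : ℝ) :
    ∀ᵐ p ∂(areaMeasure g m {q | r q = t}), r p = t :=
  areaMeasure_compl g m (isClosed_eq hr continuous_const).measurableSet

/-- On a level set of finite `u² |∇r|`-mass the boundary norm is a genuine integral. -/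
theorem lintegral_level_eq_boundaryB (hX : IsWeaklyConicalEnd g r R₀)
    (hu : ContinuousOn u {p | R < r p}) {t : ℝ} (ht : R < t)
    (hfin : ∫⁻ p, ENNReal.ofReal (u p ^ 2 * gradNorm g univ r p)
      ∂(areaMeasure g m {q | r q = t}) ≠ ⊤) :
    ∫⁻ p, ENNReal.ofReal (u p ^ 2 * gradNorm g univ r p) ∂(areaMeasure g m {q | r q = t}) =
      ENNReal.ofReal (boundaryB g r u t) := by
  have hrc : Continuous r := hX.contMDiff.continuous
  have hae : ∀ᵐ p ∂(areaMeasure g m {q | r q = t}), p ∈ {p | R < r p} := by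
    filter_upwards [areaMeasure_level_ae g hrc t] with p hp
    rwa [hp]
  have hmeas : AEStronglyMeasurable (fun p => u p ^ 2 * gradNorm g univ r p)
      (areaMeasure g m {q | r q = t}) := by
    rw [← Measure.restrict_eq_self_of_ae_mem hae]
    exact (((hu.pow 2).mul hX.continuous_gradNorm.continuousOn).aemeasurable
      (isOpen_lt continuous_const hrc).measurableSet).aestronglyMeasurable
  have h0 : 0 ≤ᵐ[areaMeasure g m {q | r q = t}] fun p => u p ^ 2 * gradNorm g univ r p :=
    Eventually.of_forall fun p => mul_nonneg (sq_nonneg _) (Real.sqrt_nonneg _)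
  have e : boundaryB g r u t = (∫⁻ p, ENNReal.ofReal (u p ^ 2 * gradNorm g univ r p)
      ∂(areaMeasure g m {q | r q = t})).toReal := integral_eq_lintegral_of_nonneg_ae h0 hmeas
  rw [e, ENNReal.ofReal_toReal hfin]

/-- The decay of the boundary norm passes to the smoothed shell averages of `|∇r²|² u²`: by the coarea
formula these are averages of `4 t² B(t)` over the interval `√(s - 1) ≤ t ≤ √(s + 1)`, whose length
is `O(s^{-1/2})`. -/
theorem integral_bump_isLittleO [T2Space X] [SecondCountableTopology X]
    (hX : IsWeaklyConicalEnd g r R₀) (hR : R₀ < R) {lam : ℝ} (hu : ContinuousOn u {p | R < r p})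
    (hint : ∀ s, R ^ 2 + 1 < s → Integrable (fun p => bump (r p ^ 2 - s) *
      (gradInner g univ (fun p => r p ^ 2) (fun p => r p ^ 2) p * u p ^ 2)) (volMeasure g))
    (hB : (fun ρ : ℝ => boundaryB g r u ρ) =o[atTop]
      fun ρ : ℝ => ρ ^ (-4 * lam + ((m + 1 : ℕ) : ℝ) - 1)) :
    (fun s => ∫ p, bump (r p ^ 2 - s) * (gradInner g univ (fun p => r p ^ 2) (fun p => r p ^ 2) p *
      u p ^ 2) ∂(volMeasure g)) =o[atTop] fun s => s ^ (-2 * lam + ((m + 1 : ℕ) : ℝ) / 2) := by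
  set β := -4 * lam + ((m + 1 : ℕ) : ℝ) - 1 with hβ
  have hrc : Continuous r := hX.contMDiff.continuous
  have hR0 : 0 < R := by linarith [hX.one_le]
  have hr0 : ∀ p, 0 < r p := fun p => by linarith [hX.one_lt p]
  rw [isLittleO_iff]
  intro c hc
  -- `t ^ β ≤ κ s ^ (β / 2)` for all `t` with `|t² - s| ≤ 1`
  set κ := (2 : ℝ) ^ |β / 2| with hκ
  have hκ0 : 0 < κ := by positivity
  set ε := c / (16 * κ) with hε
  have hε0 : 0 < ε := by positivity
  obtain ⟨T, hT⟩ := eventually_atTop.1 (hB.bound hε0)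
  filter_upwards [eventually_gt_atTop (R ^ 2 + 1), eventually_ge_atTop 2,
    eventually_ge_atTop (T ^ 2 + 1)] with s hsR hs2 hsT
  have hs0 : 0 < s := by linarith
  set L : ℝ → ℝ≥0∞ := fun t => ∫⁻ p, ENNReal.ofReal (u p ^ 2 * gradNorm g univ r p)
    ∂(areaMeasure g m {q | r q = t}) with hL
  set w : ℝ → ℝ := fun t => bump (t ^ 2 - s) * (4 * t ^ 2) with hw
  have hw0 : ∀ t, 0 ≤ w t := fun t => mul_nonneg (bump_nonneg _) (by positivity)
  set F : X → ℝ≥0∞ := fun p => ENNReal.ofReal (w (r p) * (u p ^ 2 * gradNorm g univ r p)) with hF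
  have hFc : Continuous fun p => w (r p) * (u p ^ 2 * gradNorm g univ r p) := by
    have hwc : Continuous fun p => w (r p) :=
      (contDiff_bump.continuous.comp ((hrc.pow 2).sub continuous_const)).mul
        (continuous_const.mul (hrc.pow 2))
    refine continuous_mul_of_tsupport_subset (isOpen_lt continuous_const hrc) hwc ?_
      ((hu.pow 2).mul hX.continuous_gradNorm.continuousOn)
    have hcl : IsClosed {p | s - 1 ≤ r p ^ 2} := isClosed_le continuous_const (hrc.pow 2)
    refine (closure_minimal (fun p hp => ?_) hcl).trans fun p (hp : s - 1 ≤ r p ^ 2) => ?_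
    · exact (support_bump_sub_subset s (left_ne_zero_of_mul hp)).1
    · exact lt_of_pow_lt_pow_left₀ 2 (hr0 p).le (by linarith)
  have hco := lintegral_coarea g (r := r) (f := F) (hX.contMDiff.of_le (by norm_num))
    (fun p => by linarith [hX.half_le_gradNorm p]) hFc.measurable.ennreal_ofReal
  have hlevel : ∀ t, ∫⁻ p, F p ∂(areaMeasure g m {q | r q = t}) = ENNReal.ofReal (w t) * L t := by
    intro t
    rw [hL, ← lintegral_const_mul' _ _ ENNReal.ofReal_ne_top]
    refine lintegral_congr_ae ?_
    filter_upwards [areaMeasure_level_ae g hrc t] with p hp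
    rw [hF]; dsimp only
    rw [hp, ENNReal.ofReal_mul (hw0 t)]
  simp only [hlevel] at hco
  have hleft : ∫⁻ p, F p * ENNReal.ofReal (gradNorm g univ r p) ∂(volMeasure g) =
      ENNReal.ofReal (∫ p, bump (r p ^ 2 - s) * (gradInner g univ (fun p => r p ^ 2)
        (fun p => r p ^ 2) p * u p ^ 2) ∂(volMeasure g)) := by
    rw [ofReal_integral_eq_lintegral_ofReal (hint s hsR) (Eventually.of_forall fun p =>
      mul_nonneg (bump_nonneg _) (mul_nonneg (gradInner_univ_self_nonneg g _ p) (sq_nonneg _)))]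
    refine lintegral_congr fun p => ?_
    rw [hF]; dsimp only
    have hq0 : 0 ≤ gradNorm g univ r p := Real.sqrt_nonneg _
    rw [← ENNReal.ofReal_mul (mul_nonneg (hw0 _) (mul_nonneg (sq_nonneg _) hq0)),
      hX.gradInner_sq_self]
    congr 1
    rw [hw]; ring
  obtain ⟨hco1, hco2⟩ := hco
  rw [hleft] at hco2
  have hfin : ∀ᵐ t, ENNReal.ofReal (w t) * L t < ⊤ :=
    ae_lt_top' hco1 (by rw [← hco2]; exact ENNReal.ofReal_ne_top)
  set D := 8 * s * (ε * (κ * s ^ (β / 2))) with hD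
  have hD0 : 0 ≤ D := by positivity
  -- The Bochner integral `boundaryB` is `0` on level sets of infinite mass, where it says nothing; by
  -- `hfin` such levels form a null set. Levels `t ≤ 0` are empty.
  have hbound : ∀ᵐ t, ENNReal.ofReal (w t) * L t ≤
      (Icc √(s - 1) √(s + 1)).indicator (fun _ => ENNReal.ofReal D) t := by
    filter_upwards [hfin] with t ht
    by_cases hwt : w t = 0
    · rw [hwt]; simp
    have hmem := support_bump_sub_subset s (left_ne_zero_of_mul hwt)
    rcases le_or_gt t 0 with ht0 | ht0
    · have hLt : L t = 0 := by
        have : {q | r q = t} = ∅ := by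
          ext q
          simp only [mem_ofPred_eq, mem_empty_iff_false, iff_false]
          exact fun h => by linarith [hr0 q]
        have h1 : areaMeasure g m {q | r q = t} = 0 := by
          have h2 := areaMeasure_compl g m (S := ∅) MeasurableSet.empty
          rw [compl_empty, Measure.measure_univ_eq_zero] at h2
          rw [this, h2]
        rw [hL]; dsimp only
        rw [h1]; simp
      rw [hLt]; simp
    · have hmem' : t ∈ Icc √(s - 1) √(s + 1) :=
        ⟨Real.sqrt_le_iff.2 ⟨ht0.le, hmem.1⟩, Real.le_sqrt_of_sq_le hmem.2⟩
      have htR : R < t := lt_of_pow_lt_pow_left₀ 2 ht0.le (by linarith [hmem.1])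
      have htT : T ≤ t := (le_abs_self T).trans
        (abs_le_of_sq_le_sq (by linarith [hmem.1]) ht0.le)
      have hLfin : L t ≠ ⊤ := fun h => by
        rw [h, ENNReal.mul_top (by simpa using (hw0 t).lt_of_ne' hwt)] at ht
        exact lt_irrefl _ ht
      rw [indicator_of_mem hmem', hL]; dsimp only
      rw [lintegral_level_eq_boundaryB hX hu htR hLfin, ← ENNReal.ofReal_mul (hw0 t)]
      refine ENNReal.ofReal_le_ofReal ?_
      have h1 := hT t htT
      rw [Real.norm_of_nonneg (Real.rpow_nonneg ht0.le _)] at h1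
      have h2 : boundaryB g r u t ≤ ε * t ^ β := (le_abs_self _).trans h1
      have h3 : t ^ β ≤ κ * s ^ (β / 2) := by
        have : t ^ β = (t ^ 2) ^ (β / 2) := by
          rw [← Real.rpow_natCast, ← Real.rpow_mul ht0.le]
          congr 1; push_cast; ring
        rw [this]
        exact rpow_le_of_mem_Icc hs0 (by linarith [hmem.1]) (by linarith [hmem.2])
      have h4 : w t ≤ 8 * s := by
        calc w t ≤ 1 * (4 * t ^ 2) := mul_le_mul_of_nonneg_right (bump_le_one _) (by positivity)
          _ ≤ 8 * s := by linarith [hmem.2]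
      calc w t * boundaryB g r u t ≤ w t * (ε * t ^ β) := mul_le_mul_of_nonneg_left h2 (hw0 t)
        _ ≤ 8 * s * (ε * (κ * s ^ (β / 2))) := by gcongr
  have hle : ENNReal.ofReal (∫ p, bump (r p ^ 2 - s) * (gradInner g univ (fun p => r p ^ 2)
      (fun p => r p ^ 2) p * u p ^ 2) ∂(volMeasure g)) ≤ ENNReal.ofReal (D * (2 / √s)) := by
    rw [hco2]
    refine (lintegral_mono_ae hbound).trans ?_
    rw [lintegral_indicator_const measurableSet_Icc, Real.volume_Icc, ← ENNReal.ofReal_mul hD0]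
    exact ENNReal.ofReal_le_ofReal
      (mul_le_mul_of_nonneg_left (sqrt_add_one_sub_sqrt_le (by linarith)) hD0)
  have hle' := (ENNReal.ofReal_le_ofReal_iff (by positivity)).1 hle
  rw [Real.norm_of_nonneg (integral_nonneg fun p => mul_nonneg (bump_nonneg _)
    (mul_nonneg (gradInner_univ_self_nonneg g _ p) (sq_nonneg _))),
    Real.norm_of_nonneg (Real.rpow_nonneg hs0.le _)]
  refine hle'.trans (le_of_eq ?_)
  have e1 : s / √s = s ^ (1 / 2 : ℝ) := by rw [Real.div_sqrt, Real.sqrt_eq_rpow]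
  have e2 : s ^ (-2 * lam + ((m + 1 : ℕ) : ℝ) / 2) = s ^ (β / 2) * s ^ (1 / 2 : ℝ) := by
    rw [← Real.rpow_add hs0]; congr 1; rw [hβ]; ring
  rw [e2, ← e1, hD, hε]
  field_simp
  ring

end

/-! ### The gradient near the boundary of a domain of class `C¹` up to the boundary -/

section

/-- The gradient of a function that is `C¹` up to the boundary of a set `s` is locally bounded on
`s`, boundary points included. -/
theorem exists_nhds_gradInner_le {n : ℕ} {X : Type*} [TopologicalSpace X]
    [ChartedSpace (EuclideanSpace ℝ (Fin n)) X] [IsManifold (𝓡 n) ∞ X] (g : C1Metric n X)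
    {s : Set X} {v : X → ℝ} (hv : ContMDiffOn (𝓡 n) 𝓘(ℝ, ℝ) 1 v s) {q : X} (hq : q ∈ s) :
    ∃ B, ∀ᶠ p in 𝓝 q, s ∈ 𝓝 p → gradInner g univ v v p ≤ B := by
  set φ := extChartAt (𝓡 n) q with hφ
  have h1 := (contMDiffWithinAt_iff.1 (hv q hq)).2
  rw [(𝓡 n).range_eq_univ, inter_univ, ← hφ] at h1
  set t := φ.symm ⁻¹' s with ht
  replace h1 : ContDiffWithinAt ℝ (0 + 1) (v ∘ φ.symm) t (φ q) := by
    rw [zero_add]; exact h1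
  have hy : φ q ∈ t := by
    change φ.symm (φ q) ∈ s
    rwa [φ.left_inv (mem_extChartAt_source q)]
  -- `f'` is a continuous derivative of `v` in the chart, up to the boundary of `t`
  obtain ⟨u', hu', -, -, f', hf', hc⟩ :=
    (contDiffWithinAt_succ_iff_hasFDerivWithinAt' (n := 0) (by simp)).1 h1
  rw [insert_eq_of_mem (show φ q ∈ t from hy)] at hu'
  set H : EuclideanSpace ℝ (Fin n) → ℝ := fun z =>
    ∑ i, ∑ j, (chartGram g q z)⁻¹ i j * f' z (stdVec i) * f' z (stdVec j) with hH
  have hHc : ContinuousWithinAt H t (φ q) := by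
    have hf'c : ContinuousWithinAt f' t (φ q) := hc.continuousWithinAt
    refine tendsto_finsetSum _ fun i _ => tendsto_finsetSum _ fun j _ => ?_
    refine (Tendsto.mul ?_ ?_).mul ?_
    · exact (contDiffAt_inv_entry (fun i j => chartGram_contDiffAt g (mem_extChartAt_target q) i j)
        (chartGram_det_pos g (mem_extChartAt_target q)).ne' i j).continuousAt.continuousWithinAt
    · exact hf'c.clm_apply continuousWithinAt_const
    · exact hf'c.clm_apply continuousWithinAt_const
  have hev : ∀ᶠ z in 𝓝 (φ q), z ∈ t → z ∈ u' ∧ H z < H (φ q) + 1 :=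
    eventually_nhdsWithin_iff.1 ((show ∀ᶠ z in 𝓝[t] (φ q), z ∈ u' from hu').and
      (hHc.eventually (gt_mem_nhds (lt_add_one _))))
  refine ⟨H (φ q) + 1, ?_⟩
  filter_upwards [(continuousAt_extChartAt (I := 𝓡 n) q).eventually hev,
    (isOpen_extChartAt_source (I := 𝓡 n) q).mem_nhds (mem_extChartAt_source q)] with p hp hps hs
  have hz : φ p ∈ φ.target := φ.map_source hps
  have hsymm : φ.symm (φ p) = p := φ.left_inv hps
  have htn : t ∈ 𝓝 (φ p) :=
    (continuousAt_extChartAt_symm'' (I := 𝓡 n) hz).preimage_mem_nhds (by rwa [hsymm])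
  obtain ⟨hpu, hpH⟩ := hp (mem_of_mem_nhds htn)
  have hd : fderiv ℝ (v ∘ φ.symm) (φ p) = f' (φ p) := ((hf' _ hpu).hasFDerivAt htn).fderiv
  have hvp : MDifferentiableAt (𝓡 n) 𝓘(ℝ, ℝ) v p :=
    (hv.contMDiffAt hs).mdifferentiableAt (by norm_num)
  rw [gradInner_eq_coInner g hps hvp hvp]
  refine le_trans (le_of_eq ?_) hpH.le
  rw [coordGradInner, hH]
  simp only [pd, fderivWithin_univ]
  rw [← hφ, hd]

/-! ### Integrability on the whole end -/

theorem exists_rpow_le_mul_exp (a : ℝ) : ∃ K, 0 ≤ K ∧ ∀ t : ℝ, 1 ≤ t →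
    t ^ a ≤ K * Real.exp (t ^ 2 / 20) := by
  obtain ⟨k, hk⟩ := exists_nat_ge a
  refine ⟨k.factorial * 20 ^ k, by positivity, fun t ht => ?_⟩
  have h1 := Real.pow_div_factorial_le_exp (t ^ 2 / 20) (by positivity) k
  rw [div_le_iff₀ (by positivity)] at h1
  calc t ^ a ≤ t ^ (k : ℝ) := Real.rpow_le_rpow_of_exponent_le ht hk
    _ = t ^ k := Real.rpow_natCast _ _
    _ ≤ (t ^ 2) ^ k := pow_le_pow_left₀ (by linarith) (le_self_pow₀ ht (by norm_num)) k
    _ = 20 ^ k * (t ^ 2 / 20) ^ k := by rw [← mul_pow]; congr 1; ring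
    _ ≤ 20 ^ k * (Real.exp (t ^ 2 / 20) * k.factorial) := by gcongr
    _ = _ := by ring

theorem psi_zero (t : ℝ) : Psi 0 t = Real.exp (t ^ 2 / 4) := by simp [Psi]

variable {n : ℕ} {X : Type*} [TopologicalSpace X] [ChartedSpace (EuclideanSpace ℝ (Fin n)) X]
  [IsManifold (𝓡 n) ∞ X] {g : C1Metric n X} {r u : X → ℝ} {R₀ R : ℝ}

theorem phi_nonneg {a t : ℝ} (ht : 0 ≤ t) : 0 ≤ Phi a t :=
  mul_nonneg (Real.rpow_nonneg ht _) (Real.exp_pos _).le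

/-- The exponential weight of `Ψ₀ u` costs `e^{r²/4}`, and a power of `r` costs another
`e^{r²/20}`. -/
theorem IsWeaklyConicalEnd.weighted_energy_le (hX : IsWeaklyConicalEnd g r R₀) {a K : ℝ}
    (hK : ∀ t : ℝ, 1 ≤ t → t ^ a ≤ K * Real.exp (t ^ 2 / 20)) {p : X}
    (hu : MDifferentiableAt (𝓡 n) 𝓘(ℝ, ℝ) u p)
    (hS : 1 ≤ gradInner g univ (fun q => r q ^ 2) (fun q => r q ^ 2) p) :
    ((Psi 0 (r p) * u p) ^ 2 + gradInner g univ (fun q => Psi 0 (r q) * u q)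
      (fun q => Psi 0 (r q) * u q) p) * Phi a (r p) ≤
      3 * K * ((gradInner g univ (fun q => r q ^ 2) (fun q => r q ^ 2) p * u p ^ 2 +
        gradInner g univ u u p) * Real.exp (3 / 10 * r p ^ 2)) := by
  have hr1 := hX.one_lt p
  have hrd : MDifferentiableAt (𝓡 n) 𝓘(ℝ, ℝ) (fun q => r q ^ 2) p :=
    (hX.contMDiff.pow 2).contMDiffAt.mdifferentiableAt (by norm_num)
  set S := gradInner g univ (fun q => r q ^ 2) (fun q => r q ^ 2) p with hSdef
  set Q := gradInner g univ u (fun q => r q ^ 2) p with hQ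
  set P := gradInner g univ u u p with hP
  have hP0 : 0 ≤ P := gradInner_univ_self_nonneg g u p
  have hQS : Q ^ 2 ≤ P * S := gradInner_univ_sq_le g _ _ p
  set e := Real.exp (r p ^ 2 / 4) with he
  have he0 : 0 < e := Real.exp_pos _
  have hθ : HasDerivAt (fun t => Real.exp (t / 4)) (e / 4) (r p ^ 2) :=
    (((hasDerivAt_id (r p ^ 2)).div_const 4).exp).congr_deriv (by simp [he]; ring)
  have hΨ : (fun q => Psi 0 (r q) * u q) = fun q => Real.exp (r q ^ 2 / 4) * u q := by
    funext q; rw [psi_zero]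
  have hexp : MDifferentiableAt (𝓡 n) 𝓘(ℝ, ℝ) (fun q => Real.exp (r q ^ 2 / 4)) p :=
    MDifferentiableAt.comp (I' := 𝓘(ℝ, ℝ)) (g := fun t => Real.exp (t / 4)) p
      hθ.differentiableAt.mdifferentiableAt hrd
  have hd : chartDiff (n := n) (fun q => Psi 0 (r q) * u q) p =
      e • chartDiff u p + (u p * (e / 4)) • chartDiff (fun q => r q ^ 2) p := by
    rw [hΨ, chartDiff_mul hexp hu, chartDiff_comp (f := fun q => r q ^ 2) (θ := fun t => Real.exp (t / 4))
      hθ.differentiableAt hrd, hθ.deriv, smul_smul]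
  have hgrad : gradInner g univ (fun q => Psi 0 (r q) * u q) (fun q => Psi 0 (r q) * u q) p =
      e ^ 2 * (P + u p * Q / 2 + S * u p ^ 2 / 16) := by
    have hs := metricAt_isSymm g p
    rw [gradInner_univ, hd, coInner_add_right, coInner_smul_right, coInner_smul_right,
      coInner_comm hs _ (chartDiff u p), coInner_comm hs _ (chartDiff (fun q => r q ^ 2) p),
      coInner_add_right, coInner_add_right, coInner_smul_right, coInner_smul_right,
      coInner_smul_right, coInner_smul_right, coInner_comm hs (chartDiff (fun q => r q ^ 2) p)
      (chartDiff u p)]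
    rw [hP, hQ, hSdef, gradInner_univ, gradInner_univ, gradInner_univ]
    ring
  have hcross : u p * Q / 2 ≤ P + S * u p ^ 2 / 16 := by
    refine (le_abs_self _).trans (abs_le_of_sq_le_sq ?_ (by positivity))
    have h1 := mul_le_mul_of_nonneg_left hQS (sq_nonneg (u p))
    linear_combination 1 / 4 * h1 + sq_nonneg (P - S * u p ^ 2 / 16)
  have hu2 : u p ^ 2 ≤ S * u p ^ 2 := le_mul_of_one_le_left (sq_nonneg _) hS
  have hsum : (Psi 0 (r p) * u p) ^ 2 + gradInner g univ (fun q => Psi 0 (r q) * u q)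
      (fun q => Psi 0 (r q) * u q) p ≤ e ^ 2 * (3 * (S * u p ^ 2 + P)) := by
    rw [hgrad, psi_zero, ← he]
    have h1 : u p ^ 2 + (P + u p * Q / 2 + S * u p ^ 2 / 16) ≤ 3 * (S * u p ^ 2 + P) := by
      linarith [sq_nonneg (u p)]
    calc (e * u p) ^ 2 + e ^ 2 * (P + u p * Q / 2 + S * u p ^ 2 / 16) =
          e ^ 2 * (u p ^ 2 + (P + u p * Q / 2 + S * u p ^ 2 / 16)) := by ring
      _ ≤ _ := by gcongr
  have hPhi : Phi a (r p) ≤ K * Real.exp (r p ^ 2 / 20) * Real.exp (-r p ^ 2 / 4) :=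
    mul_le_mul_of_nonneg_right (hK _ hr1.le) (Real.exp_pos _).le
  have hexps : e ^ 2 * (Real.exp (r p ^ 2 / 20) * Real.exp (-r p ^ 2 / 4)) =
      Real.exp (3 / 10 * r p ^ 2) := by
    rw [he, ← Real.exp_nat_mul, ← Real.exp_add, ← Real.exp_add]
    congr 1; push_cast; ring
  have hE0 : 0 ≤ e ^ 2 * (3 * (S * u p ^ 2 + P)) := by positivity
  calc _ ≤ e ^ 2 * (3 * (S * u p ^ 2 + P)) *
        (K * Real.exp (r p ^ 2 / 20) * Real.exp (-r p ^ 2 / 4)) :=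
        mul_le_mul hsum hPhi (phi_nonneg (by linarith)) hE0
    _ = 3 * K * ((S * u p ^ 2 + P) *
        (e ^ 2 * (Real.exp (r p ^ 2 / 20) * Real.exp (-r p ^ 2 / 4)))) := by ring
    _ = _ := by rw [hexps]

variable [MeasurableSpace X] [BorelSpace X]

/-- Energies weighted by powers of `r` are finite on bounded parts of the end, up to the boundary. -/
theorem IsWeaklyConicalEnd.lintegral_compact_lt_top [T2Space X] (hX : IsWeaklyConicalEnd g r R₀)
    (hR : R₀ < R) {v : X → ℝ} (hv : ContMDiffOn (𝓡 n) 𝓘(ℝ, ℝ) 2 v (closedEnd r R)) (a b : ℝ) :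
    ∫⁻ p in {p | R ≤ r p ∧ r p ≤ b} ∩ {p | R < r p},
      ENNReal.ofReal ((v p ^ 2 + gradInner g univ v v p) * Phi a (r p)) ∂(volMeasure g) < ⊤ := by
  have := isLocallyFiniteMeasure_volMeasure g
  have hrc : Continuous r := hX.contMDiff.continuous
  have hr0 : ∀ p, 0 < r p := fun p => by linarith [hX.one_lt p]
  have hKm : MeasurableSet {p | R ≤ r p ∧ r p ≤ b} :=
    ((isClosed_le continuous_const hrc).inter (isClosed_le hrc continuous_const)).measurableSet
  set G : X → ℝ≥0∞ := fun p =>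
    ENNReal.ofReal ((v p ^ 2 + gradInner g univ v v p) * Phi a (r p)) with hG
  -- it is enough to bound the measure with density `G` near every point of the compact set
  have hfin : (((volMeasure g).restrict {p | R < r p}).withDensity G) {p | R ≤ r p ∧ r p ≤ b} < ⊤ := by
    refine (hX.isCompact_shell hR).measure_lt_top_of_nhdsWithin fun q hq => ?_
    have hqs : q ∈ closedEnd r R := hq.1
    obtain ⟨B, hB⟩ := exists_nhds_gradInner_le g (hv.of_le (by norm_num)) hqs
    have hvc : ∀ᶠ p in 𝓝 q, p ∈ closedEnd r R → v p ^ 2 < v q ^ 2 + 1 :=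
      eventually_nhdsWithin_iff.1 (((hv.continuousOn q hqs).pow 2).eventually
        (gt_mem_nhds (lt_add_one _)))
    have hPc : ContinuousAt (fun p => Phi a (r p)) q :=
      (hrc.continuousAt.rpow_const (Or.inl (hr0 q).ne')).mul
        (Real.continuous_exp.comp ((hrc.pow 2).neg.div_const 4)).continuousAt
    obtain ⟨V, hV, hVfin⟩ := (volMeasure g).finiteAt_nhds q
    obtain ⟨U, hU, hUo, hqU⟩ := eventually_nhds_iff.1
      (((hB.and hvc).and (hPc.eventually (gt_mem_nhds (lt_add_one _)))).and hV)
    refine ⟨U, mem_nhdsWithin_of_mem_nhds (hUo.mem_nhds hqU), ?_⟩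
    rw [withDensity_apply _ hUo.measurableSet, Measure.restrict_restrict hUo.measurableSet]
    calc ∫⁻ p in U ∩ {p | R < r p}, G p ∂(volMeasure g) ≤ ∫⁻ _ in U ∩ {p | R < r p},
          ENNReal.ofReal ((v q ^ 2 + 1 + B) * (Phi a (r q) + 1)) ∂(volMeasure g) := by
          refine setLIntegral_mono' (hUo.inter (isOpen_lt continuous_const hrc)).measurableSet
            fun p hp => ENNReal.ofReal_le_ofReal ?_
          obtain ⟨⟨⟨h1, h2⟩, h3⟩, -⟩ := hU p hp.1
          have h4 := h1 (closedEnd_mem_nhds hrc hp.2)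
          have h5 := h2 (mem_of_mem_nhds (closedEnd_mem_nhds hrc hp.2))
          have h6 := gradInner_univ_self_nonneg g v p
          exact mul_le_mul (by linarith) h3.le (phi_nonneg (hr0 p).le)
            (by linarith [sq_nonneg (v p)])
      _ = ENNReal.ofReal ((v q ^ 2 + 1 + B) * (Phi a (r q) + 1)) *
          volMeasure g (U ∩ {p | R < r p}) := by rw [setLIntegral_const]
      _ < ⊤ := ENNReal.mul_lt_top ENNReal.ofReal_lt_top
          ((measure_mono fun p hp => (hU p hp.1).2).trans_lt hVfin)
  rwa [withDensity_apply _ hKm, Measure.restrict_restrict hKm] at hfin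

end

/-! ### Decay of the solution -/

section

variable {m : ℕ} {X : Type*} [TopologicalSpace X] [ChartedSpace (EuclideanSpace ℝ (Fin (m + 1))) X]
  [IsManifold (𝓡 (m + 1)) ∞ X] [MeasurableSpace X] [BorelSpace X]
  {g : C1Metric (m + 1) X} {r u : X → ℝ} {R₀ R : ℝ}

/-- The boundary of the end is a null set, by the coarea formula. -/
theorem IsWeaklyConicalEnd.volMeasure_level_eq_zero [SecondCountableTopology X]
    (hX : IsWeaklyConicalEnd g r R₀) (R : ℝ) : volMeasure g {p | r p = R} = 0 := by
  have hrc : Continuous r := hX.contMDiff.continuous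
  have hm : MeasurableSet {p | r p = R} := (isClosed_eq hrc continuous_const).measurableSet
  have hco := (lintegral_coarea g (r := r) (f := {p | r p = R}.indicator 1)
    (hX.contMDiff.of_le (by norm_num)) (fun p => by linarith [hX.half_le_gradNorm p])
    (measurable_one.indicator hm)).2
  have hzero : ∫⁻ t, ∫⁻ p, {p | r p = R}.indicator 1 p ∂(areaMeasure g m {q | r q = t}) = 0 := by
    have hne : ∀ᵐ t : ℝ, t ≠ R := compl_mem_ae_iff.2 (measure_singleton R)
    refine (lintegral_congr_ae ?_).trans lintegral_zero
    filter_upwards [hne] with t ht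
    refine (lintegral_congr_ae ?_).trans lintegral_zero
    filter_upwards [areaMeasure_level_ae g hrc t] with p hp
    have hn : p ∉ {p | r p = R} := fun h => ht (hp.symm.trans h)
    rw [indicator_of_notMem hn]
  rw [hzero] at hco
  have hle : ENNReal.ofReal (1 / 2) * volMeasure g {p | r p = R} ≤ 0 := by
    rw [← hco, ← lintegral_indicator_const hm]
    refine lintegral_mono fun p => ?_
    by_cases hp : p ∈ {p | r p = R}
    · rw [indicator_of_mem hp, indicator_of_mem hp, Pi.one_apply, one_mul]
      exact ENNReal.ofReal_le_ofReal (hX.half_le_gradNorm p)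
    · rw [indicator_of_notMem hp]; exact zero_le
  have h0 := le_antisymm hle zero_le
  rcases mul_eq_zero.1 h0 with h | h
  · norm_num at h
  · exact h

/-- The decay theorem in dimension `m + 1`: a solution whose boundary norm is `o(ρ^{-4 lam + m})` decays
so fast that `Ψ₀ u` has finite weighted energy for every polynomial weight. -/
theorem memC2Weighted_of_isLittleO [T2Space X] [SecondCountableTopology X]
    (hX : IsWeaklyConicalEnd g r R₀) (hR : R₀ < R) {lam M : ℝ}
    (hu : ContMDiffOn (𝓡 (m + 1)) 𝓘(ℝ, ℝ) 2 u (closedEnd r R))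
    (heq : ∀ p ∈ closedEnd r R, |driftPlus g r 0 (closedEnd r R) u p + lam * u p| ≤
      M * (r p)⁻¹ * (|u p| + gradNorm g (closedEnd r R) u p))
    (hB : (fun ρ : ℝ => boundaryB g r u ρ) =o[atTop]
      fun ρ : ℝ => ρ ^ (-4 * lam + ((m + 1 : ℕ) : ℝ) - 1)) (a : ℝ) :
    MemC2Weighted g r R a fun p => Psi 0 (r p) * u p := by
  have := isLocallyFiniteMeasure_volMeasure g
  have : LocallyCompactSpace X := ChartedSpace.locallyCompactSpace (EuclideanSpace ℝ (Fin (m + 1))) X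
  have hrc : Continuous r := hX.contMDiff.continuous
  have hr0 : ∀ p, 0 < r p := fun p => by linarith [hX.one_lt p]
  have hR0 : 0 < R := by linarith [hX.one_le]
  have hv : ContMDiffOn (𝓡 (m + 1)) 𝓘(ℝ, ℝ) 2 (fun p => Psi 0 (r p) * u p) (closedEnd r R) := by
    have h1 : ContDiff ℝ 2 (Psi 0) := by
      have : Psi 0 = fun t => Real.exp (t ^ 2 / 4) := funext psi_zero
      rw [this]; fun_prop
    exact ((h1.contMDiff.comp hX.contMDiff).contMDiffOn).mul hu
  refine ⟨hv, ?_⟩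
  set v : X → ℝ := fun p => Psi 0 (r p) * u p with hvdef
  set G : X → ℝ≥0∞ := fun p =>
    ENNReal.ofReal ((v p ^ 2 + gradInner g univ v v p) * Phi a (r p)) with hG
  have hΩm : MeasurableSet {p | R < r p} := (isOpen_lt continuous_const hrc).measurableSet
  obtain ⟨C, H⟩ := hX.exists_shellSystem hR hu heq
  have hcont : ContinuousOn u {p | R < r p} := hu.continuousOn.mono fun p hp =>
    mem_of_mem_nhds (closedEnd_mem_nhds hrc hp)
  have ho := integral_bump_isLittleO hX hR hcont (fun s hs => H.integrable_bump
    (H.S_cont.mul (H.u_cont.pow 2)) hs) hB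
  obtain ⟨x₂, hx₂, hx₂C, htail⟩ := H.lintegral_exp_lt_top ho
  obtain ⟨K, hK0, hK⟩ := exists_rpow_le_mul_exp a
  have hGfin : ∫⁻ p in {p | R < r p}, G p ∂(volMeasure g) < ⊤ := by
    -- a bounded part, up to the boundary, and the region of exponential decay
    have hcover : {p | R < r p} ⊆ ({p | R ≤ r p ∧ r p ≤ √x₂} ∩ {p | R < r p}) ∪
        {p | x₂ ≤ r p ^ 2} := fun p hp => by
      rcases le_or_gt x₂ (r p ^ 2) with h | h
      · exact Or.inr h
      · exact Or.inl ⟨⟨le_of_lt hp, Real.le_sqrt_of_sq_le h.le⟩, hp⟩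
    refine (lintegral_mono_set hcover).trans_lt ((lintegral_union_le _ _ _).trans_lt ?_)
    refine ENNReal.add_lt_top.2 ⟨hX.lintegral_compact_lt_top hR hv a _, ?_⟩
    have hm : MeasurableSet {p | x₂ ≤ r p ^ 2} :=
      (isClosed_le continuous_const (hrc.pow 2)).measurableSet
    refine lt_of_le_of_lt (setLIntegral_mono' hm fun p (hp : x₂ ≤ r p ^ 2) => ?_)
      (lt_of_le_of_lt (le_of_eq (lintegral_const_mul' _ _ (ENNReal.ofReal_ne_top (r := 3 * K))))
        (ENNReal.mul_lt_top ENNReal.ofReal_lt_top htail))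
    rw [← ENNReal.ofReal_mul (by positivity)]
    refine ENNReal.ofReal_le_ofReal ?_
    have hpx : R ^ 2 < r p ^ 2 := hx₂.trans_le hp
    have hpR : R < r p := lt_of_pow_lt_pow_left₀ 2 (hr0 p).le hpx
    have hS := (shell_S_bounds H.C_nonneg (s := r p ^ 2) (by linarith) (by simp)
      (H.S_bound p hpx)).2.1
    exact hX.weighted_energy_le hK
      ((hu.contMDiffAt (closedEnd_mem_nhds hrc hpR)).mdifferentiableAt (by norm_num))
      (by linarith [H.C_nonneg])
  have hset : closedEnd r R =ᵐ[volMeasure g] {p | R < r p} := by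
    have h0 := hX.volMeasure_level_eq_zero R
    have hne : ∀ᵐ p ∂(volMeasure g), r p ≠ R := by
      rw [ae_iff]; simpa using h0
    filter_upwards [hne] with p hp
    exact propext ⟨fun h => lt_of_le_of_ne h (Ne.symm hp), fun h => le_of_lt h⟩
  rw [weightedNormSq, setLIntegral_congr hset, setLIntegral_congr hset]
  have hPhi : ∀ p, 0 ≤ Phi a (r p) := fun p => phi_nonneg (hr0 p).le
  refine ENNReal.add_lt_top.2 ⟨lt_of_le_of_lt (setLIntegral_mono' hΩm fun p hp => ?_) hGfin,
    lt_of_le_of_lt (setLIntegral_mono' hΩm fun p hp => ?_) hGfin⟩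
  · refine ENNReal.ofReal_le_ofReal (mul_le_mul_of_nonneg_right ?_ (hPhi p))
    linarith [gradInner_univ_self_nonneg g v p]
  · rw [gradNorm_of_mem_nhds g (closedEnd_mem_nhds hrc hp), gradNorm_univ_sq]
    refine ENNReal.ofReal_le_ofReal (mul_le_mul_of_nonneg_right ?_ (hPhi p))
    linarith [sq_nonneg (v p)]

end

end ConicalEnd

end

theorem theorem9p1 {n : ℕ} {X : Type*} [TopologicalSpace X] [T2Space X]
    [SecondCountableTopology X] [ChartedSpace (EuclideanSpace ℝ (Fin n)) X]
    [IsManifold (𝓡 n) ∞ X] [MeasurableSpace X] [BorelSpace X]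
    (g : ConicalEnd.C1Metric n X) (r : X → ℝ) (R₀ : ℝ)
    (hX : ConicalEnd.IsWeaklyConicalEnd g r R₀)
    (R : ℝ) (hR : R₀ < R) (lam M : ℝ) (u : X → ℝ)
    (hu : ContMDiffOn (𝓡 n) 𝓘(ℝ, ℝ) 2 u (ConicalEnd.closedEnd r R))
    (heq : ∀ p ∈ ConicalEnd.closedEnd r R,
      |ConicalEnd.driftPlus g r 0 (ConicalEnd.closedEnd r R) u p + lam * u p| ≤
        M * (r p)⁻¹ * (|u p| + ConicalEnd.gradNorm g (ConicalEnd.closedEnd r R) u p))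
    (hB : (fun ρ : ℝ => ConicalEnd.boundaryB g r u ρ) =o[atTop]
      fun ρ : ℝ => ρ ^ (-4 * lam + n - 1)) :
    ∀ m' : ℝ, ConicalEnd.MemC2Weighted g r R m' (fun p => ConicalEnd.Psi 0 (r p) * u p) := by
  obtain ⟨m, rfl⟩ : ∃ m, n = m + 1 := ⟨n - 1, by have := hX.two_le_dim; omega⟩
  exact ConicalEnd.memC2Weighted_of_isLittleO hX hR hu heq hB
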